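/- Let $T>0$ and let $\mathbb T^3=(\mathbb R/\mathbb Z)^3$. For $1\le q,p\le\infty$ write $L^q_t(L^p_x)=L^q([0,T];L^p(\mathbb T^3))$ for the space of (classes of) measurable real functions on $[0,T]\times\mathbb T^3$ with $\big\|\,t\mapsto\|f(t,\cdot)\|_{L^p(\mathbb T^3)}\big\|_{L^q(0,T)}<\infty$, and similarly $L^q_t(W^{1,p}_x)$ and $L^q_t(H^{\sigma}_x)$, $\sigma\in\mathbb Z$; a prime denotes the conjugate exponent. Weak-$\star$ convergence in $L^q_t(L^p_x)$ means that the sequence and its limit lie in this space and that convergence holds against every element of $L^{q'}_t(L^{p'}_x)$; weak-$\star$ convergence in $L^q_t(W^{1,p}_x)$ means that the functions and their weak spatial derivatives converge weakly-$\star$ in $L^q_t(L^p_x)$ to the limit and its weak spatial derivatives. Let $q\in[1,\infty)$, $p\in[1,3)$, $1\le s<p^\star:=\frac{3p}{3-p}$, $r\in(q,\infty]$ and $m\in\mathbb Z$. Let $(a_\varepsilon)_{\varepsilon>0}$ and $(b_\varepsilon)_{\varepsilon>0}$ be families such that, as $\varepsilon\to0^+$, \begin{align*} a_\varepsilon&\rightharpoonup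 a\quad\text{weakly-}\star\text{ in }L^q_t(W^{1,p}_x)\text{ and weakly-}\star\text{ in }L^r_t(L^p_x),\\ b_\varepsilon&\rightharpoonup b\quad\text{weakly-}\star\text{ in }L^{q'}_t(L^{s'}_x), \end{align*} and such that the distributional time derivatives $(\partial_t b_\varepsilon)_{\varepsilon>0}$ on $(0,T)\times\mathbb T^3$ are bounded in $L^1_t(H^{-m}_x)$. Then all $a_\varepsilon b_\varepsilon$ and $ab$ belong to $L^1([0,T]\times\mathbb T^3)$ and, up to a subsequence, $a_\varepsilon b_\varepsilon\rightharpoonup ab$ in the sense of measures: every sequence $\varepsilon_n\to0^+$ has a subsequence $(\varepsilon_{n_k})_k$ such that for all $\theta\in C^0([0,T]\times\mathbb T^3)$, $$\int_0^T\!\!\int_{\mathbb T^3}a_{\varepsilon_{n_k}}b_{\varepsilon_{n_k}}\,\theta\,dx\,dt\;\longrightarrow\;\int_0^T\!\!\int_{\mathbb T^3}a\,b\,\theta\,dx\,dt\qquad(k\to\infty).$$ -/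

import Mathlib

open Set Filter Topology MeasureTheory
open scoped ENNReal NNReal ContDiff

noncomputable section

namespace WeakProduct

/-- The torus `𝕋³ = (ℝ/ℤ)³`. -/
abbrev T3 : Type := UnitAddTorus (Fin 3)

/-- The Lebesgue measure of `𝕋³` (total mass one). -/
def torusMeasure : Measure T3 :=
  Measure.pi fun _ : Fin 3 => (AddCircle.haarAddCircle : Measure UnitAddCircle)

/-- The Lebesgue measure of the time interval `[0, T]`. -/
def timeMeasure (T : ℝ) : Measure ℝ := volume.restrict (Icc 0 T)

/-- The Lebesgue measure of `[0, T] × 𝕋³`. -/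
def stMeasure (T : ℝ) : Measure (ℝ × T3) := (timeMeasure T).prod torusMeasure

/-! ### The spaces `L^q_t(L^p_x)` -/

/-- The norm of `L^q([0, T]; L^p(𝕋³))`, with values in `[0, ∞]`. -/
def mixedNorm (T : ℝ) (q p : ℝ≥0∞) (f : ℝ × T3 → ℝ) : ℝ≥0∞ :=
  eLpNorm (fun t : ℝ => eLpNorm (fun x : T3 => f (t, x)) p torusMeasure) q (timeMeasure T)

/-- `f ∈ L^q([0, T]; L^p(𝕋³))`. -/
def MemMixed (T : ℝ) (q p : ℝ≥0∞) (f : ℝ × T3 → ℝ) : Prop :=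
  AEStronglyMeasurable f (stMeasure T) ∧ mixedNorm T q p f < (⊤ : ℝ≥0∞)

/-- Weak-* convergence of `(u_ε)` to `u` in `L^q_t(L^p_x)` as `ε → 0⁺`: convergence of the
duality brackets with all elements of `L^{q'}_t(L^{p'}_x)`. -/
def TendstoWeakStarMixed (T : ℝ) (q p : ℝ≥0∞) (u : ℝ → ℝ × T3 → ℝ) (u₀ : ℝ × T3 → ℝ) : Prop :=
  (∀ ε : ℝ, 0 < ε → MemMixed T q p (u ε)) ∧ MemMixed T q p u₀ ∧
    ∀ ψ : ℝ × T3 → ℝ, MemMixed T q.conjExponent p.conjExponent ψ →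
      Tendsto (fun ε : ℝ => ∫ z, u ε z * ψ z ∂(stMeasure T)) (𝓝[>] 0)
        (𝓝 (∫ z, u₀ z * ψ z ∂(stMeasure T)))

/-! ### The spaces `L^q_t(W^{1,p}_x)` -/

/-- `φ ∈ C^∞(𝕋³)`: the periodic lift of `φ` to `ℝ³` is smooth. -/
def SmoothTorus (φ : T3 → ℝ) : Prop :=
  ContDiff ℝ ∞ fun y : Fin 3 → ℝ => φ fun i => (y i : UnitAddCircle)

/-- The partial derivative `∂φ/∂x_i` on the torus. -/
def torusPartial (i : Fin 3) (φ : T3 → ℝ) (x : T3) : ℝ :=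
  deriv (fun h : ℝ => φ (x + Pi.single i (h : UnitAddCircle))) 0

/-- `g` is the weak spatial gradient of `a` on `[0, T] × 𝕋³`: for almost every `t ∈ [0, T]` and
each `i`, the function `g i (t, ·)` is the weak derivative `∂_i a(t, ·)` on `𝕋³`. -/
def IsWeakGrad (T : ℝ) (a : ℝ × T3 → ℝ) (g : Fin 3 → ℝ × T3 → ℝ) : Prop :=
  ∀ᵐ t ∂(timeMeasure T), ∀ i : Fin 3, ∀ φ : T3 → ℝ, SmoothTorus φ →
    ∫ x, a (t, x) * torusPartial i φ x ∂torusMeasure = -∫ x, g i (t, x) * φ x ∂torusMeasure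

/-- Weak-* convergence of `(u_ε)` to `u` in `L^q_t(W^{1,p}_x)` as `ε → 0⁺`: the functions `u_ε`,
`u` and their weak spatial gradients belong to `L^q_t(L^p_x)`, and both `u_ε → u` and
`∂_i u_ε → ∂_i u` weakly-* there. -/
def TendstoWeakStarSobolev (T : ℝ) (q p : ℝ≥0∞) (u : ℝ → ℝ × T3 → ℝ) (u₀ : ℝ × T3 → ℝ) : Prop :=
  TendstoWeakStarMixed T q p u u₀ ∧
    ∃ (G : ℝ → Fin 3 → ℝ × T3 → ℝ) (g : Fin 3 → ℝ × T3 → ℝ),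
      (∀ ε : ℝ, 0 < ε → IsWeakGrad T (u ε) (G ε)) ∧ IsWeakGrad T u₀ g ∧
        ∀ i : Fin 3, TendstoWeakStarMixed T q p (fun ε => G ε i) (g i)

/-! ### The spaces `L^1_t(H^{-m}_x)` and the time derivative -/

/-- The norm of `H^σ(𝕋³)`, `σ ∈ ℤ`, with values in `[0, ∞]`. A distribution on `𝕋³` is given by
its family `c` of Fourier coefficients, and it is in `H^σ(𝕋³)` if and only if
`∑_k (1 + |k|²)^σ |c_k|² < ∞`. For `m ∈ ℕ` the space `H^{-m}(𝕋³)` is the dual of `H^m(𝕋³)`. -/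
def sobolevNorm (σ : ℤ) (c : (Fin 3 → ℤ) → ℂ) : ℝ≥0∞ :=
  (∑' k : Fin 3 → ℤ,
    ENNReal.ofReal ((1 + ∑ i, (k i : ℝ) ^ 2) ^ σ) * ‖c k‖ₑ ^ 2) ^ (1 / 2 : ℝ)

/-- The duality bracket between the distribution on `𝕋³` with Fourier coefficients `c` and the
smooth function `φ`. -/
def torusPairing (c : (Fin 3 → ℤ) → ℂ) (φ : T3 → ℝ) : ℂ :=
  ∑' k : Fin 3 → ℤ, c k * UnitAddTorus.mFourierCoeff (fun x : T3 => (φ x : ℂ)) (-k)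

/-- `Φ ∈ C_c^∞((0, T) × 𝕋³)`. -/
def IsTestFunction (T : ℝ) (Φ : ℝ × T3 → ℝ) : Prop :=
  ContDiff ℝ ∞ (fun z : ℝ × (Fin 3 → ℝ) => Φ (z.1, fun i => (z.2 i : UnitAddCircle))) ∧
    HasCompactSupport Φ ∧ tsupport Φ ⊆ Ioo 0 T ×ˢ univ

/-- `∂_t b = w` in the sense of distributions on `(0, T) × 𝕋³`, where `w` is a time-dependent
distribution on `𝕋³` given by its Fourier coefficients. -/
def IsWeakTimeDeriv (T : ℝ) (b : ℝ × T3 → ℝ) (w : ℝ → (Fin 3 → ℤ) → ℂ) : Prop :=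
  ∀ Φ : ℝ × T3 → ℝ, IsTestFunction T Φ →
    ((∫ z, b z * deriv (fun τ : ℝ => Φ (τ, z.2)) z.1 ∂(stMeasure T) : ℝ) : ℂ) =
      -∫ t, torusPairing (w t) (fun x => Φ (t, x)) ∂(timeMeasure T)

/-- `(∂_t b_ε)_{ε > 0}` is bounded in `L^1([0, T]; H^{-m}(𝕋³))`. -/
def TimeDerivBounded (T : ℝ) (m : ℤ) (b : ℝ → ℝ × T3 → ℝ) : Prop :=
  ∃ C : ℝ≥0, ∀ ε : ℝ, 0 < ε → ∃ w : ℝ → (Fin 3 → ℤ) → ℂ,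
    (∀ k, AEStronglyMeasurable (fun t => w t k) (timeMeasure T)) ∧
      ∫⁻ t, sobolevNorm (-m) (w t) ∂(timeMeasure T) ≤ C ∧ IsWeakTimeDeriv T (b ε) w

end WeakProduct

end

/-!
Write `v = a_ε - a`, a sequence tending weakly to zero, and `K_N` for a nonnegative trigonometric
approximate identity on the torus. The increments `K_{N+1} - K_N` are divergences of explicit
vector fields, so Young's inequality bounds `v - K_N * v` in `L^q_t(L^s_x)` by the gradient of `v`
times the tail of a series, which converges exactly because `s` is subcritical. Hence `∫ v b_ε θ`
is close, uniformly in `ε`, to `∫ (K_N * v) b_ε θ`.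

The latter is the pairing of `v(t, y) b_ε(t, x)` with the continuous function
`K_N(x - y) θ(t, x)` of `(t, y, x)`. By Stone–Weierstrass it suffices to test with
`σ(t, y) e^{2πik·x}`, and then the pairing is `∫ γ_ε β_ε dt` with the moment
`γ_ε = ∫ v σ dy`, weakly null and bounded in `L^r` with `r > 1`, and with a Fourier mode `β_ε` of
`b_ε`, whose derivative is bounded in `L¹`. Integration by parts in time moves this derivative
onto the primitives of `γ_ε`, which tend to zero uniformly because `r > 1` makes them
equicontinuous.
-/

noncomputable section

namespace WeakProduct

/-! ### Iterated Lebesgue norms -/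

section LebesgueNorm

variable {α β : Type*} [MeasurableSpace α] [MeasurableSpace β] {τ : Measure α} {μ : Measure β}
  {p p' : ℝ≥0∞}

lemma lintegral_mul_le_eLpNorm_one_mul_eLpNorm_top {f : α → ℝ≥0∞} (hf : AEMeasurable f τ)
    (g : α → ℝ≥0∞) : ∫⁻ x, f x * g x ∂τ ≤ eLpNorm f 1 τ * eLpNorm g ⊤ τ := by
  simp only [eLpNorm_one_eq_lintegral_enorm, eLpNorm_exponent_top, eLpNormEssSup, enorm_eq_self]
  rw [← lintegral_mul_const'' _ hf]
  refine lintegral_mono_ae ?_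
  filter_upwards [ENNReal.ae_le_essSup (μ := τ) g] with x hx
  gcongr

lemma lintegral_mul_le_eLpNorm_mul_eLpNorm [hpp : p.HolderConjugate p'] {f g : α → ℝ≥0∞}
    (hf : AEMeasurable f τ) (hg : AEMeasurable g τ) :
    ∫⁻ x, f x * g x ∂τ ≤ eLpNorm f p τ * eLpNorm g p' τ := by
  rcases eq_or_ne p ⊤ with rfl | hp
  · obtain rfl : p' = 1 := (ENNReal.HolderConjugate.eq_top_iff_eq_one ⊤ p').1 rfl
    simpa only [mul_comm] using lintegral_mul_le_eLpNorm_one_mul_eLpNorm_top hg f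
  rcases eq_or_ne p' ⊤ with rfl | hp'
  · obtain rfl : p = 1 := (ENNReal.HolderConjugate.eq_top_iff_eq_one ⊤ p).1 rfl
    exact lintegral_mul_le_eLpNorm_one_mul_eLpNorm_top hf g
  have hconj := ENNReal.HolderConjugate.toReal_of_ne_top (p := p) (q := p') hp hp'
  simpa [eLpNorm_eq_lintegral_rpow_enorm_toReal, ENNReal.HolderConjugate.ne_zero p p',
    ENNReal.HolderConjugate.ne_zero p' p, hp, hp'] using
    ENNReal.lintegral_mul_le_Lp_mul_Lq τ hconj hf hg

lemma eLpNorm_iSup_of_monotone {f : ℕ → α → ℝ≥0∞} (hf : ∀ n, AEMeasurable (f n) τ)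
    (hmono : ∀ x, Monotone fun n => f n x) :
    eLpNorm (fun x => ⨆ n, f n x) p τ = ⨆ n, eLpNorm (f n) p τ := by
  rcases eq_or_ne p 0 with rfl | hp0
  · simp
  refine le_antisymm ?_ (iSup_le fun n => eLpNorm_mono_enorm fun x => by
    simpa using le_iSup (fun n => f n x) n)
  rcases eq_or_ne p ⊤ with rfl | hp
  · simp only [eLpNorm_exponent_top, eLpNormEssSup, enorm_eq_self]
    refine essSup_le_of_ae_le _ ?_
    filter_upwards [ae_all_iff.2 fun n => ENNReal.ae_le_essSup (μ := τ) (f n)] with x hx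
    exact iSup_mono hx
  · have hpr : 0 < p.toReal := ENNReal.toReal_pos hp0 hp
    have hpow (x : α) : (⨆ n, f n x) ^ p.toReal = ⨆ n, f n x ^ p.toReal :=
      (ENNReal.orderIsoRpow p.toReal hpr).map_iSup fun n => f n x
    simp only [eLpNorm_eq_lintegral_rpow_enorm_toReal hp0 hp, enorm_eq_self, hpow, one_div]
    rw [lintegral_iSup' (fun n => (hf n).pow_const _)
      (ae_of_all _ fun x m n hmn => ENNReal.rpow_le_rpow (hmono x hmn) hpr.le)]
    exact ((ENNReal.orderIsoRpow p.toReal⁻¹ (inv_pos.2 hpr)).map_iSup _).le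

lemma eLpNorm_tsum_le (hp : 1 ≤ p) {f : ℕ → α → ℝ≥0∞} (hf : ∀ j, AEMeasurable (f j) τ) :
    eLpNorm (fun x => ∑' j, f j x) p τ ≤ ∑' j, eLpNorm (f j) p τ := by
  simp only [ENNReal.tsum_eq_iSup_nat]
  rw [eLpNorm_iSup_of_monotone (f := fun n x => ∑ j ∈ Finset.range n, f j x)
    (fun n => Finset.aemeasurable_fun_sum _ fun j _ => hf j)
    (fun x m n hmn => Finset.sum_le_sum_of_subset (Finset.range_mono hmn))]
  gcongr with n
  simpa only [Finset.sum_fn] using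
    eLpNorm_sum_le (s := Finset.range n) (fun j _ => (hf j).aestronglyMeasurable) hp

lemma eLpNorm_mul_const {f : α → ℝ≥0∞} (hf : AEMeasurable f τ) (c : ℝ≥0∞) :
    eLpNorm (fun x => f x * c) p τ = eLpNorm f p τ * c := by
  rcases eq_or_ne p 0 with rfl | hp0
  · simp
  rcases eq_or_ne p ⊤ with rfl | hp
  · simp only [eLpNorm_exponent_top, eLpNormEssSup, enorm_eq_self, mul_comm _ c]
    exact ENNReal.essSup_const_mul
  · have hpr : 0 < p.toReal := ENNReal.toReal_pos hp0 hp
    simp only [eLpNorm_eq_lintegral_rpow_enorm_toReal hp0 hp, enorm_eq_self,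
      ENNReal.mul_rpow_of_nonneg _ _ hpr.le]
    rw [lintegral_mul_const'' _ (hf.pow_const _), ENNReal.mul_rpow_of_nonneg _ _ (by positivity),
      ← ENNReal.rpow_mul, mul_one_div_cancel hpr.ne', ENNReal.rpow_one]

lemma lintegral_ne_top_of_eLpNorm_ne_top [IsFiniteMeasure τ] (hp : 1 ≤ p) {f : α → ℝ≥0∞}
    (hf : AEMeasurable f τ) (hfin : eLpNorm f p τ ≠ ⊤) : ∫⁻ x, f x ∂τ ≠ ⊤ := by
  have h : MemLp f p τ := ⟨hf.aestronglyMeasurable, hfin.lt_top⟩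
  simpa [eLpNorm_one_eq_lintegral_enorm] using (h.mono_exponent hp).2.ne

lemma measurable_essSup_section [SFinite μ] {F : α × β → ℝ≥0∞} (hF : Measurable F) :
    Measurable fun t => essSup (fun x => F (t, x)) μ := by
  refine measurable_of_Iic fun c => ?_
  have h : (fun t => essSup (fun x => F (t, x)) μ) ⁻¹' Iic c
      = {t | μ (Prod.mk t ⁻¹' {z | c < F z}) = 0} := by
    ext t
    have hiff : μ {x | c < F (t, x)} = 0 ↔ ∀ᵐ x ∂μ, F (t, x) ≤ c := by
      simp only [ae_iff, not_le]
    refine Iff.trans ⟨fun h => ?_, fun h => essSup_le_of_ae_le c h⟩ hiff.symm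
    exact (ENNReal.ae_le_essSup fun x => F (t, x)).mono fun x hx => hx.trans h
  rw [h]
  exact measurable_measure_prodMk_left (measurableSet_lt measurable_const hF)
    (measurableSet_singleton 0)

lemma measurable_eLpNorm_section [SFinite μ] (p : ℝ≥0∞) {F : α × β → ℝ≥0∞} (hF : Measurable F) :
    Measurable fun t => eLpNorm (fun x => F (t, x)) p μ := by
  rcases eq_or_ne p 0 with rfl | hp0
  · simp
  rcases eq_or_ne p ⊤ with rfl | hp
  · simpa only [eLpNorm_exponent_top, eLpNormEssSup, enorm_eq_self] using
      measurable_essSup_section hF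
  · simp only [eLpNorm_eq_lintegral_rpow_enorm_toReal hp0 hp, enorm_eq_self]
    exact ((hF.pow_const _).lintegral_prod_right').pow_const _

lemma aemeasurable_eLpNorm_section [SFinite μ] {ε : Type*} [TopologicalSpace ε] [ContinuousENorm ε]
    (p : ℝ≥0∞) {f : α × β → ε} (hf : AEStronglyMeasurable f (τ.prod μ)) :
    AEMeasurable (fun t => eLpNorm (fun x => f (t, x)) p μ) τ := by
  refine ⟨_, measurable_eLpNorm_section (μ := μ) p hf.enorm.measurable_mk, ?_⟩
  filter_upwards [Measure.ae_ae_of_ae_prod hf.enorm.ae_eq_mk] with t ht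
  rw [← eLpNorm_enorm]
  exact eLpNorm_congr_ae ht

/-- The extremal function `f ^ (p - 1) / ‖f‖_p ^ (p - 1)` in the duality between `L^p` and `L^p'`,
for a `[0, ∞]`-valued `f` and a finite exponent `p`. -/
def dualFun (p : ℝ≥0∞) (τ : Measure α) (f : α → ℝ≥0∞) (x : α) : ℝ≥0∞ :=
  f x ^ (p.toReal - 1) * (eLpNorm f p τ ^ (p.toReal - 1))⁻¹

lemma eLpNorm_dualFun_le_one [p.HolderConjugate p'] (hp : p ≠ ⊤) {f : α → ℝ≥0∞}
    (hf : AEMeasurable f τ) : eLpNorm (dualFun p τ f) p' τ ≤ 1 := by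
  unfold dualFun
  rw [eLpNorm_mul_const (hf.pow_const _), ← div_eq_mul_inv]
  refine ENNReal.div_le_of_le_mul ?_
  rw [one_mul]
  rcases eq_or_ne p' ⊤ with rfl | hp'
  · obtain rfl : p = 1 := (ENNReal.HolderConjugate.eq_top_iff_eq_one ⊤ p).1 rfl
    simpa [eLpNormEssSup] using essSup_le_of_ae_le (1 : ℝ≥0∞) (ae_of_all τ fun _ => le_rfl)
  have hconj := ENNReal.HolderConjugate.toReal_of_ne_top (p := p) (q := p') hp hp'
  have hexp : 1 / p'.toReal = 1 / p.toReal * (p.toReal - 1) := by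
    rw [one_div, ← hconj.one_sub_inv, mul_sub_one, one_div, inv_mul_cancel₀ hconj.ne_zero]
  simp only [eLpNorm_eq_lintegral_rpow_enorm_toReal (ENNReal.HolderConjugate.ne_zero p p') hp,
    eLpNorm_eq_lintegral_rpow_enorm_toReal (ENNReal.HolderConjugate.ne_zero p' p) hp',
    enorm_eq_self, ← ENNReal.rpow_mul, hconj.sub_one_mul_conj, hexp, le_refl]

lemma lintegral_mul_dualFun (hp1 : 1 ≤ p) (hp : p ≠ ⊤) {f : α → ℝ≥0∞} (hf : AEMeasurable f τ)
    (hfin : eLpNorm f p τ ≠ ⊤) : ∫⁻ x, f x * dualFun p τ f x ∂τ = eLpNorm f p τ := by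
  have hp0 : p ≠ 0 := (zero_lt_one.trans_le hp1).ne'
  have hpr : 0 < p.toReal := ENNReal.toReal_pos hp0 hp
  have hpr1 : 0 ≤ p.toReal - 1 := by
    simpa using ENNReal.toReal_mono hp hp1
  rcases eq_or_ne (eLpNorm f p τ) 0 with h0 | h0
  · rw [h0, lintegral_eq_zero_iff' (by unfold dualFun; fun_prop)]
    filter_upwards [(eLpNorm_eq_zero_iff hf.aestronglyMeasurable hp0).1 h0] with x hx
    simp [hx]
  have hmul (x : α) : f x * dualFun p τ f x
      = f x ^ p.toReal * (eLpNorm f p τ ^ (p.toReal - 1))⁻¹ := by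
    have h := ENNReal.rpow_add_of_nonneg (x := f x) 1 (p.toReal - 1) zero_le_one hpr1
    rw [add_sub_cancel, ENNReal.rpow_one] at h
    rw [dualFun, ← mul_assoc, h]
  have hpow : ∫⁻ x, f x ^ p.toReal ∂τ = eLpNorm f p τ ^ p.toReal := by
    rw [eLpNorm_eq_lintegral_rpow_enorm_toReal hp0 hp, ← ENNReal.rpow_mul]
    simp [hpr.ne']
  simp only [hmul]
  rw [lintegral_mul_const'' _ (hf.pow_const _), hpow, ← ENNReal.rpow_neg,
    ← ENNReal.rpow_add _ _ h0 hfin]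
  simp

lemma exists_almost_norming_essSup [IsFiniteMeasure τ] {f : α → ℝ≥0∞} (hf : Measurable f)
    (hfin : eLpNorm f ⊤ τ ≠ ⊤) : ∃ h : α → ℝ≥0∞, Measurable h ∧ eLpNorm h 1 τ ≤ 1 ∧
      eLpNorm f ⊤ τ ≤ 2 * ∫⁻ x, f x * h x ∂τ := by
  set N := eLpNorm f ⊤ τ
  rcases eq_or_ne N 0 with h0 | h0
  · exact ⟨0, measurable_const, by simp, by simp [h0]⟩
  set A := {x | N / 2 < f x}
  have hAm : MeasurableSet A := measurableSet_lt measurable_const hf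
  have hApos : τ A ≠ 0 := fun hnull => by
    refine (ENNReal.half_lt_self h0 hfin).not_ge ?_
    exact eLpNorm_exponent_top.trans_le (essSup_le_of_ae_le (N / 2) (ae_iff.2 (by
      simpa only [not_le, enorm_eq_self] using hnull)))
  have hcancel : (τ A)⁻¹ * τ A = 1 := ENNReal.inv_mul_cancel hApos (measure_ne_top _ _)
  refine ⟨A.indicator fun _ => (τ A)⁻¹, measurable_const.indicator hAm, ?_, ?_⟩
  · simp only [eLpNorm_one_eq_lintegral_enorm, enorm_eq_self]
    rw [lintegral_indicator_const hAm, hcancel]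
  · calc N = 2 * (N / 2) := (ENNReal.mul_div_cancel two_ne_zero ENNReal.ofNat_ne_top).symm
      _ = 2 * ∫⁻ x, A.indicator (fun _ => N / 2 * (τ A)⁻¹) x ∂τ := by
          rw [lintegral_indicator_const hAm, mul_assoc, hcancel, mul_one]
      _ ≤ 2 * ∫⁻ x, f x * A.indicator (fun _ => (τ A)⁻¹) x ∂τ := by
          gcongr with x
          by_cases hx : x ∈ A
          · simp only [indicator_of_mem hx]
            gcongr
            exact (show N / 2 < f x from hx).le
          · simp [indicator_of_notMem hx]

lemma exists_almost_norming [IsFiniteMeasure τ] [p.HolderConjugate p'] {f : α → ℝ≥0∞}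
    (hf : Measurable f) (hfin : eLpNorm f p τ ≠ ⊤) :
    ∃ h : α → ℝ≥0∞, Measurable h ∧ eLpNorm h p' τ ≤ 1 ∧
      eLpNorm f p τ ≤ 2 * ∫⁻ x, f x * h x ∂τ := by
  rcases eq_or_ne p ⊤ with rfl | hp
  · obtain rfl : p' = 1 := (ENNReal.HolderConjugate.eq_top_iff_eq_one ⊤ p').1 rfl
    exact exists_almost_norming_essSup hf hfin
  · refine ⟨dualFun p τ f, by unfold dualFun; fun_prop,
      eLpNorm_dualFun_le_one hp hf.aemeasurable, ?_⟩
    rw [lintegral_mul_dualFun (ENNReal.HolderConjugate.one_le p p') hp hf.aemeasurable hfin,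
      two_mul]
    exact le_self_add

end LebesgueNorm

section IteratedNorm

variable {α β ε ε' : Type*} [MeasurableSpace α] [MeasurableSpace β] {τ : Measure α} {μ : Measure β}
  [TopologicalSpace ε] [ContinuousENorm ε] [TopologicalSpace ε'] [ContinuousENorm ε']
  {q q' p p' : ℝ≥0∞}

/-- The iterated norm `‖ ‖f(t, x)‖_{L^p_x} ‖_{L^q_t}` on a product of two measure spaces;
`mixedNorm` is the case of `[0, T] × 𝕋³`. -/
def iterNorm {ε : Type*} [ENorm ε] (τ : Measure α) (μ : Measure β) (q p : ℝ≥0∞)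
    (f : α × β → ε) : ℝ≥0∞ :=
  eLpNorm (fun t => eLpNorm (fun x => f (t, x)) p μ) q τ

lemma iterNorm_mono [SFinite μ] {f : α × β → ε} {g : α × β → ε'}
    (h : ∀ᵐ z ∂τ.prod μ, ‖f z‖ₑ ≤ ‖g z‖ₑ) : iterNorm τ μ q p f ≤ iterNorm τ μ q p g := by
  refine eLpNorm_mono_enorm_ae ?_
  filter_upwards [Measure.ae_ae_of_ae_prod h] with t ht
  exact eLpNorm_mono_enorm_ae ht

lemma iterNorm_mono_exponent [IsProbabilityMeasure μ] {s : ℝ≥0∞} (hps : p ≤ s) {f : α × β → ε}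
    (hf : AEStronglyMeasurable f (τ.prod μ)) : iterNorm τ μ q p f ≤ iterNorm τ μ q s f := by
  refine eLpNorm_mono_enorm_ae ?_
  filter_upwards [hf.prodMk_left] with t ht
  exact eLpNorm_le_eLpNorm_of_exponent_le hps ht

lemma lintegral_enorm_mul_le_iterNorm_mul [SFinite μ] [q.HolderConjugate q']
    [p.HolderConjugate p'] {f : α × β → ε} {g : α × β → ε'}
    (hf : AEStronglyMeasurable f (τ.prod μ)) (hg : AEStronglyMeasurable g (τ.prod μ)) :
    ∫⁻ z, ‖f z‖ₑ * ‖g z‖ₑ ∂τ.prod μ ≤ iterNorm τ μ q p f * iterNorm τ μ q' p' g := by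
  rw [lintegral_prod (fun z => ‖f z‖ₑ * ‖g z‖ₑ) (hf.enorm.mul hg.enorm)]
  refine le_trans ?_ (lintegral_mul_le_eLpNorm_mul_eLpNorm (aemeasurable_eLpNorm_section p hf)
    (aemeasurable_eLpNorm_section p' hg))
  refine lintegral_mono_ae ?_
  filter_upwards [hf.prodMk_left, hg.prodMk_left] with t hft hgt
  exact lintegral_mul_le_eLpNorm_mul_eLpNorm (p := p) (p' := p') hft.enorm hgt.enorm

lemma iterNorm_tsum_le [SFinite μ] (hq : 1 ≤ q) (hp : 1 ≤ p) {F : ℕ → α × β → ℝ≥0∞}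
    (hF : ∀ j, AEMeasurable (F j) (τ.prod μ)) :
    iterNorm τ μ q p (fun z => ∑' j, F j z) ≤ ∑' j, iterNorm τ μ q p (F j) := by
  refine le_trans (eLpNorm_mono_enorm_ae ?_)
    (eLpNorm_tsum_le hq fun j => aemeasurable_eLpNorm_section p (hF j).aestronglyMeasurable)
  filter_upwards [ae_all_iff.2 fun j => (hF j).aestronglyMeasurable.prodMk_left] with t ht
  exact eLpNorm_tsum_le hp fun j => (ht j).aemeasurable

lemma exists_almost_norming_iterNorm [IsFiniteMeasure τ] [SFinite μ] [q.HolderConjugate q']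
    [p.HolderConjugate p'] (hp : p ≠ ⊤) {F : α × β → ℝ≥0∞} (hF : Measurable F)
    (hfin : iterNorm τ μ q p F ≠ ⊤) :
    ∃ K : α × β → ℝ≥0∞, Measurable K ∧ iterNorm τ μ q' p' K ≤ 1 ∧
      iterNorm τ μ q p F ≤ 2 * ∫⁻ z, F z * K z ∂τ.prod μ := by
  have hn := measurable_eLpNorm_section (μ := μ) p hF
  have hFt (t : α) : Measurable fun x => F (t, x) := hF.comp measurable_prodMk_left
  have hFfin : ∀ᵐ t ∂τ, eLpNorm (fun x => F (t, x)) p μ ≠ ⊤ :=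
    (ae_lt_top hn (lintegral_ne_top_of_eLpNorm_ne_top (ENNReal.HolderConjugate.one_le q q')
      hn.aemeasurable hfin)).mono fun t ht => ht.ne
  obtain ⟨h, hh, hh1, hFh⟩ := exists_almost_norming (p' := q') hn hfin
  set D : α × β → ℝ≥0∞ := fun z => dualFun p μ (fun x => F (z.1, x)) z.2 with hD
  have hDm : Measurable D := by
    simp only [hD, dualFun]
    exact (hF.pow_const _).mul ((hn.comp measurable_fst).pow_const _).inv
  have hDt (t : α) : Measurable fun x => D (t, x) := hDm.comp measurable_prodMk_left
  have hK : Measurable fun z : α × β => D z * h z.1 := hDm.mul (hh.comp measurable_fst)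
  refine ⟨fun z => D z * h z.1, hK, ?_, ?_⟩
  · refine (eLpNorm_mono_enorm fun t => ?_).trans hh1
    simp only [enorm_eq_self]
    rw [eLpNorm_mul_const (hDt t).aemeasurable]
    exact mul_le_of_le_one_left' (eLpNorm_dualFun_le_one hp (hFt t).aemeasurable)
  · refine hFh.trans (mul_le_mul_right (le_of_eq ?_) 2)
    rw [lintegral_prod (fun z => F z * (D z * h z.1)) (hF.mul hK).aemeasurable]
    refine lintegral_congr_ae ?_
    filter_upwards [hFfin] with t ht
    simp only [← mul_assoc]
    rw [lintegral_mul_const (f := fun x => F (t, x) * D (t, x)) _ ((hFt t).mul (hDt t))]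
    exact congrArg (· * h t) (lintegral_mul_dualFun (ENNReal.HolderConjugate.one_le p p') hp
      (hFt t).aemeasurable ht).symm

end IteratedNorm

section IteratedLebesgueSpace

variable {α β : Type*} [MeasurableSpace α] [MeasurableSpace β] {τ : Measure α} {μ : Measure β}
  {q q' p p' : ℝ≥0∞} {f g : α × β → ℝ}

/-- `f ∈ L^q_t(L^p_x)` on a product of two measure spaces; `MemMixed` is the case of
`[0, T] × 𝕋³`. -/
def MemIter (τ : Measure α) (μ : Measure β) (q p : ℝ≥0∞) (f : α × β → ℝ) : Prop :=
  AEStronglyMeasurable f (τ.prod μ) ∧ iterNorm τ μ q p f < ⊤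

lemma iterNorm_sub_le [SFinite μ] (hq : 1 ≤ q) (hp : 1 ≤ p)
    (hf : AEStronglyMeasurable f (τ.prod μ)) (hg : AEStronglyMeasurable g (τ.prod μ)) :
    iterNorm τ μ q p (fun z => f z - g z) ≤ iterNorm τ μ q p f + iterNorm τ μ q p g := by
  refine le_trans (eLpNorm_mono_enorm_ae ?_)
    (eLpNorm_add_le (aemeasurable_eLpNorm_section p hf).aestronglyMeasurable
      (aemeasurable_eLpNorm_section p hg).aestronglyMeasurable hq)
  filter_upwards [hf.prodMk_left, hg.prodMk_left] with t hft hgt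
  exact eLpNorm_sub_le hft hgt hp

lemma MemIter.sub [SFinite μ] (hq : 1 ≤ q) (hp : 1 ≤ p) (hf : MemIter τ μ q p f)
    (hg : MemIter τ μ q p g) : MemIter τ μ q p fun z => f z - g z :=
  ⟨hf.1.sub hg.1, (iterNorm_sub_le hq hp hf.1 hg.1).trans_lt (ENNReal.add_lt_top.2 ⟨hf.2, hg.2⟩)⟩

lemma MemIter.mono_exponent [IsProbabilityMeasure μ] {s : ℝ≥0∞} (hps : p ≤ s)
    (hf : MemIter τ μ q s f) : MemIter τ μ q p f :=
  ⟨hf.1, (iterNorm_mono_exponent hps hf.1).trans_lt hf.2⟩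

lemma MemIter.of_bound [IsFiniteMeasure τ] [IsFiniteMeasure μ]
    (hf : AEStronglyMeasurable f (τ.prod μ)) (M : ℝ) (hM : ∀ᵐ z ∂τ.prod μ, ‖f z‖ ≤ M) :
    MemIter τ μ q p f := by
  have hconst : eLpNorm (fun _ : β => M) p μ < ⊤ := (memLp_const M).2
  have hmono : iterNorm τ μ q p f ≤ iterNorm τ μ q p fun _ => M :=
    iterNorm_mono (hM.mono fun z hz => enorm_le_iff_norm_le.2 (hz.trans (le_abs_self M)))
  refine ⟨hf, hmono.trans_lt ?_⟩
  exact (memLp_const_enorm hconst.ne).2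

lemma MemIter.integrable_mul [SFinite μ] [q.HolderConjugate q'] [p.HolderConjugate p']
    (hf : MemIter τ μ q p f) (hg : MemIter τ μ q' p' g) :
    Integrable (fun z => f z * g z) (τ.prod μ) := by
  refine ⟨hf.1.mul hg.1, ?_⟩
  simp only [HasFiniteIntegral, enorm_mul]
  exact (lintegral_enorm_mul_le_iterNorm_mul hf.1 hg.1).trans_lt (ENNReal.mul_lt_top hf.2 hg.2)

lemma MemIter.ae_memLp [IsFiniteMeasure τ] [SFinite μ] (hq : 1 ≤ q) (hf : MemIter τ μ q p f) :
    ∀ᵐ t ∂τ, MemLp (fun x => f (t, x)) p μ := by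
  have hm := aemeasurable_eLpNorm_section p hf.1
  filter_upwards [hf.1.prodMk_left,
    ae_lt_top' hm (lintegral_ne_top_of_eLpNorm_ne_top hq hm hf.2.ne)] with t hmeas hfin
  exact ⟨hmeas, hfin⟩

lemma ae_lt_top_of_iterNorm_lt_top [IsFiniteMeasure τ] [IsFiniteMeasure μ] (hq : 1 ≤ q)
    (hp : 1 ≤ p) {F : α × β → ℝ≥0∞} (hF : AEMeasurable F (τ.prod μ))
    (hfin : iterNorm τ μ q p F < ⊤) : ∀ᵐ z ∂τ.prod μ, F z < ⊤ := by
  have := ENNReal.HolderConjugate.conjExponent hq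
  have := ENNReal.HolderConjugate.conjExponent hp
  have hone : MemIter τ μ q.conjExponent p.conjExponent fun _ => 1 :=
    .of_bound aestronglyMeasurable_const 1 (ae_of_all _ fun _ => by simp)
  have h := lintegral_enorm_mul_le_iterNorm_mul (q := q) (q' := q.conjExponent) (p := p)
    (p' := p.conjExponent) hF.aestronglyMeasurable hone.1
  simp only [enorm_eq_self, enorm_one, mul_one] at h
  exact ae_lt_top' hF (h.trans_lt (ENNReal.mul_lt_top hfin hone.2)).ne

lemma MemIter.exists_norming [IsFiniteMeasure τ] [IsFiniteMeasure μ] [q.HolderConjugate q']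
    [p.HolderConjugate p'] (hp : p ≠ ⊤) (hf : MemIter τ μ q p f) :
    ∃ ψ : α × β → ℝ, AEStronglyMeasurable ψ (τ.prod μ) ∧ iterNorm τ μ q' p' ψ ≤ 1 ∧
      iterNorm τ μ q p f ≤ 2 * ENNReal.ofReal (∫ z, f z * ψ z ∂τ.prod μ) := by
  set v := hf.1.mk f
  have hv : Measurable v := hf.1.stronglyMeasurable_mk.measurable
  have hfv : f =ᵐ[τ.prod μ] v := hf.1.ae_eq_mk
  have hle : iterNorm τ μ q p f ≤ iterNorm τ μ q p fun z => ‖v z‖ₑ :=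
    iterNorm_mono (hfv.mono fun z hz => by rw [hz, enorm_eq_self])
  have hge : iterNorm τ μ q p (fun z => ‖v z‖ₑ) ≤ iterNorm τ μ q p f :=
    iterNorm_mono (hfv.mono fun z hz => by rw [hz, enorm_eq_self])
  obtain ⟨K, hK, hK1, hvK⟩ := exists_almost_norming_iterNorm (q' := q') (p' := p') hp hv.enorm
    (hge.trans_lt hf.2).ne
  have hKfin : ∀ᵐ z ∂τ.prod μ, K z < ⊤ :=
    ae_lt_top_of_iterNorm_lt_top (ENNReal.HolderConjugate.one_le q' q)
      (ENNReal.HolderConjugate.one_le p' p) hK.aemeasurable (hK1.trans_lt ENNReal.one_lt_top)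
  -- At the zeros of `v` the quotient `v / |v|` is `0`.
  set ψ : α × β → ℝ := fun z => v z / |v z| * (K z).toReal with hψ
  have hψm : AEStronglyMeasurable ψ (τ.prod μ) := by
    simp only [hψ]
    exact ((hv.div hv.abs).mul hK.ennreal_toReal).aestronglyMeasurable
  have hvψ (z : α × β) : v z * ψ z = |v z| * (K z).toReal := by
    simp only [hψ]
    rw [← mul_assoc, ← mul_div_assoc, ← abs_mul_abs_self, mul_self_div_self]
  have hψK (z : α × β) : ‖ψ z‖ₑ ≤ ‖K z‖ₑ := by
    have hsign : ‖v z / |v z|‖ₑ ≤ 1 := by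
      rw [← enorm_one (G := ℝ), enorm_le_iff_norm_le]
      simpa using div_self_le_one |v z|
    rw [enorm_mul, enorm_eq_self, Real.enorm_of_nonneg ENNReal.toReal_nonneg]
    exact (mul_le_mul' hsign ENNReal.ofReal_toReal_le).trans_eq (one_mul _)
  have hψ1 : iterNorm τ μ q' p' ψ ≤ 1 := (iterNorm_mono (ae_of_all _ hψK)).trans hK1
  refine ⟨ψ, hψm, hψ1, (hle.trans hvK).trans_eq (congrArg (2 * ·) ?_)⟩
  rw [ofReal_integral_eq_lintegral_ofReal
    (hf.integrable_mul ⟨hψm, hψ1.trans_lt ENNReal.one_lt_top⟩)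
    (hfv.mono fun z hz => by simp only [Pi.zero_apply, hz, hvψ]; positivity)]
  refine lintegral_congr_ae ?_
  filter_upwards [hfv, hKfin] with z hz hKz
  rw [hz, hvψ, ENNReal.ofReal_mul (abs_nonneg _), ENNReal.ofReal_toReal hKz.ne,
    Real.enorm_eq_ofReal_abs]

lemma iterNorm_const_mul [SFinite μ] (c : ℝ) (hf : AEStronglyMeasurable f (τ.prod μ)) :
    iterNorm τ μ q p (fun z => c * f z) = iterNorm τ μ q p f * ‖c‖ₑ := by
  rw [iterNorm, iterNorm, ← eLpNorm_mul_const (aemeasurable_eLpNorm_section p hf)]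
  congr 1 with t
  rw [mul_comm]
  exact eLpNorm_const_smul c (fun x => f (t, x)) p μ

lemma MemIter.tsum [IsFiniteMeasure τ] [IsFiniteMeasure μ] (hq : 1 ≤ q) (hp : 1 ≤ p)
    {ψ : ℕ → α × β → ℝ} (hψ : ∀ j, AEStronglyMeasurable (ψ j) (τ.prod μ))
    (hψ1 : ∀ j, iterNorm τ μ q p (ψ j) ≤ 1) {c : ℕ → ℝ} (hc : Summable c) :
    MemIter τ μ q p fun z => ∑' j, c j * ψ j z := by
  have hterm (j : ℕ) : iterNorm τ μ q p (fun z => ‖c j * ψ j z‖ₑ) ≤ ‖c j‖ₑ := by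
    refine (iterNorm_mono (ae_of_all _ fun z => (enorm_eq_self _).le)).trans ?_
    rw [iterNorm_const_mul _ (hψ j)]
    exact mul_le_of_le_one_left' (hψ1 j)
  have hmeas (j : ℕ) : AEMeasurable (fun z => ‖c j * ψ j z‖ₑ) (τ.prod μ) :=
    ((hψ j).const_mul _).enorm
  have hsum : iterNorm τ μ q p (fun z => ∑' j, ‖c j * ψ j z‖ₑ) < ⊤ := by
    refine ((iterNorm_tsum_le hq hp hmeas).trans (ENNReal.tsum_le_tsum hterm)).trans_lt ?_
    simpa only [ofReal_norm] using hc.norm.tsum_ofReal_lt_top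
  refine ⟨aestronglyMeasurable_of_tendsto_ae atTop
    (f := fun n z => ∑ j ∈ Finset.range n, c j * ψ j z)
    (fun n => Finset.aestronglyMeasurable_fun_sum _ fun j _ => (hψ j).const_mul _) ?_,
    (iterNorm_mono (ae_of_all _ fun z => ?_)).trans_lt hsum⟩
  · filter_upwards [ae_lt_top_of_iterNorm_lt_top hq hp (AEMeasurable.tsum hmeas) hsum] with z hz
    have hz' : Summable fun j => c j * ψ j z :=
      .of_norm (by simpa only [toReal_enorm] using ENNReal.summable_toReal hz.ne)
    exact hz'.hasSum.tendsto_sum_nat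
  · rw [enorm_eq_self]
    exact enorm_tsum_le_tsum_enorm

end IteratedLebesgueSpace

section UniformBoundedness

variable {ι κ : Type*}

lemma exists_forall_abs_le_of_tsum_bounded (A : ι → κ → ℝ) (B : ι → ℝ)
    (hB : ∀ n j, |A n j| ≤ B n)
    (hA : ∀ c : κ → ℝ, Summable c → ∃ C, ∀ n, |∑' j, c j * A n j| ≤ C) :
    ∃ C, ∀ n j, |A n j| ≤ C := by
  classical
  have hmem (n : ι) : Memℓp (A n) ∞ := memℓp_infty ⟨B n, forall_mem_range.2 (hB n)⟩
  let g (n : ι) : lp (fun _ : κ => ℝ) 1 →L[ℝ] ℝ :=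
    lp.dualPairing ∞ 1 (fun _ => ContinuousLinearMap.mul ℝ ℝ) (K := 1) (fun _ => by simp)
      (⟨A n, hmem n⟩ : lp (fun _ : κ => ℝ) ∞)
  have hg (n : ι) (c : lp (fun _ : κ => ℝ) 1) : g n c = ∑' j, c j * A n j :=
    tsum_congr fun j => mul_comm _ _
  obtain ⟨C, hC⟩ := banach_steinhaus (g := g) fun c => by
    have hc : Summable c := .of_norm (by simpa using (lp.memℓp c).summable (by simp))
    simpa only [hg, Real.norm_eq_abs] using hA c hc
  refine ⟨C, fun n j => ?_⟩
  have hgj : g n (lp.single 1 j 1) = A n j := by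
    rw [hg, tsum_eq_single j fun i hi => by simp [hi]]
    simp
  calc |A n j| = ‖g n (lp.single 1 j 1)‖ := by rw [hgj, Real.norm_eq_abs]
    _ ≤ ‖g n‖ * ‖lp.single (E := fun _ : κ => ℝ) 1 j (1 : ℝ)‖ := (g n).le_opNorm _
    _ = ‖g n‖ := by rw [lp.norm_single (by simp)]; simp
    _ ≤ C := hC n

variable {α β : Type*} [MeasurableSpace α] [MeasurableSpace β] {τ : Measure α} {μ : Measure β}
  [IsFiniteMeasure τ] [IsFiniteMeasure μ] {q p : ℝ≥0∞}

theorem exists_iterNorm_bound (hq : 1 ≤ q) (hp : 1 ≤ p) (hp' : p ≠ ⊤) {u : ℕ → α × β → ℝ}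
    (hu : ∀ n, MemIter τ μ q p (u n))
    (hb : ∀ ψ, MemIter τ μ q.conjExponent p.conjExponent ψ →
      ∃ C, ∀ n, |∫ z, u n z * ψ z ∂τ.prod μ| ≤ C) :
    ∃ C : ℝ≥0, ∀ n, iterNorm τ μ q p (u n) ≤ C := by
  have := ENNReal.HolderConjugate.conjExponent hq
  have := ENNReal.HolderConjugate.conjExponent hp
  choose ψ hψ hψ1 hnorm using fun n => (hu n).exists_norming (q' := q.conjExponent)
    (p' := p.conjExponent) hp'
  have hψmem (j : ℕ) : MemIter τ μ q.conjExponent p.conjExponent (ψ j) :=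
    ⟨hψ j, (hψ1 j).trans_lt ENNReal.one_lt_top⟩
  set B : ℕ → ℝ := fun n => (iterNorm τ μ q p (u n)).toReal
  have hL1 (n j : ℕ) : ∫ z, ‖u n z * ψ j z‖ ∂τ.prod μ ≤ B n := by
    rw [integral_norm_eq_lintegral_enorm (f := fun z => u n z * ψ j z) ((hu n).1.mul (hψ j))]
    simp only [enorm_mul]
    exact ENNReal.toReal_mono (hu n).2.ne
      ((lintegral_enorm_mul_le_iterNorm_mul (hu n).1 (hψ j)).trans
        (mul_le_of_le_one_right' (hψ1 j)))
  have htsum (n : ℕ) {c : ℕ → ℝ} (hc : Summable c) :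
      ∑' j, c j * ∫ z, u n z * ψ j z ∂τ.prod μ = ∫ z, u n z * ∑' j, c j * ψ j z ∂τ.prod μ := by
    have h := hasSum_integral_of_summable_integral_norm (μ := τ.prod μ)
      (F := fun j z => c j * (u n z * ψ j z))
      (fun j => ((hu n).integrable_mul (hψmem j)).const_mul _)
      (.of_nonneg_of_le (fun j => integral_nonneg fun z => norm_nonneg _)
        (fun j => by
          simp only [norm_mul (c j), integral_const_mul]
          exact mul_le_mul_of_nonneg_left (hL1 n j) (norm_nonneg _))
        (hc.norm.mul_right (B n)))
    simp only [integral_const_mul] at h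
    rw [h.tsum_eq]
    refine integral_congr_ae (ae_of_all _ fun z => ?_)
    simp only [mul_left_comm (c _) (u n z), tsum_mul_left]
  obtain ⟨C, hC⟩ := exists_forall_abs_le_of_tsum_bounded
    (fun n j => ∫ z, u n z * ψ j z ∂τ.prod μ) B
    (fun n j => (norm_integral_le_integral_norm _).trans (hL1 n j)) fun c hc => by
      simpa only [htsum _ hc] using hb _ (.tsum (ENNReal.HolderConjugate.one_le _ q)
        (ENNReal.HolderConjugate.one_le _ p) hψ hψ1 hc)
  refine ⟨2 * C.toNNReal, fun n => (hnorm n).trans ?_⟩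
  push_cast
  gcongr
  exact ENNReal.ofReal_le_ofReal ((le_abs_self _).trans (hC n n))

end UniformBoundedness

/-! ### Young's convolution inequality -/

section Young

open scoped Convolution

variable {G : Type*} [AddCommGroup G] [MeasurableSpace G] {μ : Measure G}

lemma enorm_convolution_mul_le (f k : G → ℝ) (x : G) :
    ‖(f ⋆[ContinuousLinearMap.mul ℝ ℝ, μ] k) x‖ₑ ≤ ((‖f ·‖ₑ) ⋆ₗ[μ] (‖k ·‖ₑ)) x := by
  refine (enorm_integral_le_lintegral_enorm _).trans_eq ?_
  simp only [ContinuousLinearMap.mul_apply', enorm_mul, lconvolution_def, neg_add_eq_sub]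

lemma lconvolution_le_mul_lintegral {f k : G → ℝ≥0∞} (hf : AEMeasurable f μ) {B : ℝ≥0∞}
    (hB : ∀ y, k y ≤ B) (x : G) : (f ⋆ₗ[μ] k) x ≤ B * ∫⁻ y, f y ∂μ := by
  rw [lconvolution_def, mul_comm, ← lintegral_mul_const'' _ hf]
  gcongr
  exact hB _

variable [MeasurableAdd₂ G] [MeasurableNeg G] [μ.IsAddLeftInvariant]

lemma lconvolution_rpow_le [μ.IsNegInvariant] {p : ℝ} (hp : 1 ≤ p) {f k : G → ℝ≥0∞}
    (hf : AEMeasurable f μ) (hk : Measurable k) (x : G) :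
    (f ⋆ₗ[μ] k) x ^ p ≤ (∫⁻ y, k y ∂μ) ^ (p - 1) * ((fun y => f y ^ p) ⋆ₗ[μ] k) x := by
  have hp0 : 0 < p := by linarith
  have hp1 : 0 ≤ 1 - 1 / p := by rw [sub_nonneg, div_le_one hp0]; exact hp
  have hkx : Measurable fun y => k (-y + x) := by fun_prop
  have hsplit (y : G) :
      (f y ^ p * k (-y + x)) ^ (1 / p) * k (-y + x) ^ (1 - 1 / p) = f y * k (-y + x) := by
    rw [ENNReal.mul_rpow_of_nonneg _ _ (by positivity), ← ENNReal.rpow_mul,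
      mul_one_div_cancel hp0.ne', ENNReal.rpow_one, mul_assoc,
      ← ENNReal.rpow_add_of_nonneg _ _ (by positivity) hp1, add_sub_cancel, ENNReal.rpow_one]
  have hholder := ENNReal.lintegral_mul_norm_pow_le (μ := μ) ((hf.pow_const p).mul hkx.aemeasurable)
    hkx.aemeasurable (p := 1 / p) (by positivity) hp1 (by ring)
  simp only [Pi.mul_apply, hsplit] at hholder
  have hk_translate : ∫⁻ y, k (-y + x) ∂μ = ∫⁻ y, k y ∂μ := by
    simp only [neg_add_eq_sub]
    exact lintegral_sub_left_eq_self k x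
  calc (f ⋆ₗ[μ] k) x ^ p
      ≤ ((((fun y => f y ^ p) ⋆ₗ[μ] k) x) ^ (1 / p) * (∫⁻ y, k y ∂μ) ^ (1 - 1 / p)) ^ p := by
        rw [← hk_translate]
        gcongr
        exact hholder
    _ = _ := by
        rw [ENNReal.mul_rpow_of_nonneg _ _ hp0.le, ← ENNReal.rpow_mul, ← ENNReal.rpow_mul,
          one_div_mul_cancel hp0.ne', ENNReal.rpow_one, mul_comm, sub_mul, one_mul,
          one_div_mul_cancel hp0.ne']

variable [SFinite μ]

lemma lintegral_lconvolution {f k : G → ℝ≥0∞} (hf : AEMeasurable f μ) (hk : Measurable k) :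
    ∫⁻ x, (f ⋆ₗ[μ] k) x ∂μ = (∫⁻ y, f y ∂μ) * ∫⁻ y, k y ∂μ := by
  have hmeas : AEMeasurable (Function.uncurry fun x y => f y * k (-y + x)) (μ.prod μ) :=
    hf.comp_snd.mul (by fun_prop)
  simp only [lconvolution_def]
  rw [lintegral_lintegral_swap hmeas, ← lintegral_mul_const'' _ hf]
  refine lintegral_congr fun y => ?_
  rw [lintegral_const_mul _ (by fun_prop), lintegral_add_left_eq_self]

lemma lintegral_lconvolution_rpow_le {r : ℝ} (hr : 1 ≤ r) {f k : G → ℝ≥0∞}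
    (hf : AEMeasurable f μ) (hk : Measurable k) {B : ℝ≥0∞} (hB : ∀ y, k y ≤ B) :
    ∫⁻ x, (f ⋆ₗ[μ] k) x ^ r ∂μ ≤ B ^ (r - 1) * (∫⁻ y, k y ∂μ) * (∫⁻ y, f y ∂μ) ^ r := by
  have hr1 : 0 ≤ r - 1 := sub_nonneg.2 hr
  have hsplit (c : ℝ≥0∞) : c ^ r = c ^ (r - 1) * c := by
    nth_rw 3 [← ENNReal.rpow_one c]
    rw [← ENNReal.rpow_add_of_nonneg _ _ hr1 zero_le_one, sub_add_cancel]
  calc ∫⁻ x, (f ⋆ₗ[μ] k) x ^ r ∂μ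
      ≤ ∫⁻ x, (B * ∫⁻ y, f y ∂μ) ^ (r - 1) * (f ⋆ₗ[μ] k) x ∂μ := by
        refine lintegral_mono fun x => ?_
        rw [hsplit]
        gcongr
        exact lconvolution_le_mul_lintegral hf hB x
    _ = (B * ∫⁻ y, f y ∂μ) ^ (r - 1) * ((∫⁻ y, f y ∂μ) * ∫⁻ y, k y ∂μ) := by
        rw [lintegral_const_mul'' _ (aemeasurable_lconvolution hf hk.aemeasurable),
          lintegral_lconvolution hf hk]
    _ = _ := by
        rw [ENNReal.mul_rpow_of_nonneg _ _ hr1, hsplit (∫⁻ y, f y ∂μ)]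
        ring

lemma eLpNorm_lconvolution_le [μ.IsNegInvariant] {p s : ℝ≥0∞} (hp : 1 ≤ p) (hps : p ≤ s)
    (hs : s ≠ ⊤) {f k : G → ℝ≥0∞} (hf : AEMeasurable f μ) (hk : Measurable k) {B : ℝ≥0∞}
    (hB : ∀ y, k y ≤ B) :
    eLpNorm (f ⋆ₗ[μ] k) s μ ≤ (∫⁻ y, k y ∂μ) ^ (1 - 1 / p.toReal + 1 / s.toReal) *
      B ^ (1 / p.toReal - 1 / s.toReal) * eLpNorm f p μ := by
  have hpt : p ≠ ⊤ := ne_top_of_le_ne_top hs hps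
  rw [eLpNorm_eq_lintegral_rpow_enorm_toReal (by positivity) hpt,
    eLpNorm_eq_lintegral_rpow_enorm_toReal (zero_lt_one.trans_le (hp.trans hps)).ne' hs]
  simp only [enorm_eq_self]
  have hp1 : 1 ≤ p.toReal := by simpa using ENNReal.toReal_mono hpt hp
  have hps' : p.toReal ≤ s.toReal := ENNReal.toReal_mono hs hps
  set P := p.toReal
  set S := s.toReal
  set A := ∫⁻ y, k y ∂μ
  have hP : 0 < P := by linarith
  have hS : 0 < S := by linarith
  have hSP : 1 ≤ S / P := (one_le_div hP).2 hps'
  calc (∫⁻ x, (f ⋆ₗ[μ] k) x ^ S ∂μ) ^ (1 / S)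
      ≤ (∫⁻ x, A ^ ((P - 1) * (S / P)) * ((fun y => f y ^ P) ⋆ₗ[μ] k) x ^ (S / P) ∂μ)
          ^ (1 / S) := by
        gcongr with x
        calc (f ⋆ₗ[μ] k) x ^ S = ((f ⋆ₗ[μ] k) x ^ P) ^ (S / P) := by
              rw [← ENNReal.rpow_mul, mul_div_cancel₀ _ hP.ne']
          _ ≤ (A ^ (P - 1) * ((fun y => f y ^ P) ⋆ₗ[μ] k) x) ^ (S / P) := by
              gcongr
              exact lconvolution_rpow_le hp1 hf hk x
          _ = _ := by rw [ENNReal.mul_rpow_of_nonneg _ _ (by positivity), ← ENNReal.rpow_mul]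
    _ ≤ (A ^ ((P - 1) * (S / P)) * (B ^ (S / P - 1) * A * (∫⁻ y, f y ^ P ∂μ) ^ (S / P)))
          ^ (1 / S) := by
        rw [lintegral_const_mul'' _ ((aemeasurable_lconvolution (hf.pow_const P)
          hk.aemeasurable).pow_const _)]
        gcongr
        exact lintegral_lconvolution_rpow_le hSP (hf.pow_const P) hk hB
    _ = _ := by
        have hexp : (P - 1) * (S / P) * (1 / S) = 1 - 1 / P := by field_simp
        have hP1 : 0 ≤ 1 - 1 / P := by rw [sub_nonneg, div_le_one hP]; exact hp1
        simp only [ENNReal.mul_rpow_of_nonneg _ _ (show 0 ≤ 1 / S by positivity),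
          ← ENNReal.rpow_mul, hexp]
        rw [show (S / P - 1) * (1 / S) = 1 / P - 1 / S by field_simp,
          show S / P * (1 / S) = 1 / P by field_simp,
          ENNReal.rpow_add_of_nonneg _ _ hP1 (by positivity)]
        ring

theorem eLpNorm_convolution_mul_le [μ.IsNegInvariant] {p s : ℝ≥0∞} (hp : 1 ≤ p) (hps : p ≤ s)
    (hs : s ≠ ⊤) {f k : G → ℝ} (hf : AEStronglyMeasurable f μ) (hk : Measurable k) {B : ℝ≥0∞}
    (hB : ∀ y, ‖k y‖ₑ ≤ B) :
    eLpNorm (f ⋆[ContinuousLinearMap.mul ℝ ℝ, μ] k) s μ ≤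
      (∫⁻ y, ‖k y‖ₑ ∂μ) ^ (1 - 1 / p.toReal + 1 / s.toReal) *
        B ^ (1 / p.toReal - 1 / s.toReal) * eLpNorm f p μ :=
  calc _ ≤ eLpNorm ((‖f ·‖ₑ) ⋆ₗ[μ] (‖k ·‖ₑ)) s μ :=
        eLpNorm_mono_enorm fun x => enorm_convolution_mul_le f k x
    _ ≤ _ := eLpNorm_lconvolution_le hp hps hs hf.enorm hk.enorm hB
    _ = _ := by rw [eLpNorm_enorm]

end Young

/-! ### Trigonometric kernels on the circle -/

section Circle

/-- The function `cos² (π x)` on `ℝ/ℤ`. -/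
def cosSq (x : UnitAddCircle) : ℝ := (1 + (fourier 1 x).re) / 2

/-- The function `sin (π x) cos (π x)` on `ℝ/ℤ`. -/
def sinCos (x : UnitAddCircle) : ℝ := (fourier 1 x).im / 2

lemma fourier_one_coe (y : ℝ) :
    fourier 1 (y : UnitAddCircle) = Complex.exp ((2 * Real.pi * y : ℝ) * Complex.I) := by
  rw [fourier_coe_apply]
  congr 1
  push_cast
  ring

lemma cosSq_coe (y : ℝ) : cosSq (y : UnitAddCircle) = (1 + Real.cos (2 * Real.pi * y)) / 2 := by
  rw [cosSq, fourier_one_coe, Complex.exp_ofReal_mul_I_re]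

lemma sinCos_coe (y : ℝ) : sinCos (y : UnitAddCircle) = Real.sin (2 * Real.pi * y) / 2 := by
  rw [sinCos, fourier_one_coe, Complex.exp_ofReal_mul_I_im]

@[fun_prop]
lemma continuous_cosSq : Continuous cosSq := by
  unfold cosSq
  fun_prop

@[fun_prop]
lemma continuous_sinCos : Continuous sinCos := by
  unfold sinCos
  fun_prop

lemma cosSq_nonneg (x : UnitAddCircle) : 0 ≤ cosSq x := by
  induction x using QuotientAddGroup.induction_on with
  | H y => rw [cosSq_coe]; linarith [Real.neg_one_le_cos (2 * Real.pi * y)]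

lemma cosSq_le_one (x : UnitAddCircle) : cosSq x ≤ 1 := by
  induction x using QuotientAddGroup.induction_on with
  | H y => rw [cosSq_coe]; linarith [Real.cos_le_one (2 * Real.pi * y)]

lemma cosSq_zero : cosSq 0 = 1 := by
  simpa using cosSq_coe 0

lemma cosSq_lt_one {x : UnitAddCircle} (hx : x ≠ 0) : cosSq x < 1 := by
  refine lt_of_le_of_ne (cosSq_le_one x) fun h => hx ?_
  induction x using QuotientAddGroup.induction_on with
  | H y =>
    rw [cosSq_coe] at h
    obtain ⟨k, hk⟩ := (Real.cos_eq_one_iff (2 * Real.pi * y)).1 (by linarith)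
    have hy : (k : ℝ) = y := mul_right_cancel₀ Real.two_pi_pos.ne' (by rw [hk]; ring)
    rw [AddCircle.coe_eq_zero_iff]
    exact ⟨k, by simpa using hy⟩

lemma sinCos_sq (x : UnitAddCircle) : sinCos x ^ 2 = cosSq x * (1 - cosSq x) := by
  induction x using QuotientAddGroup.induction_on with
  | H y =>
    rw [cosSq_coe, sinCos_coe]
    linear_combination (1 / 4) * Real.sin_sq_add_cos_sq (2 * Real.pi * y)

lemma hasDerivAt_cosSq (y : ℝ) :
    HasDerivAt (fun y : ℝ => cosSq y) (-2 * Real.pi * sinCos y) y := by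
  simp only [cosSq_coe, sinCos_coe]
  convert! (((hasDerivAt_id y).const_mul (2 * Real.pi)).cos.const_add 1).div_const 2 using 1
  simp only [id_eq]
  ring

lemma hasDerivAt_sinCos (y : ℝ) :
    HasDerivAt (fun y : ℝ => sinCos y) (Real.pi * (2 * cosSq y - 1)) y := by
  simp only [cosSq_coe, sinCos_coe]
  convert! ((hasDerivAt_id y).const_mul (2 * Real.pi)).sin.div_const 2 using 1
  simp only [id_eq]
  ring

@[fun_prop]
lemma contDiff_cosSq_coe : ContDiff ℝ ∞ fun y : ℝ => cosSq y := by
  simp only [cosSq_coe]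
  fun_prop

@[fun_prop]
lemma contDiff_sinCos_coe : ContDiff ℝ ∞ fun y : ℝ => sinCos y := by
  simp only [sinCos_coe]
  fun_prop

/-- The constants `(∫ cosSq ^ n)⁻¹`, given by the recursion of Wallis' product. -/
def cosConst : ℕ → ℝ
  | 0 => 1
  | n + 1 => cosConst n * ((2 * n + 2) / (2 * n + 1))

lemma cosConst_pos (n : ℕ) : 0 < cosConst n := by
  induction n with
  | zero => exact zero_lt_one
  | succ n ih => rw [cosConst]; positivity

lemma cosConst_le_succ (n : ℕ) : cosConst n ≤ cosConst (n + 1) := by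
  rw [cosConst]
  refine le_mul_of_one_le_right (cosConst_pos n).le ?_
  rw [one_le_div (by positivity)]
  linarith

lemma cosConst_sq_le (n : ℕ) : cosConst n ^ 2 ≤ 4 * n + 1 := by
  induction n with
  | zero => simp [cosConst]
  | succ n ih =>
    rw [cosConst, mul_pow, div_pow]
    calc cosConst n ^ 2 * ((2 * n + 2) ^ 2 / (2 * n + 1) ^ 2)
        ≤ (4 * n + 1) * ((2 * n + 2) ^ 2 / (2 * n + 1) ^ 2) := by gcongr
      _ ≤ 4 * ((n + 1 : ℕ) : ℝ) + 1 := by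
        rw [← mul_div_assoc, div_le_iff₀ (by positivity)]
        push_cast
        nlinarith

/-- The `L¹`-normalized power `cosSq ^ n`, an approximate identity on the circle. -/
def circleKernel (n : ℕ) (x : UnitAddCircle) : ℝ := cosConst n * cosSq x ^ n

/-- A primitive of `circleKernel (n + 1) - circleKernel n`. -/
def circlePrimitive (n : ℕ) (x : UnitAddCircle) : ℝ :=
  cosConst n / ((2 * n + 1) * Real.pi) * (cosSq x ^ n * sinCos x)

@[fun_prop]
lemma continuous_circleKernel (n : ℕ) : Continuous (circleKernel n) := by
  unfold circleKernel; fun_prop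

@[fun_prop]
lemma continuous_circlePrimitive (n : ℕ) : Continuous (circlePrimitive n) := by
  unfold circlePrimitive; fun_prop

lemma circleKernel_nonneg (n : ℕ) (x : UnitAddCircle) : 0 ≤ circleKernel n x :=
  mul_nonneg (cosConst_pos n).le (pow_nonneg (cosSq_nonneg x) n)

lemma circleKernel_le (n : ℕ) (x : UnitAddCircle) : circleKernel n x ≤ cosConst n :=
  mul_le_of_le_one_right (cosConst_pos n).le (pow_le_one₀ (cosSq_nonneg x) (cosSq_le_one x))

lemma hasDerivAt_circlePrimitive (n : ℕ) (y : ℝ) :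
    HasDerivAt (fun y : ℝ => circlePrimitive n y)
      (circleKernel (n + 1) y - circleKernel n y) y := by
  refine ((((hasDerivAt_cosSq y).pow n).mul (hasDerivAt_sinCos y)).const_mul
    (cosConst n / ((2 * n + 1) * Real.pi))).congr_deriv ?_
  have hpow : (n : ℝ) * cosSq y ^ (n - 1) * (-2 * Real.pi * sinCos y) * sinCos y
      = -2 * Real.pi * n * cosSq y ^ n * (1 - cosSq y) := by
    rcases n with _ | n
    · simp
    · simp only [Nat.add_sub_cancel]
      linear_combination (-2 * Real.pi * (n + 1 : ℕ) * cosSq y ^ n) * sinCos_sq y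
  simp only [Pi.pow_apply]
  rw [hpow, circleKernel, circleKernel, cosConst]
  field_simp
  ring

lemma hasDerivAt_circlePrimitive_sub (n : ℕ) (x : UnitAddCircle) :
    HasDerivAt (fun h : ℝ => circlePrimitive n (x - h))
      (-(circleKernel (n + 1) x - circleKernel n x)) 0 := by
  induction x using QuotientAddGroup.induction_on with
  | H c =>
    have h := (hasDerivAt_circlePrimitive n (c - 0)).comp_const_sub c 0
    simpa only [sub_zero, AddCircle.coe_sub] using h

lemma integrable_of_continuous {X : Type*} [TopologicalSpace X] [CompactSpace X]
    [MeasurableSpace X] [OpensMeasurableSpace X] {μ : Measure X} [IsFiniteMeasureOnCompacts μ]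
    {E : Type*} [NormedAddCommGroup E] {f : X → E} (hf : Continuous f) : Integrable f μ :=
  hf.integrable_of_hasCompactSupport (HasCompactSupport.of_compactSpace f)

lemma integral_circle_eq (f : UnitAddCircle → ℝ) :
    ∫ x, f x ∂AddCircle.haarAddCircle = ∫ y in (0 : ℝ)..1, f y := by
  rw [AddCircle.integral_haarAddCircle, ← AddCircle.intervalIntegral_preimage 1 0 f]
  simp

lemma integral_circleKernel_succ (n : ℕ) :
    ∫ x, circleKernel (n + 1) x ∂AddCircle.haarAddCircle =
      ∫ x, circleKernel n x ∂AddCircle.haarAddCircle := by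
  have _ : Continuous fun y : ℝ => (y : UnitAddCircle) := AddCircle.continuous_mk' 1
  rw [← sub_eq_zero, ← integral_sub (integrable_of_continuous (by fun_prop))
    (integrable_of_continuous (by fun_prop)), integral_circle_eq,
    intervalIntegral.integral_eq_sub_of_hasDerivAt (fun y _ => hasDerivAt_circlePrimitive n y)
      (Continuous.intervalIntegrable (by fun_prop) _ _),
    AddCircle.coe_period, AddCircle.coe_zero, sub_self]

lemma integral_circleKernel (n : ℕ) : ∫ x, circleKernel n x ∂AddCircle.haarAddCircle = 1 := by
  induction n with
  | zero => simp [circleKernel, cosConst]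
  | succ n ih => rw [integral_circleKernel_succ, ih]

lemma integral_cosSq_pow (n : ℕ) :
    ∫ x, cosSq x ^ n ∂AddCircle.haarAddCircle = (cosConst n)⁻¹ := by
  refine eq_inv_of_mul_eq_one_right ?_
  rw [← integral_const_mul]
  exact integral_circleKernel n

lemma integral_cosSq_pow_mul_sinCos_sq (n : ℕ) :
    ∫ x, cosSq x ^ n * sinCos x ^ 2 ∂AddCircle.haarAddCircle =
      (cosConst (n + 1))⁻¹ / (2 * n + 4) := by
  have hsplit (x : UnitAddCircle) :
      cosSq x ^ n * sinCos x ^ 2 = cosSq x ^ (n + 1) - cosSq x ^ (n + 2) := by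
    rw [sinCos_sq]; ring
  simp only [hsplit]
  rw [integral_sub (integrable_of_continuous (by fun_prop))
    (integrable_of_continuous (by fun_prop)), integral_cosSq_pow, integral_cosSq_pow,
    cosConst.eq_2 (n + 1)]
  have := cosConst_pos (n + 1)
  push_cast
  field_simp
  ring

lemma natCast_mul_pow_mul_one_sub_le {s : ℝ} (hs0 : 0 ≤ s) (hs1 : s ≤ 1) (m : ℕ) :
    m * (s ^ m * (1 - s)) ≤ 1 :=
  calc m * (s ^ m * (1 - s)) ≤ s ^ m * (1 + m * (1 - s)) := by
        linarith [pow_nonneg hs0 m]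
    _ ≤ s ^ m * (1 + (1 - s)) ^ m := by gcongr; exact one_add_mul_le_pow (by linarith) m
    _ = (s * (1 + (1 - s))) ^ m := (mul_pow _ _ _).symm
    _ ≤ 1 := pow_le_one₀ (mul_nonneg hs0 (by linarith)) (by nlinarith [sq_nonneg (1 - s)])

lemma abs_circlePrimitive (n : ℕ) (x : UnitAddCircle) :
    |circlePrimitive n x| =
      cosConst n / ((2 * n + 1) * Real.pi) * (cosSq x ^ n * |sinCos x|) := by
  have := cosConst_pos n
  rw [circlePrimitive, abs_mul, abs_mul, abs_of_pos (a := _ / _) (by positivity),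
    abs_of_nonneg (pow_nonneg (cosSq_nonneg x) n)]

lemma abs_circlePrimitive_le (n : ℕ) (x : UnitAddCircle) :
    |circlePrimitive n x| ≤ 1 / (2 * n + 1) := by
  have hsq : (cosSq x ^ n * |sinCos x|) ^ 2 ≤ 1 / (2 * n + 1) := by
    have := natCast_mul_pow_mul_one_sub_le (cosSq_nonneg x) (cosSq_le_one x) (2 * n + 1)
    rw [mul_pow, sq_abs, sinCos_sq, le_div_iff₀ (by positivity)]
    push_cast at this
    linear_combination this
  have hmul : cosConst n * (cosSq x ^ n * |sinCos x|) ≤ 2 := by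
    refine le_of_sq_le_sq ?_ zero_le_two
    calc (cosConst n * (cosSq x ^ n * |sinCos x|)) ^ 2
        ≤ (4 * n + 1 : ℝ) * (1 / (2 * n + 1)) := by
          rw [mul_pow]; gcongr; exact cosConst_sq_le n
      _ ≤ 2 ^ 2 := by rw [mul_one_div, div_le_iff₀ (by positivity)]; linarith
  rw [abs_circlePrimitive, div_mul_eq_mul_div, div_le_div_iff₀ (by positivity) (by positivity)]
  nlinarith [Real.pi_gt_three, show (0 : ℝ) ≤ 2 * n + 1 by positivity]

lemma sq_integral_weight_mul_le {α : Type*} [MeasurableSpace α] {μ : Measure α} {w g : α → ℝ}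
    (hw : ∀ x, 0 ≤ w x) (hw1 : Integrable w μ) (hwg : Integrable (fun x => w x * g x) μ)
    (hwg2 : Integrable (fun x => w x * g x ^ 2) μ) :
    (∫ x, w x * g x ∂μ) ^ 2 ≤ (∫ x, w x ∂μ) * ∫ x, w x * g x ^ 2 ∂μ := by
  have hquad (r : ℝ) : 0 ≤ (∫ x, w x ∂μ) * (r * r) + (-2 * ∫ x, w x * g x ∂μ) * r
      + ∫ x, w x * g x ^ 2 ∂μ := by
    calc 0 ≤ ∫ x, w x * (r - g x) ^ 2 ∂μ :=
          integral_nonneg fun x => mul_nonneg (hw x) (sq_nonneg _)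
      _ = ∫ x, w x * (r * r) + (-2 * (w x * g x)) * r + w x * g x ^ 2 ∂μ := by
          congr 1; ext x; ring
      _ = _ := by
          rw [integral_add (by fun_prop) hwg2,
            integral_add (by fun_prop) (by fun_prop),
            integral_mul_const, integral_mul_const, integral_const_mul]
  have := discrim_le_zero hquad
  rw [discrim] at this
  linarith

lemma cosConst_mul_integral_sq_le (n : ℕ) :
    (cosConst n * ∫ x, cosSq x ^ n * |sinCos x| ∂AddCircle.haarAddCircle) ^ 2
      ≤ (n + 1 : ℝ)⁻¹ := by
  have hc := cosConst_pos n
  have hc1 := cosConst_pos (n + 1)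
  have hCS := sq_integral_weight_mul_le (μ := AddCircle.haarAddCircle) (w := fun x => cosSq x ^ n)
    (g := fun x => |sinCos x|) (fun x => pow_nonneg (cosSq_nonneg x) n)
    (integrable_of_continuous (by fun_prop)) (integrable_of_continuous (by fun_prop))
    (integrable_of_continuous (by fun_prop))
  simp only [sq_abs] at hCS
  rw [integral_cosSq_pow, integral_cosSq_pow_mul_sinCos_sq] at hCS
  calc _ ≤ cosConst n ^ 2 * ((cosConst n)⁻¹ * ((cosConst (n + 1))⁻¹ / (2 * n + 4))) := by
        rw [mul_pow]; gcongr
    _ = (cosConst n / cosConst (n + 1)) * (2 * n + 4 : ℝ)⁻¹ := by field_simp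
    _ ≤ 1 * (n + 1 : ℝ)⁻¹ := by
        gcongr
        · exact div_le_one_of_le₀ (cosConst_le_succ n) hc1.le
        · linarith
        · linarith
    _ = (n + 1 : ℝ)⁻¹ := one_mul _

lemma integral_abs_circlePrimitive_le (n : ℕ) :
    ∫ x, |circlePrimitive n x| ∂AddCircle.haarAddCircle ≤ ((n + 1 : ℝ) ^ (3 / 2 : ℝ))⁻¹ := by
  have hsqrt : cosConst n * ∫ x, cosSq x ^ n * |sinCos x| ∂AddCircle.haarAddCircle
      ≤ ((n + 1 : ℝ) ^ (1 / 2 : ℝ))⁻¹ := by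
    rw [← Real.sqrt_eq_rpow]
    refine le_of_sq_le_sq ?_ (by positivity)
    rw [inv_pow, Real.sq_sqrt (by positivity)]
    exact cosConst_mul_integral_sq_le n
  have hexp : (n + 1 : ℝ) ^ (3 / 2 : ℝ) = (n + 1) * (n + 1 : ℝ) ^ (1 / 2 : ℝ) := by
    rw [← Real.rpow_one_add' (by positivity) (by norm_num)]
    norm_num
  simp only [abs_circlePrimitive]
  rw [integral_const_mul, hexp, mul_inv, div_mul_eq_mul_div, div_eq_inv_mul]
  gcongr ?_ * ?_
  · exact mul_nonneg (cosConst_pos n).le <| integral_nonneg fun x =>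
      mul_nonneg (pow_nonneg (cosSq_nonneg x) n) (abs_nonneg _)
  · gcongr
    nlinarith [Real.pi_gt_three, show (0 : ℝ) ≤ n by positivity]

end Circle

/-! ### Convolution kernels on the torus -/

section Torus

open scoped Convolution

instance : torusMeasure.IsAddHaarMeasure := by
  unfold torusMeasure; infer_instance

instance : IsProbabilityMeasure torusMeasure := by
  unfold torusMeasure; infer_instance

/-- The approximate identity `∏ⱼ cos^{2n} (π x_j)` on the torus, normalized in `L¹`. -/
def torusKernel (n : ℕ) (x : T3) : ℝ := ∏ j, circleKernel n (x j)

/-- The factor depending on `x_j` of the product `torusPotential i n`. -/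
def potentialFactor (i : Fin 3) (n : ℕ) (j : Fin 3) : UnitAddCircle → ℝ :=
  if j = i then circlePrimitive n else if j < i then circleKernel (n + 1) else circleKernel n

/-- The `i`-th component of a vector field with divergence `torusKernel (n + 1) - torusKernel n`;
the coordinates are passed from `n` to `n + 1` one after the other. -/
def torusPotential (i : Fin 3) (n : ℕ) (x : T3) : ℝ := ∏ j, potentialFactor i n j (x j)

/-- Convolution on the torus. -/
def conv (f k : T3 → ℝ) : T3 → ℝ := f ⋆[ContinuousLinearMap.mul ℝ ℝ, torusMeasure] k

/-- `g` is the weak gradient of `f` on the torus. -/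
def IsTorusWeakGrad (f : T3 → ℝ) (g : Fin 3 → T3 → ℝ) : Prop :=
  ∀ i : Fin 3, ∀ φ : T3 → ℝ, SmoothTorus φ →
    ∫ x, f x * torusPartial i φ x ∂torusMeasure = -∫ x, g i x * φ x ∂torusMeasure

@[fun_prop]
lemma continuous_torusKernel (n : ℕ) : Continuous (torusKernel n) := by
  unfold torusKernel; fun_prop

@[fun_prop]
lemma continuous_potentialFactor (i : Fin 3) (n : ℕ) (j : Fin 3) :
    Continuous (potentialFactor i n j) := by
  unfold potentialFactor; split_ifs <;> fun_prop

@[fun_prop]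
lemma continuous_torusPotential (i : Fin 3) (n : ℕ) : Continuous (torusPotential i n) := by
  unfold torusPotential; fun_prop

lemma torusKernel_nonneg (n : ℕ) (x : T3) : 0 ≤ torusKernel n x :=
  Finset.prod_nonneg fun j _ => circleKernel_nonneg n (x j)

lemma integral_torusKernel (n : ℕ) : ∫ x, torusKernel n x ∂torusMeasure = 1 := by
  unfold torusKernel torusMeasure
  rw [integral_fintype_prod_eq_prod (fun _ => circleKernel n)]
  simp [integral_circleKernel]

lemma abs_potentialFactor_le {i j : Fin 3} (hji : j ≠ i) (n : ℕ) (x : UnitAddCircle) :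
    |potentialFactor i n j x| ≤ cosConst (n + 1) := by
  rw [potentialFactor, if_neg hji]
  split_ifs
  · rw [abs_of_nonneg (circleKernel_nonneg _ _)]
    exact circleKernel_le _ _
  · rw [abs_of_nonneg (circleKernel_nonneg _ _)]
    exact (circleKernel_le _ _).trans (cosConst_le_succ n)

lemma abs_torusPotential_le (i : Fin 3) (n : ℕ) (x : T3) : |torusPotential i n x| ≤ 5 := by
  have herase : ∏ j ∈ Finset.univ.erase i, |potentialFactor i n j (x j)|
      ≤ cosConst (n + 1) ^ 2 :=
    calc _ ≤ ∏ j ∈ Finset.univ.erase i, cosConst (n + 1) :=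
          Finset.prod_le_prod (fun _ _ => abs_nonneg _)
            fun j hj => abs_potentialFactor_le (Finset.ne_of_mem_erase hj) n (x j)
      _ = cosConst (n + 1) ^ 2 := by simp
  rw [torusPotential, Finset.abs_prod, ← Finset.mul_prod_erase _ _ (Finset.mem_univ i)]
  calc |potentialFactor i n i (x i)| * _
      ≤ 1 / (2 * n + 1) * (4 * (n + 1 : ℕ) + 1) := by
        gcongr
        · simpa [potentialFactor] using abs_circlePrimitive_le n (x i)
        · exact herase.trans (cosConst_sq_le (n + 1))
    _ ≤ 5 := by
        rw [one_div_mul_eq_div, div_le_iff₀ (by positivity)]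
        push_cast
        linarith [show (0 : ℝ) ≤ n by positivity]

lemma integral_abs_torusPotential_le (i : Fin 3) (n : ℕ) :
    ∫ x, |torusPotential i n x| ∂torusMeasure ≤ ((n + 1 : ℝ) ^ (3 / 2 : ℝ))⁻¹ := by
  have hkernel (m : ℕ) : ∫ x, |circleKernel m x| ∂AddCircle.haarAddCircle = 1 := by
    simp only [abs_of_nonneg (circleKernel_nonneg m _), integral_circleKernel]
  unfold torusPotential torusMeasure
  simp only [Finset.abs_prod]
  rw [integral_fintype_prod_eq_prod (fun j y => |potentialFactor i n j y|),
    Finset.prod_eq_single i]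
  · simpa [potentialFactor] using integral_abs_circlePrimitive_le n
  · intro j _ hj
    simp only [potentialFactor, if_neg hj]
    split_ifs <;> exact hkernel _
  · simp

lemma contDiff_potentialFactor_coe (i : Fin 3) (n : ℕ) (j : Fin 3) :
    ContDiff ℝ ∞ fun y : ℝ => potentialFactor i n j y := by
  unfold potentialFactor
  split_ifs
  · unfold circlePrimitive; fun_prop
  · unfold circleKernel; fun_prop
  · unfold circleKernel; fun_prop

lemma smoothTorus_torusPotential_sub (i : Fin 3) (n : ℕ) (x : T3) :
    SmoothTorus fun y => torusPotential i n (x - y) := by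
  refine contDiff_prod fun j _ => ?_
  obtain ⟨c, hc⟩ : ∃ c : ℝ, (c : UnitAddCircle) = x j := QuotientAddGroup.mk_surjective (x j)
  simp only [Pi.sub_apply, ← hc, ← AddCircle.coe_sub]
  exact (contDiff_potentialFactor_coe i n j).comp (contDiff_const.sub (contDiff_apply ℝ ℝ j))

lemma torusPartial_torusPotential_sub (i : Fin 3) (n : ℕ) (x y : T3) :
    torusPartial i (fun y => torusPotential i n (x - y)) y =
      -((circleKernel (n + 1) (x i - y i) - circleKernel n (x i - y i)) *
        ∏ j ∈ Finset.univ.erase i, potentialFactor i n j (x j - y j)) := by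
  have hfactor (h : ℝ) : torusPotential i n (x - (y + Pi.single i (h : UnitAddCircle)))
      = circlePrimitive n (x i - y i - h) *
        ∏ j ∈ Finset.univ.erase i, potentialFactor i n j (x j - y j) := by
    rw [torusPotential, ← Finset.mul_prod_erase _ _ (Finset.mem_univ i)]
    congr 1
    · simp [potentialFactor, sub_sub]
    · refine Finset.prod_congr rfl fun j hj => ?_
      simp [Pi.single_eq_of_ne (Finset.ne_of_mem_erase hj)]
  simp only [torusPartial, hfactor]
  rw [((hasDerivAt_circlePrimitive_sub n (x i - y i)).mul_const _).deriv, neg_mul]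

lemma continuous_torusPartial_torusPotential_sub (i : Fin 3) (n : ℕ) (x : T3) :
    Continuous (torusPartial i fun y => torusPotential i n (x - y)) := by
  rw [funext (torusPartial_torusPotential_sub i n x)]
  fun_prop

lemma prod_erase_potentialFactor (i : Fin 3) (n : ℕ) (z : Fin 3 → UnitAddCircle) :
    ∏ j ∈ Finset.univ.erase i, potentialFactor i n j (z j) =
      (∏ j with j < i, circleKernel (n + 1) (z j)) * ∏ j with i < j, circleKernel n (z j) := by
  have hif : ∀ j ∈ Finset.univ.erase i, potentialFactor i n j (z j) =
      if j < i then circleKernel (n + 1) (z j) else circleKernel n (z j) := by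
    intro j hj
    rw [potentialFactor, if_neg (Finset.ne_of_mem_erase hj)]
    split_ifs <;> rfl
  rw [Finset.prod_congr rfl hif, Finset.prod_ite]
  congr 2 <;> · ext j; simp; omega

lemma sum_torusPartial_torusPotential_sub (n : ℕ) (x y : T3) :
    ∑ i, torusPartial i (fun y => torusPotential i n (x - y)) y =
      torusKernel n (x - y) - torusKernel (n + 1) (x - y) := by
  have h := Finset.prod_sub_ordered Finset.univ (fun j => circleKernel n (x j - y j))
    (fun j => circleKernel n (x j - y j) - circleKernel (n + 1) (x j - y j))
  simp only [sub_sub_cancel] at h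
  simp only [torusKernel, Pi.sub_apply, h, torusPartial_torusPotential_sub]
  rw [sub_sub_cancel]
  refine Finset.sum_congr rfl fun i _ => ?_
  rw [prod_erase_potentialFactor i n fun j => x j - y j]
  ring

lemma exists_bound_of_continuous {X : Type*} [TopologicalSpace X] [CompactSpace X] {f : X → ℝ}
    (hf : Continuous f) : ∃ B : ℝ, ∀ x, ‖f x‖ ≤ B := by
  simpa using isCompact_univ.exists_bound_of_continuousOn hf.continuousOn

lemma conv_apply (f k : T3 → ℝ) (x : T3) :
    conv f k x = ∫ y, f y * k (x - y) ∂torusMeasure := rfl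

lemma integrable_mul_sub {f k : T3 → ℝ} (hf : Integrable f torusMeasure) (hk : Continuous k)
    (x : T3) : Integrable (fun y => f y * k (x - y)) torusMeasure :=
  (HasCompactSupport.of_compactSpace k).convolutionExists_right (ContinuousLinearMap.mul ℝ ℝ)
    hf.locallyIntegrable hk x

lemma continuous_conv {f k : T3 → ℝ} (hf : Integrable f torusMeasure) (hk : Continuous k) :
    Continuous (conv f k) :=
  (HasCompactSupport.of_compactSpace k).continuous_convolution_right _ hf.locallyIntegrable hk

lemma conv_torusKernel_succ_sub {f : T3 → ℝ} {g : Fin 3 → T3 → ℝ}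
    (hf : Integrable f torusMeasure) (hg : IsTorusWeakGrad f g) (n : ℕ) (x : T3) :
    conv f (torusKernel (n + 1)) x - conv f (torusKernel n) x
      = ∑ i, conv (g i) (torusPotential i n) x := by
  have hparts (i : Fin 3) : conv (g i) (torusPotential i n) x
      = -∫ y, f y * torusPartial i (fun y => torusPotential i n (x - y)) y ∂torusMeasure := by
    rw [hg i _ (smoothTorus_torusPotential_sub i n x), neg_neg, conv_apply]
  have hinteg (i : Fin 3) : Integrable (fun y => f y *
      torusPartial i (fun y => torusPotential i n (x - y)) y) torusMeasure := by
    have hcont := continuous_torusPartial_torusPotential_sub i n x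
    obtain ⟨B, hB⟩ := exists_bound_of_continuous hcont
    exact hf.mul_bdd (c := B) hcont.aestronglyMeasurable (ae_of_all _ hB)
  simp only [hparts, Finset.sum_neg_distrib]
  rw [← integral_finsetSum _ fun i _ => hinteg i]
  simp only [← Finset.mul_sum, sum_torusPartial_torusPotential_sub]
  rw [conv_apply, conv_apply, ← integral_sub (integrable_mul_sub hf (by fun_prop) x)
    (integrable_mul_sub hf (by fun_prop) x), ← integral_neg]
  congr 1
  ext y
  ring

end Torus

/-! ### The approximate identity and the subcritical Sobolev embedding -/

section ApproximateIdentity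

instance : torusMeasure.IsNegInvariant :=
  Measure.IsAddHaarMeasure.isNegInvariant_of_regular _

lemma lintegral_enorm_torusKernel (n : ℕ) : ∫⁻ y, ‖torusKernel n y‖ₑ ∂torusMeasure = 1 := by
  simp only [Real.enorm_of_nonneg (torusKernel_nonneg n _)]
  rw [← ofReal_integral_eq_lintegral_ofReal (integrable_of_continuous (by fun_prop))
    (ae_of_all _ (torusKernel_nonneg n)), integral_torusKernel, ENNReal.ofReal_one]

lemma conv_apply_swap (f k : T3 → ℝ) (x : T3) :
    conv f k x = ∫ y, f (x - y) * k y ∂torusMeasure :=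
  convolution_mul_swap

lemma conv_sub {f g k : T3 → ℝ} (hf : Integrable f torusMeasure) (hg : Integrable g torusMeasure)
    (hk : Continuous k) : conv (f - g) k = conv f k - conv g k := by
  ext x
  simp only [conv_apply, Pi.sub_apply, sub_mul]
  exact integral_sub (integrable_mul_sub hf hk x) (integrable_mul_sub hg hk x)

lemma eLpNorm_conv_torusKernel_le {f : T3 → ℝ} (hf : Integrable f torusMeasure) (n : ℕ) :
    eLpNorm (conv f (torusKernel n)) 1 torusMeasure ≤ eLpNorm f 1 torusMeasure := by
  obtain ⟨B, hB⟩ := exists_bound_of_continuous (continuous_torusKernel n)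
  have h := eLpNorm_convolution_mul_le (μ := torusMeasure) le_rfl le_rfl ENNReal.one_ne_top hf.1
    (continuous_torusKernel n).measurable (B := ENNReal.ofReal B) fun y => by
      rw [← ofReal_norm]; exact ENNReal.ofReal_le_ofReal (hB y)
  simpa [conv, lintegral_enorm_torusKernel] using h

lemma prod_cosSq_lt_one {x : T3} (hx : x ≠ 0) : ∏ j, cosSq (x j) < 1 := by
  obtain ⟨i, hi⟩ := Function.ne_iff.1 hx
  calc ∏ j, cosSq (x j) = cosSq (x i) * ∏ j ∈ Finset.univ.erase i, cosSq (x j) :=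
        (Finset.mul_prod_erase _ _ (Finset.mem_univ i)).symm
    _ ≤ cosSq (x i) * 1 := by
        gcongr
        · exact cosSq_nonneg _
        · exact Finset.prod_le_one (fun j _ => cosSq_nonneg _) fun j _ => cosSq_le_one _
    _ < 1 := by rw [mul_one]; exact cosSq_lt_one hi

lemma torusKernel_eq (n : ℕ) (x : T3) :
    torusKernel n x = cosConst n ^ 3 * (∏ j, cosSq (x j)) ^ n := by
  simp [torusKernel, circleKernel, Finset.prod_mul_distrib, Finset.prod_pow]

lemma tendsto_conv_of_continuous {f : T3 → ℝ} (hf : Continuous f) (x : T3) :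
    Tendsto (fun n => conv f (torusKernel n) x) atTop (𝓝 (f x)) := by
  have hpow (n : ℕ) : ∫ y : T3, (∏ j, cosSq (y j)) ^ n ∂torusMeasure = (cosConst n ^ 3)⁻¹ := by
    refine eq_inv_of_mul_eq_one_right ?_
    rw [← integral_const_mul]
    simpa only [torusKernel_eq] using integral_torusKernel n
  have h := tendsto_setIntegral_pow_smul_of_unique_maximum_of_isCompact_of_continuousOn
    (μ := torusMeasure) (s := univ) (c := fun y : T3 => ∏ j, cosSq (y j)) (x₀ := 0)
    (g := fun y => f (x - y)) isCompact_univ (by fun_prop)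
    (fun y _ hy => by simpa [cosSq_zero] using prod_cosSq_lt_one hy)
    (fun y _ => Finset.prod_nonneg fun j _ => cosSq_nonneg _) (by simp [cosSq_zero]) (by simp)
    (by fun_prop)
  simp only [Measure.restrict_univ, sub_zero, hpow] at h
  refine h.congr fun n => ?_
  rw [conv_apply_swap, inv_inv, smul_eq_mul, ← integral_const_mul]
  refine integral_congr_ae (ae_of_all _ fun y => ?_)
  simp only [torusKernel_eq, smul_eq_mul]
  ring

lemma norm_conv_torusKernel_le {f : T3 → ℝ} {M : ℝ} (hM : ∀ x, ‖f x‖ ≤ M) (n : ℕ) (x : T3) :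
    ‖conv f (torusKernel n) x‖ ≤ M := by
  rw [conv_apply_swap]
  calc _ ≤ ∫ y, M * torusKernel n y ∂torusMeasure := by
        refine norm_integral_le_of_norm_le
          ((integrable_of_continuous (by fun_prop)).const_mul M) (ae_of_all _ fun y => ?_)
        rw [norm_mul, Real.norm_of_nonneg (torusKernel_nonneg n y)]
        gcongr
        · exact torusKernel_nonneg n y
        · exact hM _
    _ = M := by rw [integral_const_mul, integral_torusKernel, mul_one]

lemma tendsto_eLpNorm_conv_sub_of_continuous {f : T3 → ℝ} (hf : Continuous f) :
    Tendsto (fun n => eLpNorm (conv f (torusKernel n) - f) 1 torusMeasure) atTop (𝓝 0) := by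
  obtain ⟨M, hM⟩ := exists_bound_of_continuous hf
  have h := tendsto_lintegral_norm_of_dominated_convergence (μ := torusMeasure)
    (F := fun n => conv f (torusKernel n)) (f := f) (bound := fun _ => M)
    (fun n => (continuous_conv (integrable_of_continuous hf) (by fun_prop)).aestronglyMeasurable)
    (integrable_const M).2 (fun n => ae_of_all _ (norm_conv_torusKernel_le hM n))
    (ae_of_all _ (tendsto_conv_of_continuous hf))
  simpa only [eLpNorm_one_eq_lintegral_enorm, Pi.sub_apply, ofReal_norm] using h

lemma tendsto_eLpNorm_conv_sub {f : T3 → ℝ} (hf : Integrable f torusMeasure) :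
    Tendsto (fun n => eLpNorm (conv f (torusKernel n) - f) 1 torusMeasure) atTop (𝓝 0) := by
  rw [ENNReal.tendsto_nhds_zero]
  intro ε hε
  have hε3 : ε / 3 ≠ 0 := (ENNReal.div_pos hε.ne' (by simp)).ne'
  obtain ⟨g, hgc, hfg⟩ : ∃ g : T3 → ℝ, Continuous g ∧ eLpNorm (f - g) 1 torusMeasure ≤ ε / 3 := by
    obtain ⟨g, hfg, -⟩ := (memLp_one_iff_integrable.2 hf).exists_boundedContinuous_eLpNorm_sub_le
      ENNReal.one_ne_top hε3
    exact ⟨g, g.continuous, hfg⟩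
  have hg : Integrable g torusMeasure := integrable_of_continuous hgc
  filter_upwards [ENNReal.tendsto_nhds_zero.1
    (tendsto_eLpNorm_conv_sub_of_continuous hgc) (ε / 3) (pos_iff_ne_zero.2 hε3)]
    with n hgn
  have hmeas {u : T3 → ℝ} (hu : Integrable u torusMeasure) :
      AEStronglyMeasurable (conv u (torusKernel n)) torusMeasure :=
    (continuous_conv hu (continuous_torusKernel n)).aestronglyMeasurable
  have hsplit : conv f (torusKernel n) - f =
      conv (f - g) (torusKernel n) + (conv g (torusKernel n) - g) - (f - g) := by
    rw [conv_sub hf hg (continuous_torusKernel n)]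
    abel
  calc eLpNorm (conv f (torusKernel n) - f) 1 torusMeasure
      ≤ eLpNorm (conv (f - g) (torusKernel n)) 1 torusMeasure +
        eLpNorm (conv g (torusKernel n) - g) 1 torusMeasure + eLpNorm (f - g) 1 torusMeasure := by
        rw [hsplit]
        refine (eLpNorm_sub_le ((hmeas (hf.sub hg)).add ((hmeas hg).sub hg.1)) (hf.sub hg).1
          le_rfl).trans ?_
        gcongr
        exact eLpNorm_add_le (hmeas (hf.sub hg)) ((hmeas hg).sub hg.1) le_rfl
    _ ≤ ε / 3 + ε / 3 + ε / 3 := by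
        gcongr
        exact (eLpNorm_conv_torusKernel_le (hf.sub hg) n).trans hfg
    _ = ε := ENNReal.add_thirds ε

end ApproximateIdentity

section Sobolev

variable {p s : ℝ≥0∞}

/-- The constant in the `L^p`-`L^s` bound for the convolution with `torusPotential i n`. -/
def potentialConst (p s : ℝ≥0∞) (n : ℕ) : ℝ≥0∞ :=
  ENNReal.ofReal (((n + 1 : ℝ) ^ (3 / 2 : ℝ))⁻¹) ^ (1 - 1 / p.toReal + 1 / s.toReal) *
    5 ^ (1 / p.toReal - 1 / s.toReal)

lemma one_div_toReal_le_one (hp : 1 ≤ p) : 1 / p.toReal ≤ 1 := by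
  rcases eq_or_ne p ⊤ with rfl | hpt
  · simp
  · exact (div_le_one₀ (ENNReal.toReal_pos (one_pos.trans_le hp).ne' hpt)).2
      (by simpa using ENNReal.toReal_mono hpt hp)

lemma eLpNorm_conv_torusPotential_le (hp : 1 ≤ p) (hps : p ≤ s) (hs : s ≠ ⊤) {g : T3 → ℝ}
    (hg : AEStronglyMeasurable g torusMeasure) (i : Fin 3) (n : ℕ) :
    eLpNorm (conv g (torusPotential i n)) s torusMeasure
      ≤ potentialConst p s n * eLpNorm g p torusMeasure := by
  have hexp : 0 ≤ 1 - 1 / p.toReal + 1 / s.toReal := by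
    have := one_div_toReal_le_one hp
    have : 0 ≤ 1 / s.toReal := by positivity
    linarith
  have hint : ∫⁻ y, ‖torusPotential i n y‖ₑ ∂torusMeasure
      ≤ ENNReal.ofReal (((n + 1 : ℝ) ^ (3 / 2 : ℝ))⁻¹) := by
    rw [← ofReal_integral_norm_eq_lintegral_enorm (integrable_of_continuous (by fun_prop))]
    exact ENNReal.ofReal_le_ofReal (integral_abs_torusPotential_le i n)
  have hsup (y : T3) : ‖torusPotential i n y‖ₑ ≤ 5 := by
    simpa [Real.enorm_eq_ofReal_abs] using ENNReal.ofReal_le_ofReal (abs_torusPotential_le i n y)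
  refine (eLpNorm_convolution_mul_le hp hps hs hg
    (continuous_torusPotential i n).measurable hsup).trans ?_
  rw [potentialConst]
  gcongr

lemma tsum_potentialConst_ne_top (hp : 1 ≤ p) (hps : p ≤ s) (hs : s ≠ ⊤)
    (hcrit : p⁻¹ < s⁻¹ + 3⁻¹) : ∑' n, potentialConst p s n ≠ ⊤ := by
  have hpt : p ≠ ⊤ := ne_top_of_le_ne_top hs hps
  have hp0 : p ≠ 0 := (one_pos.trans_le hp).ne'
  have hs0 : s ≠ 0 := (one_pos.trans_le (hp.trans hps)).ne'
  have h0 : 0 ≤ 1 / p.toReal - 1 / s.toReal :=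
    sub_nonneg.2 (one_div_le_one_div_of_le (ENNReal.toReal_pos hp0 hpt)
      (ENNReal.toReal_mono hs hps))
  have hcrit' : 1 / p.toReal < 1 / s.toReal + 1 / 3 := by
    have h := (ENNReal.toReal_lt_toReal (by simpa) (by simp [hs0])).2 hcrit
    rw [ENNReal.toReal_add (by simpa) (by simp)] at h
    simpa using h
  set γ := 1 - 1 / p.toReal + 1 / s.toReal
  have _ : 2 / 3 < γ := by simp only [γ]; linarith
  have hterm (n : ℕ) : ENNReal.ofReal (((n + 1 : ℝ) ^ (3 / 2 : ℝ))⁻¹) ^ γ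
      = ENNReal.ofReal (1 / ((n + 1 : ℕ) : ℝ) ^ (3 / 2 * γ)) := by
    rw [ENNReal.ofReal_rpow_of_nonneg (by positivity) (by linarith), Real.inv_rpow (by positivity),
      ← Real.rpow_mul (by positivity), one_div, Nat.cast_add_one]
  simp only [potentialConst]
  rw [ENNReal.tsum_mul_right]
  refine ENNReal.mul_ne_top ?_ (ENNReal.rpow_ne_top_of_nonneg h0 (by simp))
  simp only [hterm, γ]
  exact Summable.tsum_ofReal_ne_top
    ((summable_nat_add_iff 1).2 (Real.summable_one_div_nat_rpow.2 (by linarith)))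

variable {f : T3 → ℝ} {g : Fin 3 → T3 → ℝ}

lemma conv_torusKernel_sub_eq_sum (hf : Integrable f torusMeasure)
    (hg : IsTorusWeakGrad f g) (N k : ℕ) :
    conv f (torusKernel (N + k)) - conv f (torusKernel N)
      = ∑ n ∈ Finset.range k, ∑ i, conv (g i) (torusPotential i (N + n)) := by
  have hstep (n : ℕ) : conv f (torusKernel (N + (n + 1))) - conv f (torusKernel (N + n))
      = ∑ i, conv (g i) (torusPotential i (N + n)) := by
    ext x
    simpa only [Pi.sub_apply, Finset.sum_apply, add_assoc] using
      conv_torusKernel_succ_sub hf hg (N + n) x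
  simp only [← hstep]
  exact (Finset.sum_range_sub (fun n => conv f (torusKernel (N + n))) k).symm

lemma eLpNorm_conv_torusKernel_sub_le (hp : 1 ≤ p) (hps : p ≤ s) (hs : s ≠ ⊤)
    (hf : Integrable f torusMeasure) (hgm : ∀ i, MemLp (g i) p torusMeasure)
    (hg : IsTorusWeakGrad f g) (N k : ℕ) :
    eLpNorm (conv f (torusKernel (N + k)) - conv f (torusKernel N)) s torusMeasure
      ≤ (∑' n, potentialConst p s (n + N)) * ∑ i, eLpNorm (g i) p torusMeasure := by
  have hs1 : 1 ≤ s := hp.trans hps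
  have hmeas (i : Fin 3) (n : ℕ) :
      AEStronglyMeasurable (conv (g i) (torusPotential i n)) torusMeasure :=
    (continuous_conv ((hgm i).integrable hp) (continuous_torusPotential i n)).aestronglyMeasurable
  rw [conv_torusKernel_sub_eq_sum hf hg]
  calc _ ≤ ∑ n ∈ Finset.range k,
          eLpNorm (∑ i, conv (g i) (torusPotential i (N + n))) s torusMeasure :=
        eLpNorm_sum_le (fun n _ => Finset.aestronglyMeasurable_sum _ fun i _ => hmeas i _) hs1
    _ ≤ ∑ n ∈ Finset.range k, potentialConst p s (n + N) * ∑ i, eLpNorm (g i) p torusMeasure := by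
        gcongr with n
        refine (eLpNorm_sum_le (fun i _ => hmeas i _) hs1).trans ?_
        rw [Finset.mul_sum, add_comm n N]
        gcongr with i
        exact eLpNorm_conv_torusPotential_le hp hps hs (hgm i).1 i (N + n)
    _ = (∑ n ∈ Finset.range k, potentialConst p s (n + N)) * ∑ i, eLpNorm (g i) p torusMeasure :=
        (Finset.sum_mul _ _ _).symm
    _ ≤ _ := by
        gcongr
        exact ENNReal.sum_le_tsum _

theorem eLpNorm_sub_conv_torusKernel_le (hp : 1 ≤ p) (hps : p ≤ s) (hs : s ≠ ⊤)
    (hf : Integrable f torusMeasure) (hgm : ∀ i, MemLp (g i) p torusMeasure)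
    (hg : IsTorusWeakGrad f g) (N : ℕ) :
    eLpNorm (f - conv f (torusKernel N)) s torusMeasure
      ≤ (∑' n, potentialConst p s (n + N)) * ∑ i, eLpNorm (g i) p torusMeasure := by
  have hmeas (n : ℕ) : AEStronglyMeasurable (conv f (torusKernel n)) torusMeasure :=
    (continuous_conv hf (continuous_torusKernel n)).aestronglyMeasurable
  obtain ⟨ns, hns, hlim⟩ := (tendstoInMeasure_of_tendsto_eLpNorm one_ne_zero
    hmeas hf.1 (tendsto_eLpNorm_conv_sub hf)).exists_seq_tendsto_ae
  refine (Lp.eLpNorm_lim_le_liminf_eLpNorm (fun j => (hmeas (ns j)).sub (hmeas N)) _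
    (hlim.mono fun x hx => hx.sub_const _)).trans
    (liminf_le_of_frequently_le' (Eventually.frequently ?_))
  filter_upwards [hns.tendsto_atTop.eventually_ge_atTop N] with j hj
  obtain ⟨k, hk⟩ := Nat.exists_eq_add_of_le hj
  rw [hk]
  exact eLpNorm_conv_torusKernel_sub_le hp hps hs hf hgm hg N k

end Sobolev

/-! ### Compensated compactness in time -/

section Time

variable {T : ℝ} {γ β w : ℝ → ℂ} {χ : ℝ → ℝ}

instance : IsFiniteMeasure (timeMeasure T) := by
  unfold timeMeasure
  infer_instance

lemma ae_mem_Icc (T : ℝ) : ∀ᵐ t ∂timeMeasure T, t ∈ Icc 0 T :=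
  ae_restrict_mem measurableSet_Icc

lemma integrable_mul_of_continuous (hβ : Integrable β (timeMeasure T)) (hχ : Continuous χ) :
    Integrable (fun t => β t * (χ t : ℂ)) (timeMeasure T) := by
  obtain ⟨M, hM⟩ := isCompact_Icc.exists_bound_of_continuousOn (s := Icc 0 T) hχ.continuousOn
  refine hβ.mul_bdd (c := M) (by fun_prop) ?_
  filter_upwards [ae_mem_Icc T] with t ht
  simpa using hM t ht

/-- The primitive of `w` vanishing at time zero. -/
def timePrimitive (T : ℝ) (w : ℝ → ℂ) (t : ℝ) : ℂ := ∫ s in Iic t, w s ∂timeMeasure T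

/-- The integral of `γ` over the remaining time. -/
def timeTail (T : ℝ) (γ : ℝ → ℂ) (s : ℝ) : ℂ := ∫ t in Ici s, γ t ∂timeMeasure T

lemma integral_mul_timePrimitive (hγ : Integrable γ (timeMeasure T))
    (hw : Integrable w (timeMeasure T)) :
    ∫ t, γ t * timePrimitive T w t ∂timeMeasure T = ∫ s, w s * timeTail T γ s ∂timeMeasure T := by
  have hS : MeasurableSet {z : ℝ × ℝ | z.2 ≤ z.1} :=
    measurableSet_le measurable_snd measurable_fst
  calc _ = ∫ t, ∫ s, {z : ℝ × ℝ | z.2 ≤ z.1}.indicator (fun z => γ z.1 * w z.2) (t, s)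
          ∂timeMeasure T ∂timeMeasure T := by
        congr 1 with t
        rw [timePrimitive, ← integral_indicator measurableSet_Iic, ← integral_const_mul]
        congr 1 with s
        by_cases h : s ≤ t <;> simp [h]
    _ = ∫ s, ∫ t, {z : ℝ × ℝ | z.2 ≤ z.1}.indicator (fun z => γ z.1 * w z.2) (t, s)
          ∂timeMeasure T ∂timeMeasure T := integral_integral_swap ((hγ.mul_prod hw).indicator hS)
    _ = _ := by
        congr 1 with s
        rw [timeTail, ← integral_indicator measurableSet_Ici, ← integral_const_mul]
        congr 1 with t
        by_cases h : s ≤ t <;> simp [h, mul_comm]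

lemma norm_timePrimitive_le (hw : Integrable w (timeMeasure T)) (t : ℝ) :
    ‖timePrimitive T w t‖ ≤ ∫ s, ‖w s‖ ∂timeMeasure T :=
  (norm_integral_le_integral_norm _).trans
    (setIntegral_le_integral hw.norm (ae_of_all _ fun _ => norm_nonneg _))

lemma aestronglyMeasurable_timePrimitive (hw : Integrable w (timeMeasure T)) :
    AEStronglyMeasurable (timePrimitive T w) (timeMeasure T) := by
  have hS : MeasurableSet {z : ℝ × ℝ | z.2 ≤ z.1} :=
    measurableSet_le measurable_snd measurable_fst
  refine (hw.1.comp_snd (μ := timeMeasure T).indicator hS).integral_prod_right'.congr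
    (ae_of_all _ fun t => ?_)
  rw [timePrimitive, ← integral_indicator measurableSet_Iic]
  rfl

lemma integrable_timePrimitive (hw : Integrable w (timeMeasure T)) :
    Integrable (timePrimitive T w) (timeMeasure T) :=
  Integrable.of_bound (aestronglyMeasurable_timePrimitive hw) _
    (ae_of_all _ fun t => norm_timePrimitive_le hw t)

/-- Smooth functions with compact support in `(0, T)`. -/
def IsTimeTest (T : ℝ) (χ : ℝ → ℝ) : Prop :=
  ContDiff ℝ ∞ χ ∧ HasCompactSupport χ ∧ tsupport χ ⊆ Ioo 0 T

/-- `w` is the derivative of `β` in the sense of distributions on `(0, T)`. -/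
def IsScalarWeakDeriv (T : ℝ) (β w : ℝ → ℂ) : Prop :=
  ∀ χ, IsTimeTest T χ →
    ∫ t, β t * ((deriv χ t : ℝ) : ℂ) ∂timeMeasure T = -∫ t, w t * (χ t : ℂ) ∂timeMeasure T

namespace IsTimeTest

lemma continuous_deriv (hχ : IsTimeTest T χ) : Continuous (deriv χ) :=
  hχ.1.continuous_deriv (by simp)

lemma integrable (hχ : IsTimeTest T χ) : Integrable χ :=
  hχ.1.continuous.integrable_of_hasCompactSupport hχ.2.1

lemma eq_zero (hχ : IsTimeTest T χ) {t : ℝ} (ht : t ∉ Ioo 0 T) : χ t = 0 :=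
  image_eq_zero_of_notMem_tsupport fun h => ht (hχ.2.2 h)

lemma integral_mul_timeMeasure (hχ : IsTimeTest T χ) (β : ℝ → ℂ) :
    ∫ t, β t * (χ t : ℂ) ∂timeMeasure T = ∫ t, β t * (χ t : ℂ) :=
  setIntegral_eq_integral_of_forall_compl_eq_zero fun t ht => by
    rw [hχ.eq_zero fun h => ht (Ioo_subset_Icc_self h), Complex.ofReal_zero, mul_zero]

lemma exists_Icc_eq_zero (hχ : IsTimeTest T χ) (hT : 0 < T) :
    ∃ a b, 0 < a ∧ b < T ∧ ∀ t ∉ Icc a b, χ t = 0 := by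
  rcases (tsupport χ).eq_empty_or_nonempty with h | h
  · exact ⟨T, 0, hT, hT, fun t _ => by simp [tsupport_eq_empty_iff.1 h]⟩
  · refine ⟨sInf (tsupport χ), sSup (tsupport χ), (hχ.2.2 (hχ.2.1.sInf_mem h)).1,
      (hχ.2.2 (hχ.2.1.sSup_mem h)).2, fun t ht => image_eq_zero_of_notMem_tsupport fun hmem =>
        ht ⟨csInf_le hχ.2.1.bddBelow hmem, le_csSup hχ.2.1.bddAbove hmem⟩⟩

lemma exists_primitive (hχ : IsTimeTest T χ) (hT : 0 < T) (h0 : ∫ t, χ t = 0) :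
    ∃ ζ, IsTimeTest T ζ ∧ deriv ζ = χ := by
  obtain ⟨a, b, ha, hb, hzero⟩ := hχ.exists_Icc_eq_zero hT
  set ζ : ℝ → ℝ := fun t => ∫ u in Iic t, χ u
  have hζ : ζ = fun t => ζ 0 + ∫ u in (0 : ℝ)..t, χ u := by
    ext t
    rw [← intervalIntegral.integral_Iic_sub_Iic hχ.integrable.integrableOn
      hχ.integrable.integrableOn, add_sub_cancel]
  have hderiv (t : ℝ) : HasDerivAt ζ (χ t) t := by
    rw [hζ]
    exact (intervalIntegral.integral_hasDerivAt_right (hχ.1.continuous.intervalIntegrable _ _)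
      (hχ.1.continuous.stronglyMeasurableAtFilter _ _) hχ.1.continuous.continuousAt).const_add _
  have hζzero (t : ℝ) (ht : t ∉ Icc a b) : ζ t = 0 := by
    rcases not_and_or.1 ht with hta | htb
    · exact setIntegral_eq_zero_of_forall_eq_zero fun u hu =>
        hzero u fun h => hta (h.1.trans hu)
    · rw [← h0]
      exact setIntegral_eq_integral_of_forall_compl_eq_zero fun u hu =>
        hzero u fun h => hu (h.2.trans (not_le.1 htb).le)
  have hsupp : tsupport ζ ⊆ Icc a b :=
    closure_minimal (fun t ht => by_contra fun h => ht (hζzero t h)) isClosed_Icc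
  have hderiv' : deriv ζ = χ := funext fun t => (hderiv t).deriv
  refine ⟨ζ, ⟨?_, ?_, ?_⟩, hderiv'⟩
  · rw [contDiff_infty_iff_deriv, hderiv']
    exact ⟨fun t => (hderiv t).differentiableAt, hχ.1⟩
  · exact isCompact_Icc.of_isClosed_subset (isClosed_tsupport ζ) hsupp
  · exact hsupp.trans fun t ht => ⟨ha.trans_le ht.1, ht.2.trans_lt hb⟩

lemma sub_const_mul {χ₀ : ℝ → ℝ} (hχ : IsTimeTest T χ) (hχ₀ : IsTimeTest T χ₀) (c : ℝ) :
    IsTimeTest T (fun t => χ t - c * χ₀ t) := by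
  have hsupp : tsupport (fun t => χ t - c * χ₀ t) ⊆ tsupport χ ∪ tsupport χ₀ :=
    (tsupport_sub χ _).trans (union_subset_union_right _ (tsupport_mul_subset_right ..))
  exact ⟨hχ.1.sub (contDiff_const.mul hχ₀.1),
    (hχ.2.1.isCompact.union hχ₀.2.1.isCompact).of_isClosed_subset (isClosed_tsupport _) hsupp,
    hsupp.trans (union_subset hχ.2.2 hχ₀.2.2)⟩

end IsTimeTest

lemma exists_timeTest_integral_eq_one (hT : 0 < T) : ∃ χ, IsTimeTest T χ ∧ ∫ t, χ t = 1 := by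
  let B : ContDiffBump (T / 2) := ⟨T / 8, T / 4, by positivity, by linarith⟩
  refine ⟨B.normed volume, ⟨B.contDiff_normed, B.hasCompactSupport_normed, ?_⟩,
    B.integral_normed⟩
  rw [B.tsupport_normed_eq, Real.closedBall_eq_Icc]
  exact Icc_subset_Ioo (by simp only [B]; linarith) (by simp only [B]; linarith)

lemma timeTail_deriv (hχ : IsTimeTest T χ) {s : ℝ} (hs : s ∈ Icc 0 T) :
    timeTail T (fun t => ((deriv χ t : ℝ) : ℂ)) s = -(χ s : ℂ) := by
  have hinter : Ici s ∩ Icc 0 T = Icc s T := by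
    rw [← Ici_inter_Iic, ← inter_assoc, Ici_inter_Ici, sup_of_le_left hs.1, Ici_inter_Iic]
  rw [timeTail, timeMeasure, Measure.restrict_restrict measurableSet_Ici, hinter,
    integral_Icc_eq_integral_Ioc, ← intervalIntegral.integral_of_le hs.2,
    intervalIntegral.integral_ofReal, intervalIntegral.integral_deriv_eq_sub
    (fun t _ => (hχ.1.differentiable (by simp)).differentiableAt)
    (hχ.continuous_deriv.intervalIntegrable _ _), hχ.eq_zero (t := T) (by simp)]
  simp

lemma isScalarWeakDeriv_timePrimitive (hw : Integrable w (timeMeasure T)) :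
    IsScalarWeakDeriv T (timePrimitive T w) w := by
  intro χ hχ
  have hd : Integrable (fun t => ((deriv χ t : ℝ) : ℂ)) (timeMeasure T) := by
    simpa using integrable_mul_of_continuous (integrable_const 1) hχ.continuous_deriv
  simp only [mul_comm (timePrimitive T w _)]
  rw [integral_mul_timePrimitive hd hw, ← integral_neg]
  refine integral_congr_ae ?_
  filter_upwards [ae_mem_Icc T] with s hs
  rw [timeTail_deriv hχ hs, mul_neg]

/-- The du Bois-Reymond lemma. -/
lemma ae_eq_const_of_isScalarWeakDeriv_zero (hT : 0 < T) (hβ : Integrable β (timeMeasure T))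
    (h : IsScalarWeakDeriv T β 0) : ∃ c : ℂ, ∀ᵐ t ∂timeMeasure T, β t = c := by
  obtain ⟨χ₀, hχ₀, hχ₀one⟩ := exists_timeTest_integral_eq_one hT
  set c : ℂ := ∫ t, β t * (χ₀ t : ℂ) ∂timeMeasure T
  refine ⟨c, ?_⟩
  have hmean (χ : ℝ → ℝ) (hχ : IsTimeTest T χ) :
      ∫ t, (β t - c) * (χ t : ℂ) ∂timeMeasure T = 0 := by
    have hmeanzero : ∫ t, (χ t - (∫ u, χ u) * χ₀ t) = 0 := by
      rw [integral_sub hχ.integrable (hχ₀.integrable.const_mul _), integral_const_mul, hχ₀one]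
      ring
    obtain ⟨ζ, hζ, hζd⟩ := (hχ.sub_const_mul hχ₀ (∫ u, χ u)).exists_primitive hT hmeanzero
    have hχint : ∫ t, c * (χ t : ℂ) ∂timeMeasure T = c * (∫ u, χ u : ℝ) := by
      rw [hχ.integral_mul_timeMeasure, integral_const_mul, integral_complex_ofReal]
    have hβζ : ∫ t, (β t * (χ t : ℂ) - β t * (χ₀ t : ℂ) * (∫ u, χ u : ℝ)) ∂timeMeasure T = 0 := by
      rw [← neg_zero, ← integral_zero ℝ ℂ (μ := timeMeasure T)]
      refine Eq.trans ?_ ((h ζ hζ).trans (by simp))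
      rw [hζd]
      congr 1 with t
      push_cast
      ring
    rw [integral_sub (integrable_mul_of_continuous hβ hχ.1.continuous)
      ((integrable_mul_of_continuous hβ hχ₀.1.continuous).mul_const _), integral_mul_const] at hβζ
    simp only [sub_mul]
    rw [integral_sub (integrable_mul_of_continuous hβ hχ.1.continuous)
      (integrable_mul_of_continuous (integrable_const c) hχ.1.continuous), hχint, hβζ]
  have hint : IntegrableOn (fun t => β t - c) (Icc 0 T) := hβ.sub (integrable_const c)
  have hloc : LocallyIntegrableOn (fun t => β t - c) (Ioo 0 T) :=
    (hint.mono_set Ioo_subset_Icc_self).locallyIntegrableOn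
  have hzero := isOpen_Ioo.ae_eq_zero_of_integral_contDiff_smul_eq_zero hloc fun χ h1 h2 h3 => by
    rw [← hmean χ ⟨h1, h2, h3⟩, IsTimeTest.integral_mul_timeMeasure ⟨h1, h2, h3⟩]
    simp only [Complex.real_smul, mul_comm]
  rw [timeMeasure, ← restrict_Ioo_eq_restrict_Icc, ae_restrict_iff' measurableSet_Ioo]
  exact hzero.mono fun t ht hmem => sub_eq_zero.1 (ht hmem)

theorem ae_eq_const_add_timePrimitive (hT : 0 < T) (hβ : Integrable β (timeMeasure T))
    (hw : Integrable w (timeMeasure T)) (h : IsScalarWeakDeriv T β w) :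
    ∃ c : ℂ, ∀ᵐ t ∂timeMeasure T, β t = c + timePrimitive T w t := by
  obtain ⟨c, hc⟩ := ae_eq_const_of_isScalarWeakDeriv_zero (β := fun t => β t - timePrimitive T w t)
    hT (hβ.sub (integrable_timePrimitive hw)) fun χ hχ => by
      simp only [sub_mul]
      rw [integral_sub (integrable_mul_of_continuous hβ hχ.continuous_deriv)
        (integrable_mul_of_continuous (integrable_timePrimitive hw) hχ.continuous_deriv),
        h χ hχ, isScalarWeakDeriv_timePrimitive hw χ hχ]
      simp
  exact ⟨c, hc.mono fun t ht => by linear_combination ht⟩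

end Time

section TimeCompactness

variable {T : ℝ} {γ β w : ℝ → ℂ} {r : ℝ≥0∞}

lemma one_sub_one_div_toReal_pos (hr : 1 < r) : 0 < 1 - 1 / r.toReal := by
  rcases eq_or_ne r ⊤ with rfl | hrt
  · simp
  · have h1 : 1 < r.toReal := by simpa using ENNReal.toReal_strict_mono hrt hr
    rw [sub_pos, div_lt_one (one_pos.trans h1)]
    exact h1

lemma norm_timeTail_sub_le (hr : 1 < r) (hγ : Integrable γ (timeMeasure T)) {C : ℝ≥0}
    (hC : eLpNorm γ r (timeMeasure T) ≤ C) {s s' : ℝ} (hss : s ≤ s') :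
    ‖timeTail T γ s - timeTail T γ s'‖ ≤ C * (s' - s) ^ (1 - 1 / r.toReal) := by
  have hdiff : timeTail T γ s - timeTail T γ s' = ∫ t in Ico s s', γ t ∂timeMeasure T := by
    rw [timeTail, timeTail, ← Ico_union_Ici_eq_Ici hss, setIntegral_union
      ((Iio_disjoint_Ici le_rfl).mono_left Ico_subset_Iio_self) measurableSet_Ici
      hγ.integrableOn hγ.integrableOn, add_sub_cancel_right]
  have hvol : (timeMeasure T).restrict (Ico s s') univ ≤ ENNReal.ofReal (s' - s) := by
    rw [Measure.restrict_apply_univ, ← Real.volume_Ico]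
    exact Measure.restrict_apply_le _ _
  have hexp := (one_sub_one_div_toReal_pos hr).le
  rw [hdiff, ← toReal_enorm]
  refine ENNReal.toReal_le_of_le_ofReal (by have := sub_nonneg.2 hss; positivity) ?_
  calc ‖∫ t in Ico s s', γ t ∂timeMeasure T‖ₑ
      ≤ eLpNorm γ 1 ((timeMeasure T).restrict (Ico s s')) := by
        rw [eLpNorm_one_eq_lintegral_enorm]
        exact enorm_integral_le_lintegral_enorm _
    _ ≤ eLpNorm γ r ((timeMeasure T).restrict (Ico s s')) *
          (timeMeasure T).restrict (Ico s s') univ ^ (1 - 1 / r.toReal) := by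
        simpa using eLpNorm_le_eLpNorm_mul_rpow_measure_univ hr.le hγ.1.restrict
    _ ≤ C * ENNReal.ofReal (s' - s) ^ (1 - 1 / r.toReal) := by
        gcongr
        exact (eLpNorm_mono_measure _ Measure.restrict_le_self).trans hC
    _ = ENNReal.ofReal (C * (s' - s) ^ (1 - 1 / r.toReal)) := by
        rw [ENNReal.ofReal_mul C.coe_nonneg, ENNReal.ofReal_coe_nnreal,
          ENNReal.ofReal_rpow_of_nonneg (sub_nonneg.2 hss) hexp]

lemma equicontinuous_timeTail (hr : 1 < r) {ι : Type*} {γ : ι → ℝ → ℂ}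
    (hγ : ∀ n, Integrable (γ n) (timeMeasure T)) {C : ℝ≥0}
    (hC : ∀ n, eLpNorm (γ n) r (timeMeasure T) ≤ C) :
    Equicontinuous fun n => timeTail T (γ n) := by
  have hexp := one_sub_one_div_toReal_pos hr
  refine Metric.equicontinuous_of_continuity_modulus
    (fun d => C * d ^ (1 - 1 / r.toReal)) ?_ _ fun s s' n => ?_
  · simpa only [Real.zero_rpow hexp.ne', mul_zero] using
      ((Real.continuous_rpow_const hexp.le).const_mul (C : ℝ)).tendsto 0
  · wlog hss : s ≤ s' generalizing s s'
    · rw [dist_comm, dist_comm s]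
      exact this s' s (le_of_not_ge hss)
    rw [dist_eq_norm, dist_comm, Real.dist_eq, abs_of_nonneg (sub_nonneg.2 hss)]
    exact norm_timeTail_sub_le hr (hγ n) (hC n) hss

lemma tendstoUniformlyOn_timeTail (hr : 1 < r) {γ : ℕ → ℝ → ℂ}
    (hγ : ∀ n, Integrable (γ n) (timeMeasure T)) {C : ℝ≥0}
    (hC : ∀ n, eLpNorm (γ n) r (timeMeasure T) ≤ C)
    (hlim : ∀ s, Tendsto (fun n => timeTail T (γ n) s) atTop (𝓝 0)) :
    TendstoUniformlyOn (fun n => timeTail T (γ n)) 0 atTop (Icc 0 T) := by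
  rw [tendstoUniformlyOn_iff_tendstoUniformly_comp_coe]
  have hequi : Equicontinuous fun n (s : Icc 0 T) => timeTail T (γ n) s := fun s U hU =>
    continuous_subtype_val.continuousAt.eventually (equicontinuous_timeTail hr hγ hC s U hU)
  exact UniformFun.tendsto_iff_tendstoUniformly.1
    ((hequi.tendsto_uniformFun_iff_pi atTop 0).2 (tendsto_pi_nhds.2 fun s => hlim s))

lemma timeTail_zero : timeTail T γ 0 = ∫ t, γ t ∂timeMeasure T := by
  rw [timeTail, timeMeasure, Measure.restrict_restrict measurableSet_Ici,
    inter_eq_right.2 fun t ht => ht.1]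

lemma norm_integral_mul_le_of_norm_timeTail_le (hT : 0 < T) (hγ : Integrable γ (timeMeasure T))
    (hβ : Integrable β (timeMeasure T)) (hw : Integrable w (timeMeasure T))
    (h : IsScalarWeakDeriv T β w) {η : ℝ} (hη : ∀ s ∈ Icc 0 T, ‖timeTail T γ s‖ ≤ η) :
    T * ‖∫ t, γ t * β t ∂timeMeasure T‖
      ≤ η * (∫ t, ‖β t‖ ∂timeMeasure T + 2 * T * ∫ t, ‖w t‖ ∂timeMeasure T) := by
  have hη0 : 0 ≤ η := (norm_nonneg _).trans (hη 0 ⟨le_rfl, hT.le⟩)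
  obtain ⟨c, hc⟩ := ae_eq_const_add_timePrimitive hT hβ hw h
  have hconst : T * ‖c‖ ≤ ∫ t, ‖β t‖ ∂timeMeasure T + T * ∫ t, ‖w t‖ ∂timeMeasure T := by
    have hmono := integral_mono_ae (integrable_const ‖c‖)
      (hβ.norm.add (integrable_const (∫ t, ‖w t‖ ∂timeMeasure T))) (hc.mono fun t ht => by
        rw [show c = β t - timePrimitive T w t by rw [ht, add_sub_cancel_right]]
        exact (norm_sub_le _ _).trans (add_le_add le_rfl (norm_timePrimitive_le hw t)))
    have hvol : (timeMeasure T).real univ = T := by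
      rw [timeMeasure, measureReal_restrict_apply_univ, Real.volume_real_Icc_of_le hT.le, sub_zero]
    simpa only [Pi.add_apply, integral_add hβ.norm (integrable_const _), integral_const, hvol,
      smul_eq_mul] using hmono
  have hsplit : ∫ t, γ t * β t ∂timeMeasure T
      = timeTail T γ 0 * c + ∫ s, w s * timeTail T γ s ∂timeMeasure T := by
    rw [← integral_mul_timePrimitive hγ hw, timeTail_zero, ← integral_mul_const,
      ← integral_add (hγ.mul_const _) (hγ.mul_bdd (aestronglyMeasurable_timePrimitive hw)
        (ae_of_all _ (norm_timePrimitive_le hw)))]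
    exact integral_congr_ae (hc.mono fun t ht => by simp only [ht, mul_add])
  have htail : ‖∫ s, w s * timeTail T γ s ∂timeMeasure T‖ ≤ η * ∫ t, ‖w t‖ ∂timeMeasure T := by
    rw [← integral_const_mul]
    refine norm_integral_le_of_norm_le (hw.norm.const_mul η) ((ae_mem_Icc T).mono fun s hs => ?_)
    rw [norm_mul, mul_comm]
    gcongr
    exact hη s hs
  calc T * ‖∫ t, γ t * β t ∂timeMeasure T‖
      ≤ T * (η * ‖c‖ + η * ∫ t, ‖w t‖ ∂timeMeasure T) := by
        rw [hsplit]
        gcongr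
        refine (norm_add_le _ _).trans (add_le_add ?_ htail)
        rw [norm_mul]
        gcongr
        exact hη 0 ⟨le_rfl, hT.le⟩
    _ = η * (T * ‖c‖ + T * ∫ t, ‖w t‖ ∂timeMeasure T) := by ring
    _ ≤ η * (∫ t, ‖β t‖ ∂timeMeasure T + T * (∫ t, ‖w t‖ ∂timeMeasure T)
          + T * ∫ t, ‖w t‖ ∂timeMeasure T) := by gcongr
    _ = _ := by ring

theorem tendsto_integral_mul_zero (hT : 0 < T) (hr : 1 < r) {γ β w : ℕ → ℝ → ℂ}
    (hγ : ∀ n, Integrable (γ n) (timeMeasure T)) {C : ℝ≥0}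
    (hC : ∀ n, eLpNorm (γ n) r (timeMeasure T) ≤ C)
    (hlim : ∀ s, Tendsto (fun n => timeTail T (γ n) s) atTop (𝓝 0))
    (hβ : ∀ n, Integrable (β n) (timeMeasure T)) (hw : ∀ n, Integrable (w n) (timeMeasure T))
    (hβw : ∀ n, IsScalarWeakDeriv T (β n) (w n)) {M : ℝ}
    (hM : ∀ n, ∫ t, ‖β n t‖ ∂timeMeasure T ≤ M) (hM' : ∀ n, ∫ t, ‖w n t‖ ∂timeMeasure T ≤ M) :
    Tendsto (fun n => ∫ t, γ n t * β n t ∂timeMeasure T) atTop (𝓝 0) := by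
  have hM0 : 0 ≤ M := (integral_nonneg fun t => norm_nonneg _).trans (hM 0)
  rw [Metric.tendsto_nhds]
  intro ε hε
  set η := T * (ε / 2) / (M + 2 * T * M + 1)
  have hη : 0 < η := by positivity
  filter_upwards [Metric.tendstoUniformlyOn_iff.1
    (tendstoUniformlyOn_timeTail hr hγ hC hlim) η hη] with n hn
  have hbound := norm_integral_mul_le_of_norm_timeTail_le hT (hγ n) (hβ n) (hw n) (hβw n)
    (η := η) fun s hs => by simpa using (hn s hs).le
  rw [dist_zero_right]
  refine lt_of_mul_lt_mul_left (hbound.trans_lt ?_) hT.le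
  have hsum : ∫ t, ‖β n t‖ ∂timeMeasure T + 2 * T * ∫ t, ‖w n t‖ ∂timeMeasure T
      ≤ M + 2 * T * M + 1 := by
    have := mul_le_mul_of_nonneg_left (hM' n) (by positivity : 0 ≤ 2 * T)
    linarith [hM n]
  calc η * (∫ t, ‖β n t‖ ∂timeMeasure T + 2 * T * ∫ t, ‖w n t‖ ∂timeMeasure T)
      ≤ η * (M + 2 * T * M + 1) := mul_le_mul_of_nonneg_left hsum hη.le
    _ = T * (ε / 2) := div_mul_cancel₀ _ (by positivity)
    _ < T * ε := by gcongr; linarith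

end TimeCompactness

/-! ### Fourier modes -/

section FourierModes

open UnitAddTorus (mFourier mFourierCoeff)

lemma integral_mFourier (n : Fin 3 → ℤ) :
    ∫ x, mFourier n x ∂torusMeasure = if n = 0 then 1 else 0 := by
  have h := (orthonormal_iff_ite.1 (UnitAddTorus.orthonormal_mFourier (d := Fin 3))) 0 n
  simp only [ContinuousMap.inner_toLp, ← UnitAddTorus.mFourier_neg, ← UnitAddTorus.mFourier_add,
    neg_zero, add_zero, eq_comm (a := (0 : Fin 3 → ℤ))] at h
  exact h

lemma norm_mFourier_le (n : Fin 3 → ℤ) (x : T3) : ‖mFourier n x‖ ≤ 1 :=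
  ((mFourier n).norm_coe_le_norm x).trans_eq UnitAddTorus.mFourier_norm

lemma mFourierCoeff_add_smul_mFourier (A B : ℂ) (k l j : Fin 3 → ℤ) :
    mFourierCoeff (fun x => A * mFourier k x + B * mFourier l x) j
      = A * (if k = j then 1 else 0) + B * (if l = j then 1 else 0) := by
  have hcoeff : ∀ n, ∫ x, mFourier (-j) x * mFourier n x ∂torusMeasure
      = if n = j then 1 else 0 := fun n => by
    simp only [← UnitAddTorus.mFourier_add, integral_mFourier, neg_add_eq_zero,
      eq_comm (a := j)]
  have hint : ∀ n, Integrable (fun x => mFourier (-j) x * mFourier n x) torusMeasure := fun n =>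
    integrable_of_continuous (by fun_prop)
  rw [← hcoeff, ← hcoeff, ← integral_const_mul, ← integral_const_mul,
    ← integral_add ((hint k).const_mul A) ((hint l).const_mul B)]
  refine integral_congr_ae (ae_of_all _ fun x => ?_)
  simp only [smul_eq_mul]
  ring

lemma torusPairing_trigonometric {c : (Fin 3 → ℤ) → ℂ} {φ : T3 → ℝ} {A B : ℂ} {k : Fin 3 → ℤ}
    (hφ : ∀ x, (φ x : ℂ) = A * mFourier k x + B * mFourier (-k) x) :
    torusPairing c φ = A * c (-k) + B * c k := by
  have hterm : ∀ j, c j * mFourierCoeff (fun x => (φ x : ℂ)) (-j)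
      = (if j = -k then A * c (-k) else 0) + (if j = k then B * c k else 0) := fun j => by
    simp only [hφ, mFourierCoeff_add_smul_mFourier, eq_comm (a := k), mul_ite, mul_one, mul_zero,
      add_mul, ite_mul, zero_mul, neg_eq_iff_eq_neg, neg_neg, mul_comm (c j)]
    congr 1 <;> split_ifs with hj <;> simp only [hj]
  simp only [torusPairing, hterm]
  exact ((hasSum_ite_eq (-k) _).add (hasSum_ite_eq k _)).tsum_eq

lemma contDiff_mFourier_lift (k : Fin 3 → ℤ) :
    ContDiff ℝ ∞ fun y : Fin 3 → ℝ => mFourier k fun i => (y i : UnitAddCircle) := by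
  have e : (fun y : Fin 3 → ℝ => mFourier k fun i => (y i : UnitAddCircle))
      = fun y => ∏ i, Complex.exp (2 * Real.pi * Complex.I * k i * (y i : ℂ)) := by
    ext y
    simp only [mFourier, ContinuousMap.coe_mk, fourier_coe_apply, Complex.ofReal_one, div_one]
  rw [e]
  exact contDiff_prod fun i _ => (contDiff_const.mul
    (Complex.ofRealCLM.contDiff.comp (contDiff_apply ℝ ℝ i))).cexp

variable {T : ℝ} {χ : ℝ → ℝ} {φ : T3 → ℝ} {b : ℝ × T3 → ℝ} {w : ℝ → (Fin 3 → ℤ) → ℂ}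

lemma IsTimeTest.mul_smoothTorus (hχ : IsTimeTest T χ) (hφ : SmoothTorus φ) :
    IsTestFunction T fun z => χ z.1 * φ z.2 := by
  have hsub : tsupport (fun z : ℝ × T3 => χ z.1 * φ z.2) ⊆ tsupport χ ×ˢ univ :=
    closure_minimal (fun z hz => ⟨subset_closure (left_ne_zero_of_mul hz), mem_univ _⟩)
      ((isClosed_tsupport χ).prod isClosed_univ)
  refine ⟨(hχ.1.comp contDiff_fst).mul (ContDiff.comp
      (g := fun y : Fin 3 → ℝ => φ fun i => (y i : UnitAddCircle)) hφ contDiff_snd), ?_,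
    hsub.trans (prod_mono hχ.2.2 subset_rfl)⟩
  exact .of_support_subset_isCompact (hχ.2.1.isCompact.prod isCompact_univ)
    (subset_closure.trans hsub)

/-- The time-dependent Fourier coefficient `t ↦ ∫ b(t, x) e^{2πik·x} dx` (of frequency `-k`). -/
def timeMode (b : ℝ × T3 → ℝ) (k : Fin 3 → ℤ) (t : ℝ) : ℂ :=
  ∫ x, (b (t, x) : ℂ) * mFourier k x ∂torusMeasure

lemma integrable_mul_mFourier (hb : Integrable b (stMeasure T)) (k : Fin 3 → ℤ) :
    Integrable (fun z => (b z : ℂ) * mFourier k z.2) (stMeasure T) :=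
  hb.ofReal.mul_bdd (c := 1) (by fun_prop) (ae_of_all _ fun z => norm_mFourier_le k z.2)

lemma integrable_timeMode (hb : Integrable b (stMeasure T)) (k : Fin 3 → ℤ) :
    Integrable (timeMode b k) (timeMeasure T) :=
  (integrable_mul_mFourier hb k).integral_prod_left

lemma integral_norm_timeMode_le (hb : Integrable b (stMeasure T)) (k : Fin 3 → ℤ) :
    ∫ t, ‖timeMode b k t‖ ∂timeMeasure T ≤ ∫ z, ‖b z‖ ∂stMeasure T := by
  refine (integral_mono_ae (integrable_timeMode hb k).norm hb.norm.integral_prod_left ?_).trans_eq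
    (integral_prod _ hb.norm).symm
  filter_upwards [hb.prod_right_ae] with t ht
  refine norm_integral_le_of_norm_le ht.norm (ae_of_all _ fun x => ?_)
  rw [norm_mul, Complex.norm_real]
  exact mul_le_of_le_one_right (norm_nonneg _) (norm_mFourier_le k x)

lemma integral_timeMode_mul (hb : Integrable b (stMeasure T)) (k : Fin 3 → ℤ) {η : ℝ → ℝ}
    (hη : Continuous η) {M : ℝ} (hM : ∀ t, ‖η t‖ ≤ M) :
    ∫ t, timeMode b k t * (η t : ℂ) ∂timeMeasure T
      = ((∫ z, b z * (η z.1 * (mFourier k z.2).re) ∂stMeasure T : ℝ) : ℂ)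
        + ((∫ z, b z * (η z.1 * (mFourier k z.2).im) ∂stMeasure T : ℝ) : ℂ) * Complex.I := by
  have hint : Integrable (fun z => (b z : ℂ) * mFourier k z.2 * (η z.1 : ℂ)) (stMeasure T) :=
    (integrable_mul_mFourier hb k).mul_bdd (c := M) (by fun_prop)
      (ae_of_all _ fun z => by simpa using hM z.1)
  have hfubini : ∫ z, (b z : ℂ) * mFourier k z.2 * (η z.1 : ℂ) ∂stMeasure T
      = ∫ t, timeMode b k t * (η t : ℂ) ∂timeMeasure T := by
    refine (integral_prod _ hint).trans ?_
    simp only [integral_mul_const, timeMode]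
  rw [← hfubini, ← integral_re_add_im hint]
  congr! 5 with z z <;> simp <;> ring

lemma integral_torusPairing_mul (hw : ∀ k, Integrable (fun t => w t k) (timeMeasure T))
    (hχ : Continuous χ) {A B : ℂ} {k : Fin 3 → ℤ}
    (hφ : ∀ x, (φ x : ℂ) = A * mFourier k x + B * mFourier (-k) x) :
    ∫ t, torusPairing (w t) (fun x => χ t * φ x) ∂timeMeasure T
      = A * ∫ t, w t (-k) * (χ t : ℂ) ∂timeMeasure T
        + B * ∫ t, w t k * (χ t : ℂ) ∂timeMeasure T := by
  rw [← integral_const_mul, ← integral_const_mul,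
    ← integral_add ((integrable_mul_of_continuous (hw _) hχ).const_mul _)
      ((integrable_mul_of_continuous (hw _) hχ).const_mul _)]
  congr 1 with t
  rw [torusPairing_trigonometric (A := χ t * A) (B := χ t * B) (k := k) fun x => by
    rw [Complex.ofReal_mul, hφ]; ring]
  ring

theorem IsWeakTimeDeriv.isScalarWeakDeriv_timeMode (h : IsWeakTimeDeriv T b w)
    (hb : Integrable b (stMeasure T)) (hw : ∀ k, Integrable (fun t => w t k) (timeMeasure T))
    (k : Fin 3 → ℤ) : IsScalarWeakDeriv T (timeMode b k) fun t => w t (-k) := by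
  intro χ hχ
  obtain ⟨M, hM⟩ := hχ.2.1.deriv.exists_bound_of_continuous hχ.continuous_deriv
  have hre := h _ (hχ.mul_smoothTorus (φ := fun x => (mFourier k x).re)
    (Complex.reCLM.contDiff.comp (contDiff_mFourier_lift k)))
  have him := h _ (hχ.mul_smoothTorus (φ := fun x => (mFourier k x).im)
    (Complex.imCLM.contDiff.comp (contDiff_mFourier_lift k)))
  simp only [deriv_mul_const_field] at hre him
  rw [integral_torusPairing_mul hw hχ.1.continuous (A := 1 / 2) (B := 1 / 2) (k := k) fun x => by
    rw [UnitAddTorus.mFourier_neg, Complex.re_eq_add_conj]; ring] at hre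
  rw [integral_torusPairing_mul hw hχ.1.continuous (A := 1 / (2 * Complex.I))
    (B := -(1 / (2 * Complex.I))) (k := k) fun x => by
    rw [UnitAddTorus.mFourier_neg, Complex.im_eq_sub_conj]; ring] at him
  rw [integral_timeMode_mul hb k hχ.continuous_deriv hM, hre, him]
  field_simp
  ring

/-- The weight `(1 + |k|²)^{σ/2}` of the frequency `k` in the norm of `H^σ(𝕋³)`. -/
def sobolevWeight (σ : ℤ) (k : Fin 3 → ℤ) : ℝ≥0∞ :=
  ENNReal.ofReal ((1 + ∑ i, (k i : ℝ) ^ 2) ^ σ) ^ (1 / 2 : ℝ)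

lemma sobolevWeight_ne_zero (σ : ℤ) (k : Fin 3 → ℤ) : sobolevWeight σ k ≠ 0 := by
  have hpos : (0 : ℝ) < (1 + ∑ i, (k i : ℝ) ^ 2) ^ σ := by positivity
  exact (ENNReal.rpow_pos (ENNReal.ofReal_pos.2 hpos) ENNReal.ofReal_ne_top).ne'

lemma sobolevWeight_ne_top (σ : ℤ) (k : Fin 3 → ℤ) : sobolevWeight σ k ≠ ⊤ :=
  ENNReal.rpow_ne_top_of_nonneg (by norm_num) ENNReal.ofReal_ne_top

lemma sobolevWeight_mul_le_sobolevNorm (σ : ℤ) (k : Fin 3 → ℤ) (c : (Fin 3 → ℤ) → ℂ) :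
    sobolevWeight σ k * ‖c k‖ₑ ≤ sobolevNorm σ c := by
  have hsq : ‖c k‖ₑ = (‖c k‖ₑ ^ 2) ^ (1 / 2 : ℝ) := by
    rw [← ENNReal.rpow_natCast, ← ENNReal.rpow_mul]
    norm_num
  rw [sobolevWeight, hsq, ← ENNReal.mul_rpow_of_nonneg _ _ (by norm_num), sobolevNorm]
  gcongr
  exact ENNReal.le_tsum k

lemma lintegral_mode_le {σ : ℤ} {C : ℝ≥0} (hC : ∫⁻ t, sobolevNorm σ (w t) ∂timeMeasure T ≤ C)
    (k : Fin 3 → ℤ) : ∫⁻ t, ‖w t k‖ₑ ∂timeMeasure T ≤ (sobolevWeight σ k)⁻¹ * C := by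
  rw [mul_comm, ← div_eq_mul_inv, ENNReal.le_div_iff_mul_le (.inl (sobolevWeight_ne_zero σ k))
    (.inl (sobolevWeight_ne_top σ k)), mul_comm,
    ← lintegral_const_mul' _ _ (sobolevWeight_ne_top σ k)]
  exact (lintegral_mono fun t => sobolevWeight_mul_le_sobolevNorm σ k (w t)).trans hC

end FourierModes

/-! ### Regularization in space -/

section SpaceRegularization

variable {T : ℝ} {q p s : ℝ≥0∞} {a : ℝ × T3 → ℝ} {g : Fin 3 → ℝ × T3 → ℝ}

/-- The regularization of a function of time and space by convolution in space with
`torusKernel N`. -/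
def spaceConv (N : ℕ) (a : ℝ × T3 → ℝ) (z : ℝ × T3) : ℝ :=
  conv (fun y => a (z.1, y)) (torusKernel N) z.2

lemma stronglyMeasurable_spaceConv (N : ℕ) (ha : StronglyMeasurable a) :
    StronglyMeasurable (spaceConv N a) := by
  have hkernel : Continuous fun w : (ℝ × T3) × T3 => torusKernel N (w.1.2 - w.2) := by fun_prop
  exact ((ha.comp_measurable (measurable_fst.fst.prodMk measurable_snd)).mul
    hkernel.stronglyMeasurable).integral_prod_right

lemma aestronglyMeasurable_spaceConv (N : ℕ) (ha : AEStronglyMeasurable a (stMeasure T)) :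
    AEStronglyMeasurable (spaceConv N a) (stMeasure T) := by
  refine ⟨_, stronglyMeasurable_spaceConv N ha.stronglyMeasurable_mk, ?_⟩
  have hslices : ∀ᵐ t ∂timeMeasure T, ∀ x, spaceConv N a (t, x) = spaceConv N (ha.mk a) (t, x) := by
    filter_upwards [Measure.ae_ae_of_ae_prod ha.ae_eq_mk] with t ht x
    exact integral_congr_ae (ht.mono fun y hy => by simp only [hy])
  exact ((Measure.quasiMeasurePreserving_fst (μ := timeMeasure T) (ν := torusMeasure)).ae
    hslices).mono fun z hz => hz z.2

/-- The rate of approximation of `W^{1,p}(𝕋³)` functions by their regularizations in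
`L^s(𝕋³)`. -/
def approxRate (p s : ℝ≥0∞) (N : ℕ) : ℝ≥0∞ := ∑' n, potentialConst p s (n + N)

lemma approxRate_ne_top (hp : 1 ≤ p) (hps : p ≤ s) (hs : s ≠ ⊤) (hcrit : p⁻¹ < s⁻¹ + 3⁻¹) (N : ℕ) :
    approxRate p s N ≠ ⊤ :=
  ne_top_of_le_ne_top (tsum_potentialConst_ne_top hp hps hs hcrit)
    (ENNReal.tsum_comp_le_tsum_of_injective (add_left_injective N) _)

lemma tendsto_approxRate (hp : 1 ≤ p) (hps : p ≤ s) (hs : s ≠ ⊤) (hcrit : p⁻¹ < s⁻¹ + 3⁻¹) :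
    Tendsto (approxRate p s) atTop (𝓝 0) :=
  ENNReal.tendsto_sum_nat_add _ (tsum_potentialConst_ne_top hp hps hs hcrit)

lemma mixedNorm_sub_spaceConv_le (hq : 1 ≤ q) (hp : 1 ≤ p) (hps : p ≤ s) (hs : s ≠ ⊤)
    (ha : MemMixed T q p a) (hg : ∀ i, MemMixed T q p (g i)) (hag : IsWeakGrad T a g) (N : ℕ) :
    mixedNorm T q s (fun z => a z - spaceConv N a z)
      ≤ approxRate p s N * ∑ i, mixedNorm T q p (g i) := by
  have hgm (i : Fin 3) : AEMeasurable (fun t => eLpNorm (fun x => g i (t, x)) p torusMeasure)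
      (timeMeasure T) := aemeasurable_eLpNorm_section p (hg i).1
  have hgL : ∀ᵐ t ∂timeMeasure T, ∀ i, MemLp (fun x => g i (t, x)) p torusMeasure :=
    ae_all_iff.2 fun i => MemIter.ae_memLp hq (hg i)
  calc mixedNorm T q s (fun z => a z - spaceConv N a z)
      ≤ eLpNorm (fun t => (∑ i, eLpNorm (fun x => g i (t, x)) p torusMeasure) * approxRate p s N)
          q (timeMeasure T) := by
        refine eLpNorm_mono_enorm_ae ?_
        filter_upwards [hag, MemIter.ae_memLp hq ha, hgL] with t hweak haL hgL
        rw [mul_comm]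
        exact eLpNorm_sub_conv_torusKernel_le hp hps hs (haL.integrable hp) hgL hweak N
    _ = approxRate p s N
          * eLpNorm (∑ i, fun t => eLpNorm (fun x => g i (t, x)) p torusMeasure) q
            (timeMeasure T) := by
        rw [eLpNorm_mul_const (Finset.aemeasurable_fun_sum _ fun i _ => hgm i), mul_comm,
          Finset.sum_fn]
    _ ≤ approxRate p s N * ∑ i, mixedNorm T q p (g i) := by
        gcongr
        exact eLpNorm_sum_le (fun i _ => (hgm i).aestronglyMeasurable) hq

lemma memMixed_spaceConv (hp : 1 ≤ p) (hps : p ≤ s) (hs : s ≠ ⊤) (ha : MemMixed T q p a) (N : ℕ) :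
    MemMixed T q s (spaceConv N a) := by
  obtain ⟨B, hB⟩ := exists_bound_of_continuous (continuous_torusKernel N)
  have hexp : 0 ≤ 1 / p.toReal - 1 / s.toReal :=
    sub_nonneg.2 (one_div_le_one_div_of_le
      (ENNReal.toReal_pos (one_pos.trans_le hp).ne' (ne_top_of_le_ne_top hs hps))
      (ENNReal.toReal_mono hs hps))
  refine ⟨aestronglyMeasurable_spaceConv N ha.1, ?_⟩
  calc mixedNorm T q s (spaceConv N a)
      ≤ eLpNorm (fun t => eLpNorm (fun x => a (t, x)) p torusMeasure
          * ENNReal.ofReal B ^ (1 / p.toReal - 1 / s.toReal)) q (timeMeasure T) := by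
        refine eLpNorm_mono_enorm_ae ?_
        filter_upwards [ha.1.prodMk_left] with t ht
        have hyoung := eLpNorm_convolution_mul_le hp hps hs ht
          (continuous_torusKernel N).measurable (B := ENNReal.ofReal B) fun y => by
            rw [← ofReal_norm]; exact ENNReal.ofReal_le_ofReal (hB y)
        rwa [lintegral_enorm_torusKernel, ENNReal.one_rpow, one_mul, mul_comm] at hyoung
    _ = mixedNorm T q p a * ENNReal.ofReal B ^ (1 / p.toReal - 1 / s.toReal) :=
        eLpNorm_mul_const (aemeasurable_eLpNorm_section p ha.1) _
    _ < ⊤ := ENNReal.mul_lt_top ha.2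
        (ENNReal.rpow_ne_top_of_nonneg hexp ENNReal.ofReal_ne_top).lt_top

lemma memMixed_sub_spaceConv (hq : 1 ≤ q) (hp : 1 ≤ p) (hps : p ≤ s) (hs : s ≠ ⊤)
    (hcrit : p⁻¹ < s⁻¹ + 3⁻¹) (ha : MemMixed T q p a) (hg : ∀ i, MemMixed T q p (g i))
    (hag : IsWeakGrad T a g) (N : ℕ) : MemMixed T q s (fun z => a z - spaceConv N a z) :=
  ⟨ha.1.sub (aestronglyMeasurable_spaceConv N ha.1),
    (mixedNorm_sub_spaceConv_le hq hp hps hs ha hg hag N).trans_lt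
      (ENNReal.mul_lt_top (approxRate_ne_top hp hps hs hcrit N).lt_top
        (ENNReal.sum_lt_top.2 fun i _ => (hg i).2))⟩

theorem memMixed_of_isWeakGrad (hq : 1 ≤ q) (hp : 1 ≤ p) (hps : p ≤ s) (hs : s ≠ ⊤)
    (hcrit : p⁻¹ < s⁻¹ + 3⁻¹) (ha : MemMixed T q p a) (hg : ∀ i, MemMixed T q p (g i))
    (hag : IsWeakGrad T a g) : MemMixed T q s a := by
  have hconv := memMixed_spaceConv (q := q) hp hps hs ha 0
  have herr := memMixed_sub_spaceConv hq hp hps hs hcrit ha hg hag 0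
  have hcomm : mixedNorm T q s (fun z => spaceConv 0 a z - a z)
      = mixedNorm T q s fun z => a z - spaceConv 0 a z :=
    congrArg (eLpNorm · q (timeMeasure T)) <| funext fun t =>
      eLpNorm_sub_comm (fun x => spaceConv 0 a (t, x)) (fun x => a (t, x)) s torusMeasure
  have herr' : MemMixed T q s fun z => spaceConv 0 a z - a z :=
    ⟨hconv.1.sub ha.1, hcomm.trans_lt herr.2⟩
  have hsub := MemIter.sub hq (hp.trans hps) hconv herr'
  simp only [sub_sub_cancel] at hsub
  exact hsub

end SpaceRegularization

/-! ### The trilinear form -/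

section WeakLimits

lemma tendsto_zero_of_span_dense {E : Type*} [NormedAddCommGroup E] [NormedSpace ℂ E] {S : Set E}
    (hS : (Submodule.span ℂ S).topologicalClosure = ⊤) {L : ℕ → E →L[ℂ] ℂ} {M : ℝ≥0}
    (hL : ∀ n, ‖L n‖₊ ≤ M) (hL0 : ∀ x ∈ S, Tendsto (fun n => L n x) atTop (𝓝 0)) (x : E) :
    Tendsto (fun n => L n x) atTop (𝓝 0) := by
  have hequi : Equicontinuous fun n x => L n x :=
    (LipschitzWith.uniformEquicontinuous _ M fun n =>
      (L n).lipschitz.weaken (hL n)).equicontinuous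
  have hclosed : IsClosed {x | Tendsto (fun n => L n x) atTop (𝓝 0)} :=
    hequi.isClosed_setOfPred_tendsto continuous_const
  have hspan : (Submodule.span ℂ S : Set E) ⊆ {x | Tendsto (fun n => L n x) atTop (𝓝 0)} := by
    intro x hx
    induction hx using Submodule.span_induction with
    | mem x hx => exact hL0 x hx
    | zero => simp
    | add x y _ _ hx hy => simpa using hx.add hy
    | smul c x _ hx => simpa using hx.const_mul c
  have hx : x ∈ (Submodule.span ℂ S).topologicalClosure := hS ▸ Submodule.mem_top
  exact closure_minimal hspan hclosed hx

variable {α : Type*} [MeasurableSpace α] {μ : Measure α} {v : ℕ → α → ℝ}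

/-- Convergence to zero of the integrals against all bounded measurable functions. -/
def IsWeaklyNull (μ : Measure α) (v : ℕ → α → ℝ) : Prop :=
  ∀ ψ : α → ℝ, AEStronglyMeasurable ψ μ → ∀ M, (∀ z, ‖ψ z‖ ≤ M) →
    Tendsto (fun n => ∫ z, v n z * ψ z ∂μ) atTop (𝓝 0)

lemma IsWeaklyNull.tendsto_integral_complex (h : IsWeaklyNull μ v) (hv : ∀ n, Integrable (v n) μ)
    {ψ : α → ℂ} (hψ : AEStronglyMeasurable ψ μ) {M : ℝ} (hM : ∀ z, ‖ψ z‖ ≤ M) :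
    Tendsto (fun n => ∫ z, (v n z : ℂ) * ψ z ∂μ) atTop (𝓝 0) := by
  have hre := h _ hψ.re M fun z => (Complex.abs_re_le_norm _).trans (hM z)
  have him := h _ hψ.im M fun z => (Complex.abs_im_le_norm _).trans (hM z)
  have hsum := hre.ofReal.add (him.ofReal.mul_const Complex.I)
  rw [Complex.ofReal_zero, zero_mul, add_zero] at hsum
  refine hsum.congr fun n => ?_
  refine Eq.trans ?_ (integral_re_add_im ((hv n).ofReal.mul_bdd hψ (ae_of_all _ hM)))
  simp

end WeakLimits

section TimeExtension

variable {T : ℝ} {X : Type*}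

/-- The extension of a function on `[0, T] × X` to `ℝ × X`, constant in time outside `[0, T]`. -/
def timeExtend {Y : Type*} (hT : 0 ≤ T) (f : Icc 0 T × X → Y) (z : ℝ × X) : Y :=
  f (projIcc 0 T hT z.1, z.2)

variable [TopologicalSpace X]

lemma continuous_timeExtend {Y : Type*} [TopologicalSpace Y] (hT : 0 ≤ T) {f : Icc 0 T × X → Y}
    (hf : Continuous f) : Continuous (timeExtend hT f) :=
  hf.comp ((continuous_projIcc.comp continuous_fst).prodMk continuous_snd)

variable [CompactSpace X]

lemma norm_timeExtend_le {Y : Type*} [SeminormedAddCommGroup Y] (hT : 0 ≤ T)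
    (f : C(Icc 0 T × X, Y)) (z : ℝ × X) : ‖timeExtend hT f z‖ ≤ ‖f‖ :=
  f.norm_coe_le_norm _

variable [MeasurableSpace (ℝ × X)] [OpensMeasurableSpace (ℝ × X)] {ν : Measure (ℝ × X)}
  {G : ℝ × X → ℝ}

lemma integrable_mul_timeExtend (hT : 0 ≤ T) (hG : Integrable G ν) (F : C(Icc 0 T × X, ℂ)) :
    Integrable (fun z => (G z : ℂ) * timeExtend hT F z) ν :=
  hG.ofReal.mul_bdd (continuous_timeExtend hT F.continuous).aestronglyMeasurable
    (ae_of_all _ (norm_timeExtend_le hT F))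

/-- The functional `F ↦ ∫ G F` on continuous functions on `[0, T] × X`. -/
def pairing (hT : 0 ≤ T) (hG : Integrable G ν) : C(Icc 0 T × X, ℂ) →L[ℂ] ℂ :=
  LinearMap.mkContinuous
    { toFun F := ∫ z, (G z : ℂ) * timeExtend hT F z ∂ν
      map_add' F H := by
        rw [← integral_add (integrable_mul_timeExtend hT hG F) (integrable_mul_timeExtend hT hG H)]
        simp only [timeExtend, ContinuousMap.add_apply, mul_add]
      map_smul' c F := by
        rw [RingHom.id_apply, smul_eq_mul, ← integral_const_mul]
        simp only [timeExtend, ContinuousMap.smul_apply, smul_eq_mul, mul_left_comm] }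
    (∫ z, ‖G z‖ ∂ν) fun F => by
      rw [← integral_mul_const]
      refine norm_integral_le_of_norm_le (hG.norm.mul_const _) (ae_of_all _ fun z => ?_)
      rw [norm_mul, Complex.norm_real]
      exact mul_le_mul_of_nonneg_left (norm_timeExtend_le hT F z) (norm_nonneg _)

lemma pairing_apply (hT : 0 ≤ T) (hG : Integrable G ν) (F : C(Icc 0 T × X, ℂ)) :
    pairing hT hG F = ∫ z, (G z : ℂ) * timeExtend hT F z ∂ν := rfl

lemma norm_pairing_le (hT : 0 ≤ T) (hG : Integrable G ν) : ‖pairing hT hG‖ ≤ ∫ z, ‖G z‖ ∂ν :=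
  LinearMap.mkContinuous_norm_le _ (integral_nonneg fun _ => norm_nonneg _) _

end TimeExtension

section Separated

open UnitAddTorus (mFourier)

variable {T : ℝ}

/-- The function `(t, y, x) ↦ σ(t, y) e^{2πik·x}`. -/
def separated (σ : C(Icc 0 T × T3, ℂ)) (k : Fin 3 → ℤ) : C(Icc 0 T × T3 × T3, ℂ) where
  toFun z := σ (z.1, z.2.1) * mFourier k z.2.2
  continuous_toFun := by fun_prop

lemma separated_apply (σ : C(Icc 0 T × T3, ℂ)) (k : Fin 3 → ℤ) (z : Icc 0 T × T3 × T3) :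
    separated σ k z = σ (z.1, z.2.1) * mFourier k z.2.2 := rfl

lemma separated_one_zero : separated (T := T) 1 0 = 1 := by
  ext z
  simp [separated_apply, UnitAddTorus.mFourier_zero]

lemma separated_mul_separated (σ τ : C(Icc 0 T × T3, ℂ)) (k l : Fin 3 → ℤ) :
    separated σ k * separated τ l = separated (σ * τ) (k + l) := by
  ext z
  simp only [separated_apply, ContinuousMap.mul_apply, UnitAddTorus.mFourier_add]
  ring

lemma star_separated (σ : C(Icc 0 T × T3, ℂ)) (k : Fin 3 → ℤ) :
    star (separated σ k) = separated (star σ) (-k) := by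
  ext z
  simp [separated_apply, UnitAddTorus.mFourier_neg]

variable (T) in
/-- The set of all functions `(t, y, x) ↦ σ(t, y) e^{2πik·x}`. -/
def separatedSet : Set C(Icc 0 T × T3 × T3, ℂ) :=
  range fun j : C(Icc 0 T × T3, ℂ) × (Fin 3 → ℤ) => separated j.1 j.2

lemma separated_mem_separatedSet (σ : C(Icc 0 T × T3, ℂ)) (k : Fin 3 → ℤ) :
    separated σ k ∈ separatedSet T := ⟨(σ, k), rfl⟩

lemma exists_separated_ne {z z' : Icc 0 T × T3 × T3} (hz : z ≠ z') :
    ∃ f ∈ separatedSet T, f z ≠ f z' := by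
  obtain ⟨t, y, x⟩ := z
  obtain ⟨t', y', x'⟩ := z'
  by_cases hty : (t, y) = (t', y')
  · obtain ⟨rfl, rfl⟩ := Prod.mk.inj hty
    obtain ⟨i, hi⟩ := Function.ne_iff.1 fun h : x = x' => hz (by rw [h])
    refine ⟨_, separated_mem_separatedSet 1 (Pi.single i 1), ?_⟩
    simp only [separated_apply, ContinuousMap.one_apply, one_mul, UnitAddTorus.mFourier_single,
      fourier_one]
    exact fun h => hi (AddCircle.injective_toCircle one_ne_zero (Circle.ext h))
  · let σ : C(Icc 0 T × T3, ℂ) := ⟨fun w => (dist w (t', y') : ℂ), by fun_prop⟩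
    refine ⟨_, separated_mem_separatedSet σ 0, ?_⟩
    simpa [separated_apply, UnitAddTorus.mFourier_zero, σ] using hty

variable (T) in
theorem closure_span_separatedSet :
    (Submodule.span ℂ (separatedSet T)).topologicalClosure = ⊤ := by
  let A : StarSubalgebra ℂ C(Icc 0 T × T3 × T3, ℂ) :=
    { toSubalgebra := Algebra.adjoin ℂ (separatedSet T)
      star_mem' := by
        change Algebra.adjoin ℂ (separatedSet T) ≤ star (Algebra.adjoin ℂ (separatedSet T))
        refine Algebra.adjoin_le ?_
        rintro _ ⟨⟨σ, k⟩, rfl⟩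
        refine Algebra.subset_adjoin ?_
        rw [star_separated]
        exact separated_mem_separatedSet _ _ }
  have hclosed : (Submonoid.closure (separatedSet T) : Set C(Icc 0 T × T3 × T3, ℂ))
      ⊆ separatedSet T := fun f hf => by
    refine Submonoid.closure_induction (fun _ => id) ?_ ?_ hf
    · exact separated_one_zero ▸ separated_mem_separatedSet _ _
    · rintro _ _ _ _ ⟨⟨σ, k⟩, rfl⟩ ⟨⟨τ, l⟩, rfl⟩
      exact separated_mul_separated σ τ k l ▸ separated_mem_separatedSet _ _
  have hspan : A.toSubalgebra.toSubmodule = Submodule.span ℂ (separatedSet T) :=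
    Algebra.adjoin_eq_span_of_subset _ (hclosed.trans Submodule.subset_span)
  have hsep : A.SeparatesPoints := fun z z' hz => by
    obtain ⟨f, hf, hne⟩ := exists_separated_ne hz
    exact ⟨f, ⟨f, Algebra.subset_adjoin hf, rfl⟩, hne⟩
  rw [← hspan]
  exact congrArg (Subalgebra.toSubmodule <| StarSubalgebra.toSubalgebra ·)
    (ContinuousMap.starSubalgebra_topologicalClosure_eq_top_of_separatesPoints A hsep)

end Separated

section Trilinear

variable {T : ℝ} {q q' p p' r : ℝ≥0∞} {v b : ℝ × T3 → ℝ}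

/-- The measure of `[0, T] × 𝕋³ × 𝕋³`. -/
def tripleMeasure (T : ℝ) : Measure (ℝ × T3 × T3) :=
  (timeMeasure T).prod (torusMeasure.prod torusMeasure)

/-- The tensor product `v(t, y) b(t, x)`. -/
def tensor (v b : ℝ × T3 → ℝ) (z : ℝ × T3 × T3) : ℝ := v (z.1, z.2.1) * b (z.1, z.2.2)

lemma aestronglyMeasurable_tensor (hv : AEStronglyMeasurable v (stMeasure T))
    (hb : AEStronglyMeasurable b (stMeasure T)) :
    AEStronglyMeasurable (tensor v b) (tripleMeasure T) := by
  have hfst : MeasurePreserving (Prod.map id Prod.fst) (tripleMeasure T) (stMeasure T) :=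
    (MeasurePreserving.id (timeMeasure T)).prod measurePreserving_fst
  have hsnd : MeasurePreserving (Prod.map id Prod.snd) (tripleMeasure T) (stMeasure T) :=
    (MeasurePreserving.id (timeMeasure T)).prod measurePreserving_snd
  exact (hv.comp_measurePreserving hfst).mul (hb.comp_measurePreserving hsnd)

lemma lintegral_tensor_le [q.HolderConjugate q'] (hp : 1 ≤ p) (hp' : 1 ≤ p')
    (hv : AEStronglyMeasurable v (stMeasure T)) (hb : AEStronglyMeasurable b (stMeasure T)) :
    ∫⁻ z, ‖tensor v b z‖ₑ ∂tripleMeasure T ≤ mixedNorm T q p v * mixedNorm T q' p' b := by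
  refine (lintegral_prod _ (aestronglyMeasurable_tensor hv hb).enorm).trans_le
    ((lintegral_mono_ae ?_).trans (lintegral_mul_le_eLpNorm_mul_eLpNorm (p := q) (p' := q')
      (aemeasurable_eLpNorm_section p hv) (aemeasurable_eLpNorm_section p' hb)))
  filter_upwards [hv.prodMk_left, hb.prodMk_left] with t hvt hbt
  simp only [tensor, enorm_mul]
  rw [lintegral_prod_mul hvt.enorm hbt.enorm, ← eLpNorm_one_eq_lintegral_enorm,
    ← eLpNorm_one_eq_lintegral_enorm]
  exact mul_le_mul' (eLpNorm_le_eLpNorm_of_exponent_le hp hvt)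
    (eLpNorm_le_eLpNorm_of_exponent_le hp' hbt)

lemma integrable_tensor [q.HolderConjugate q'] (hp : 1 ≤ p) (hp' : 1 ≤ p')
    (hv : MemMixed T q p v) (hb : MemMixed T q' p' b) :
    Integrable (tensor v b) (tripleMeasure T) :=
  ⟨aestronglyMeasurable_tensor hv.1 hb.1,
    (lintegral_tensor_le hp hp' hv.1 hb.1).trans_lt (ENNReal.mul_lt_top hv.2 hb.2)⟩

/-- The moment `t ↦ ∫ v(t, y) σ(t, y) dy`. -/
def timeMoment (hT : 0 ≤ T) (v : ℝ × T3 → ℝ) (σ : C(Icc 0 T × T3, ℂ)) (t : ℝ) : ℂ :=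
  ∫ y, (v (t, y) : ℂ) * timeExtend hT σ (t, y) ∂torusMeasure

lemma pairing_tensor_separated (hT : 0 ≤ T) (h : Integrable (tensor v b) (tripleMeasure T))
    (σ : C(Icc 0 T × T3, ℂ)) (k : Fin 3 → ℤ) :
    pairing hT h (separated σ k) = ∫ t, timeMoment hT v σ t * timeMode b k t ∂timeMeasure T := by
  rw [pairing_apply]
  refine (integral_prod _ (integrable_mul_timeExtend hT h (separated σ k))).trans ?_
  congr 1 with t
  rw [timeMoment, timeMode, ← integral_prod_mul]
  congr 1 with w
  simp only [tensor, timeExtend, separated_apply]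
  push_cast
  ring

lemma integrable_timeMoment (hT : 0 ≤ T) (hv : Integrable v (stMeasure T))
    (σ : C(Icc 0 T × T3, ℂ)) : Integrable (timeMoment hT v σ) (timeMeasure T) :=
  (integrable_mul_timeExtend hT hv σ).integral_prod_left

lemma eLpNorm_timeMoment_le (hT : 0 ≤ T) (hp : 1 ≤ p) (hv : AEStronglyMeasurable v (stMeasure T))
    (σ : C(Icc 0 T × T3, ℂ)) :
    eLpNorm (timeMoment hT v σ) r (timeMeasure T) ≤ mixedNorm T r p v * ‖σ‖ₑ := by
  rw [mixedNorm, ← eLpNorm_mul_const (aemeasurable_eLpNorm_section p hv)]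
  refine eLpNorm_mono_enorm_ae ?_
  filter_upwards [hv.prodMk_left] with t ht
  calc ‖timeMoment hT v σ t‖ₑ ≤ ∫⁻ y, ‖v (t, y)‖ₑ * ‖σ‖ₑ ∂torusMeasure := by
        refine (enorm_integral_le_lintegral_enorm _).trans (lintegral_mono fun y => ?_)
        rw [enorm_mul]
        exact mul_le_mul' (enorm_le_iff_norm_le.2 (Complex.norm_real _).le)
          (enorm_le_iff_norm_le.2 (norm_timeExtend_le hT σ _))
    _ = eLpNorm (fun y => v (t, y)) 1 torusMeasure * ‖σ‖ₑ := by
        rw [lintegral_mul_const'' _ ht.enorm, eLpNorm_one_eq_lintegral_enorm]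
    _ ≤ eLpNorm (fun y => v (t, y)) p torusMeasure * ‖σ‖ₑ := by
        gcongr
        exact eLpNorm_le_eLpNorm_of_exponent_le hp ht

lemma timeTail_timeMoment (hT : 0 ≤ T) (hv : Integrable v (stMeasure T))
    (σ : C(Icc 0 T × T3, ℂ)) (s : ℝ) :
    timeTail T (timeMoment hT v σ) s
      = ∫ z, (v z : ℂ) * (Ici s ×ˢ univ).indicator (timeExtend hT σ) z ∂stMeasure T := by
  have hset : MeasurableSet (Ici s ×ˢ (univ : Set T3)) := measurableSet_Ici.prod .univ
  simp only [← indicator_mul_right _ fun z => (v z : ℂ)]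
  rw [integral_indicator hset]
  refine Eq.symm ((setIntegral_prod _ (integrable_mul_timeExtend hT hv σ).integrableOn).trans ?_)
  simp only [setIntegral_univ, timeTail, timeMoment]

end Trilinear

section BoundedFamilies

variable {T : ℝ} {q q' p p' r : ℝ≥0∞} {f : ℝ × T3 → ℝ} {v b : ℕ → ℝ × T3 → ℝ}

lemma memMixed_one (T : ℝ) (q p : ℝ≥0∞) : MemMixed T q p fun _ => 1 :=
  MemIter.of_bound aestronglyMeasurable_const 1 (ae_of_all _ fun _ => norm_one.le)

lemma MemMixed.integrable (hq : 1 ≤ q) (hp : 1 ≤ p) (hf : MemMixed T q p f) :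
    Integrable f (stMeasure T) := by
  have := ENNReal.HolderConjugate.conjExponent hq
  have := ENNReal.HolderConjugate.conjExponent hp
  have h := MemIter.integrable_mul hf (memMixed_one T q.conjExponent p.conjExponent)
  simp only [mul_one] at h
  exact h

/-- Boundedness of a sequence in `L^q_t(L^p_x)`. -/
def BoundedMixed (T : ℝ) (q p : ℝ≥0∞) (v : ℕ → ℝ × T3 → ℝ) : Prop :=
  (∀ n, AEStronglyMeasurable (v n) (stMeasure T)) ∧ ∃ C : ℝ≥0, ∀ n, mixedNorm T q p (v n) ≤ C

lemma BoundedMixed.memMixed (hv : BoundedMixed T q p v) (n : ℕ) : MemMixed T q p (v n) :=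
  let ⟨_, hC⟩ := hv.2
  ⟨hv.1 n, (hC n).trans_lt ENNReal.coe_lt_top⟩

lemma BoundedMixed.sub_const (hq : 1 ≤ q) (hp : 1 ≤ p) (hv : BoundedMixed T q p v)
    (hf : MemMixed T q p f) : BoundedMixed T q p fun n z => v n z - f z := by
  obtain ⟨hmeas, C, hC⟩ := hv
  refine ⟨fun n => (hmeas n).sub hf.1, C + (mixedNorm T q p f).toNNReal, fun n => ?_⟩
  rw [ENNReal.coe_add, ENNReal.coe_toNNReal hf.2.ne]
  exact (iterNorm_sub_le hq hp (hmeas n) hf.1).trans (add_le_add_left (hC n) _)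

lemma BoundedMixed.exists_integral_norm_le (hq : 1 ≤ q) (hp : 1 ≤ p) (hv : BoundedMixed T q p v) :
    ∃ M, ∀ n, ∫ z, ‖v n z‖ ∂stMeasure T ≤ M := by
  have := ENNReal.HolderConjugate.conjExponent hq
  have := ENNReal.HolderConjugate.conjExponent hp
  have hone := memMixed_one T q.conjExponent p.conjExponent
  obtain ⟨hmeas, C, hC⟩ := hv
  refine ⟨(C * mixedNorm T q.conjExponent p.conjExponent fun _ => 1).toReal, fun n => ?_⟩
  rw [integral_norm_eq_lintegral_enorm (hmeas n)]
  refine ENNReal.toReal_mono (ENNReal.mul_ne_top ENNReal.coe_ne_top hone.2.ne) ?_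
  calc ∫⁻ z, ‖v n z‖ₑ ∂stMeasure T = ∫⁻ z, ‖v n z‖ₑ * ‖(1 : ℝ)‖ₑ ∂stMeasure T := by simp
    _ ≤ _ := (lintegral_enorm_mul_le_iterNorm_mul (hmeas n) hone.1).trans
      (mul_le_mul_left (hC n) _)

lemma BoundedMixed.exists_integral_norm_tensor_le [q.HolderConjugate q'] (hp : 1 ≤ p)
    (hp' : 1 ≤ p') (hv : BoundedMixed T q p v) (hb : BoundedMixed T q' p' b) :
    ∃ M : ℝ≥0, ∀ n, ∫ z, ‖tensor (v n) (b n) z‖ ∂tripleMeasure T ≤ M := by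
  obtain ⟨hvm, C, hC⟩ := hv
  obtain ⟨hbm, D, hD⟩ := hb
  refine ⟨C * D, fun n => ?_⟩
  rw [integral_norm_eq_lintegral_enorm (aestronglyMeasurable_tensor (hvm n) (hbm n))]
  exact ENNReal.toReal_mono ENNReal.coe_ne_top
    ((lintegral_tensor_le hp hp' (hvm n) (hbm n)).trans (mul_le_mul' (hC n) (hD n)))

/-- Boundedness in `L¹(0, T)` of the weak time derivatives of each Fourier mode of the functions
`b n`; the bound may depend on the frequency. -/
def HasBoundedModeDerivs (T : ℝ) (b : ℕ → ℝ × T3 → ℝ) : Prop :=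
  ∀ k, ∃ M : ℝ, ∀ n, ∃ w : ℝ → ℂ, Integrable w (timeMeasure T) ∧
    ∫ t, ‖w t‖ ∂timeMeasure T ≤ M ∧ IsScalarWeakDeriv T (timeMode (b n) k) w

lemma tendsto_integral_timeMoment_mul_timeMode (hT : 0 < T) (hr : 1 < r) (hp : 1 ≤ p)
    (hv : BoundedMixed T r p v) (hv0 : IsWeaklyNull (stMeasure T) v)
    (hbi : ∀ n, Integrable (b n) (stMeasure T)) {M : ℝ}
    (hM : ∀ n, ∫ z, ‖b n z‖ ∂stMeasure T ≤ M) (hbt : HasBoundedModeDerivs T b)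
    (σ : C(Icc 0 T × T3, ℂ)) (k : Fin 3 → ℤ) :
    Tendsto (fun n => ∫ t, timeMoment hT.le (v n) σ t * timeMode (b n) k t ∂timeMeasure T) atTop
      (𝓝 0) := by
  have hvi : ∀ n, Integrable (v n) (stMeasure T) := fun n => (hv.memMixed n).integrable hr.le hp
  obtain ⟨N, hN⟩ := hbt k
  choose w hwi hwN hw using hN
  obtain ⟨hmeas, C, hC⟩ := hv
  refine tendsto_integral_mul_zero hT hr (w := w) (C := C * ‖σ‖₊) (M := max M N)
    (fun n => integrable_timeMoment hT.le (hvi n) σ) (fun n => ?_) (fun s => ?_)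
    (fun n => integrable_timeMode (hbi n) k) hwi hw
    (fun n => ((integral_norm_timeMode_le (hbi n) k).trans (hM n)).trans (le_max_left _ _))
    (fun n => (hwN n).trans (le_max_right _ _))
  · exact (eLpNorm_timeMoment_le hT.le hp (hmeas n) σ).trans (mul_le_mul_left (hC n) _)
  · simp only [timeTail_timeMoment hT.le (hvi _)]
    exact hv0.tendsto_integral_complex hvi
      ((continuous_timeExtend hT.le σ.continuous).aestronglyMeasurable.indicator
        (measurableSet_Ici.prod .univ))
      fun z => (norm_indicator_le_norm_self _ _).trans (norm_timeExtend_le hT.le σ z)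

theorem tendsto_integral_tensor_mul (hT : 0 < T) [q.HolderConjugate q'] (hr : 1 < r) (hp : 1 ≤ p)
    (hp' : 1 ≤ p') (hv : BoundedMixed T q p v) (hvr : BoundedMixed T r p v)
    (hv0 : IsWeaklyNull (stMeasure T) v) (hb : BoundedMixed T q' p' b)
    (hbt : HasBoundedModeDerivs T b) (F : C(Icc 0 T × T3 × T3, ℂ)) :
    Tendsto (fun n => ∫ z, (tensor (v n) (b n) z : ℂ) * timeExtend hT.le F z ∂tripleMeasure T)
      atTop (𝓝 0) := by
  have hq' : 1 ≤ q' := ENNReal.HolderConjugate.one_le q' q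
  have htensor n := integrable_tensor hp hp' (hv.memMixed n) (hb.memMixed n)
  obtain ⟨B, hB⟩ := hb.exists_integral_norm_le hq' hp'
  obtain ⟨M, hM⟩ := hv.exists_integral_norm_tensor_le hp hp' hb
  refine tendsto_zero_of_span_dense (closure_span_separatedSet T)
    (L := fun n => pairing hT.le (htensor n)) (M := M)
    (fun n => (norm_pairing_le hT.le (htensor n)).trans (hM n)) ?_ F
  rintro _ ⟨⟨σ, k⟩, rfl⟩
  simp only [pairing_tensor_separated]
  exact tendsto_integral_timeMoment_mul_timeMode hT hr hp hvr hv0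
    (fun n => (hb.memMixed n).integrable hq' hp') hB hbt σ k

end BoundedFamilies

/-! ### Products of weakly null sequences with time-regular sequences -/

section WeakGradient

variable {T : ℝ} {q p : ℝ≥0∞} {φ : T3 → ℝ} {a a' : ℝ × T3 → ℝ} {g g' : Fin 3 → ℝ × T3 → ℝ}

lemma isOpenQuotientMap_coe_torus :
    IsOpenQuotientMap fun (y : Fin 3 → ℝ) (i : Fin 3) => (y i : UnitAddCircle) :=
  IsOpenQuotientMap.piMap fun _ => QuotientAddGroup.isOpenQuotientMap_mk

lemma SmoothTorus.continuous (hφ : SmoothTorus φ) : Continuous φ :=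
  isOpenQuotientMap_coe_torus.continuous_comp_iff.1 (ContDiff.continuous hφ)

lemma SmoothTorus.continuous_torusPartial (hφ : SmoothTorus φ) (i : Fin 3) :
    Continuous (torusPartial i φ) := by
  have hlift (y : Fin 3 → ℝ) : torusPartial i φ (fun j => (y j : UnitAddCircle))
      = lineDeriv ℝ (fun y : Fin 3 → ℝ => φ fun j => (y j : UnitAddCircle)) y
        (Pi.single i (1 : ℝ)) := by
    rw [torusPartial, lineDeriv]
    congr 1 with h
    congr 1 with j
    rcases eq_or_ne j i with rfl | hji <;> simp [*]
  refine isOpenQuotientMap_coe_torus.continuous_comp_iff.1 ?_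
  refine ((hφ.continuous_fderiv (by simp)).clm_apply
    (continuous_const (y := (Pi.single i 1 : Fin 3 → ℝ)))).congr fun y => ?_
  exact ((hφ.differentiable (by simp)).differentiableAt.lineDeriv_eq_fderiv.symm).trans
    (hlift y).symm

lemma IsWeakGrad.sub (hq : 1 ≤ q) (hp : 1 ≤ p) (ha : MemMixed T q p a) (ha' : MemMixed T q p a')
    (hg : ∀ i, MemMixed T q p (g i)) (hg' : ∀ i, MemMixed T q p (g' i)) (hag : IsWeakGrad T a g)
    (hag' : IsWeakGrad T a' g') :
    IsWeakGrad T (fun z => a z - a' z) fun i z => g i z - g' i z := by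
  have hint {f : T3 → ℝ} {η : T3 → ℝ} (hf : MemLp f p torusMeasure) (hη : Continuous η) :
      Integrable (fun x => f x * η x) torusMeasure := by
    obtain ⟨B, hB⟩ := exists_bound_of_continuous hη
    exact (hf.integrable hp).mul_bdd hη.aestronglyMeasurable (ae_of_all _ hB)
  filter_upwards [hag, hag', MemIter.ae_memLp hq ha, MemIter.ae_memLp hq ha',
    ae_all_iff.2 fun i => MemIter.ae_memLp hq (hg i),
    ae_all_iff.2 fun i => MemIter.ae_memLp hq (hg' i)] with t hweak hweak' haL haL' hgL hgL' i φ hφ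
  simp only [sub_mul]
  rw [integral_sub (hint haL (hφ.continuous_torusPartial i))
    (hint haL' (hφ.continuous_torusPartial i)), integral_sub (hint (hgL i) hφ.continuous)
    (hint (hgL' i) hφ.continuous), hweak i φ hφ, hweak' i φ hφ]
  ring

end WeakGradient

section RegularizedProduct

variable {T : ℝ} {q q' p p' s s' r : ℝ≥0∞} {f g v b θ : ℝ × T3 → ℝ}

lemma norm_integral_mul_mul_le [q.HolderConjugate q'] [p.HolderConjugate p']
    (hf : MemMixed T q p f) (hg : MemMixed T q' p' g) {M : ℝ} (hθ : ∀ z, ‖θ z‖ ≤ M) :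
    ‖∫ z, f z * g z * θ z ∂stMeasure T‖ ≤ (mixedNorm T q p f * mixedNorm T q' p' g).toReal * M := by
  have hi : Integrable (fun z => f z * g z) (stMeasure T) := MemIter.integrable_mul hf hg
  have hM : 0 ≤ M := (norm_nonneg _).trans (hθ 0)
  calc ‖∫ z, f z * g z * θ z ∂stMeasure T‖ ≤ ∫ z, ‖f z * g z‖ * M ∂stMeasure T :=
        norm_integral_le_of_norm_le (hi.norm.mul_const M) (ae_of_all _ fun z => by
          rw [norm_mul]
          gcongr
          exact hθ z)
    _ = (∫⁻ z, ‖f z * g z‖ₑ ∂stMeasure T).toReal * M := by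
        rw [integral_mul_const, integral_norm_eq_lintegral_enorm hi.1]
    _ ≤ (mixedNorm T q p f * mixedNorm T q' p' g).toReal * M := by
        gcongr
        · exact ENNReal.mul_ne_top hf.2.ne hg.2.ne
        · simp only [enorm_mul]
          exact lintegral_enorm_mul_le_iterNorm_mul hf.1 hg.1

lemma integrable_mul_mul_timeExtend [q.HolderConjugate q'] [p.HolderConjugate p'] (hT : 0 ≤ T)
    (hf : MemMixed T q p f) (hg : MemMixed T q' p' g) (θ : C(Icc 0 T × T3, ℝ)) :
    Integrable (fun z => f z * g z * timeExtend hT θ z) (stMeasure T) :=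
  (MemIter.integrable_mul hf hg).mul_bdd (c := ‖θ‖)
    (continuous_timeExtend hT θ.continuous).aestronglyMeasurable
    (ae_of_all _ (norm_timeExtend_le hT θ))

/-- The kernel `K_N(x - y) θ(t, x)` representing the pairing of `spaceConv N v * b` with `θ` as a
pairing of `tensor v b`. -/
def regKernel (N : ℕ) (θ : C(Icc 0 T × T3, ℝ)) : C(Icc 0 T × T3 × T3, ℂ) where
  toFun z := ((torusKernel N (z.2.2 - z.2.1) * θ (z.1, z.2.2) : ℝ) : ℂ)
  continuous_toFun := by fun_prop

lemma integral_tensor_mul_regKernel (hT : 0 ≤ T) (N : ℕ) (θ : C(Icc 0 T × T3, ℝ))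
    (h : Integrable (tensor v b) (tripleMeasure T))
    (hi : Integrable (fun z => spaceConv N v z * b z * timeExtend hT θ z) (stMeasure T)) :
    ∫ z, (tensor v b z : ℂ) * timeExtend hT (regKernel N θ) z ∂tripleMeasure T
      = ((∫ z, spaceConv N v z * b z * timeExtend hT θ z ∂stMeasure T : ℝ) : ℂ) := by
  have hker (t : ℝ) (x y : T3) :
      (tensor v b (t, y, x) : ℂ) * timeExtend hT (regKernel N θ) (t, y, x)
        = ((v (t, y) * torusKernel N (x - y) * (b (t, x) * timeExtend hT θ (t, x)) : ℝ) : ℂ) := by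
    simp only [tensor, timeExtend, regKernel, ContinuousMap.coe_mk]
    push_cast
    ring
  have hti := integrable_mul_timeExtend hT h (regKernel N θ)
  rw [← integral_complex_ofReal]
  refine (integral_prod _ hti).trans (Eq.trans ?_ (integral_prod _ hi.ofReal).symm)
  refine integral_congr_ae ?_
  filter_upwards [hti.prod_right_ae] with t ht
  rw [integral_prod_symm _ ht]
  congr 1 with x
  simp only [hker]
  rw [integral_complex_ofReal, integral_mul_const, mul_assoc]
  rfl

lemma tendsto_integral_spaceConv_mul {v b : ℕ → ℝ × T3 → ℝ} (hT : 0 < T) [q.HolderConjugate q']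
    [s.HolderConjugate s'] (hr : 1 < r) (hp : 1 ≤ p) (hps : p ≤ s) (hs : s ≠ ⊤)
    (hv : BoundedMixed T q p v) (hvr : BoundedMixed T r p v) (hv0 : IsWeaklyNull (stMeasure T) v)
    (hb : BoundedMixed T q' s' b) (hbt : HasBoundedModeDerivs T b) (θ : C(Icc 0 T × T3, ℝ))
    (N : ℕ) :
    Tendsto (fun n => ∫ z, spaceConv N (v n) z * b n z * timeExtend hT.le θ z ∂stMeasure T) atTop
      (𝓝 0) := by
  have hs' : 1 ≤ s' := ENNReal.HolderConjugate.one_le s' s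
  have htensor := tendsto_integral_tensor_mul hT hr hp hs' hv hvr hv0 hb hbt (regKernel N θ)
  simp only [fun n => integral_tensor_mul_regKernel hT.le N θ
    (integrable_tensor hp hs' (hv.memMixed n) (hb.memMixed n))
    (integrable_mul_mul_timeExtend hT.le (memMixed_spaceConv hp hps hs (hv.memMixed n) N)
      (hb.memMixed n) θ)] at htensor
  rwa [← Complex.ofReal_zero, tendsto_ofReal_iff] at htensor

lemma dist_integral_spaceConv_mul_le {g : Fin 3 → ℝ × T3 → ℝ} (hT : 0 ≤ T) [q.HolderConjugate q']
    [s.HolderConjugate s'] (hp : 1 ≤ p) (hps : p ≤ s) (hs : s ≠ ⊤) (hcrit : p⁻¹ < s⁻¹ + 3⁻¹)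
    (hv : MemMixed T q p v) (hg : ∀ i, MemMixed T q p (g i)) (hvg : IsWeakGrad T v g)
    (hb : MemMixed T q' s' b) (θ : C(Icc 0 T × T3, ℝ)) (N : ℕ) :
    dist (∫ z, v z * b z * timeExtend hT θ z ∂stMeasure T)
        (∫ z, spaceConv N v z * b z * timeExtend hT θ z ∂stMeasure T)
      ≤ (approxRate p s N * (∑ i, mixedNorm T q p (g i)) * mixedNorm T q' s' b).toReal * ‖θ‖ := by
  have hq : 1 ≤ q := ENNReal.HolderConjugate.one_le q q'
  have hvs := memMixed_of_isWeakGrad hq hp hps hs hcrit hv hg hvg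
  have hsum : ∑ i, mixedNorm T q p (g i) ≠ ⊤ := ENNReal.sum_ne_top.2 fun i _ => (hg i).2.ne
  rw [dist_eq_norm, ← integral_sub (integrable_mul_mul_timeExtend hT hvs hb θ)
    (integrable_mul_mul_timeExtend hT (memMixed_spaceConv hp hps hs hv N) hb θ)]
  simp only [← sub_mul]
  refine (norm_integral_mul_mul_le (memMixed_sub_spaceConv hq hp hps hs hcrit hv hg hvg N) hb
    (norm_timeExtend_le hT θ)).trans ?_
  gcongr
  · exact ENNReal.mul_ne_top (ENNReal.mul_ne_top (approxRate_ne_top hp hps hs hcrit N) hsum)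
      hb.2.ne
  · exact mixedNorm_sub_spaceConv_le hq hp hps hs hv hg hvg N

theorem tendsto_integral_mul_of_isWeaklyNull {v b : ℕ → ℝ × T3 → ℝ} {g : ℕ → Fin 3 → ℝ × T3 → ℝ}
    (hT : 0 < T) [q.HolderConjugate q'] [s.HolderConjugate s'] (hr : 1 < r) (hp : 1 ≤ p)
    (hps : p ≤ s) (hs : s ≠ ⊤) (hcrit : p⁻¹ < s⁻¹ + 3⁻¹) (hv : BoundedMixed T q p v)
    (hvr : BoundedMixed T r p v) (hv0 : IsWeaklyNull (stMeasure T) v)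
    (hg : ∀ i, BoundedMixed T q p fun n => g n i) (hvg : ∀ n, IsWeakGrad T (v n) (g n))
    (hb : BoundedMixed T q' s' b) (hbt : HasBoundedModeDerivs T b) (θ : C(Icc 0 T × T3, ℝ)) :
    Tendsto (fun n => ∫ z, v n z * b n z * timeExtend hT.le θ z ∂stMeasure T) atTop (𝓝 0) := by
  choose C hC using fun i => (hg i).2
  obtain ⟨D, hD⟩ := hb.2
  set rate : ℕ → ℝ := fun N => (approxRate p s N * (∑ i, (C i : ℝ≥0∞)) * D).toReal * ‖θ‖
  have hsum : ∑ i, (C i : ℝ≥0∞) ≠ ⊤ := ENNReal.sum_ne_top.2 fun _ _ => ENNReal.coe_ne_top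
  have hrate : Tendsto rate atTop (𝓝 0) := by
    have hlim := ENNReal.Tendsto.mul_const (ENNReal.Tendsto.mul_const
      (tendsto_approxRate hp hps hs hcrit) (.inr hsum)) (.inr (ENNReal.coe_ne_top (r := D)))
    have hreal := ((ENNReal.tendsto_toReal (by simp)).comp hlim).mul_const ‖θ‖
    simpa only [zero_mul, ENNReal.toReal_zero, Function.comp_apply] using hreal
  have hle (N n : ℕ) : dist (∫ z, v n z * b n z * timeExtend hT.le θ z ∂stMeasure T)
      (∫ z, spaceConv N (v n) z * b n z * timeExtend hT.le θ z ∂stMeasure T) ≤ rate N := by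
    refine (dist_integral_spaceConv_mul_le hT.le hp hps hs hcrit (hv.memMixed n)
      (fun i => (hg i).memMixed n) (hvg n) (hb.memMixed n) θ N).trans ?_
    refine mul_le_mul_of_nonneg_right (ENNReal.toReal_mono ?_ ?_) (norm_nonneg θ)
    · exact ENNReal.mul_ne_top (ENNReal.mul_ne_top (approxRate_ne_top hp hps hs hcrit N) hsum)
        ENNReal.coe_ne_top
    · gcongr with i
      · exact hC i n
      · exact hD n
  refine TendstoUniformlyOnFilter.tendsto_of_eventually_tendsto (p := atTop) ?_
    (.of_forall fun N => tendsto_integral_spaceConv_mul hT hr hp hps hs hv hvr hv0 hb hbt θ N)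
    tendsto_const_nhds
  rw [Metric.tendstoUniformlyOnFilter_iff]
  intro ε hε
  filter_upwards [(hrate.eventually_lt_const hε).prod_inl atTop] with x hx
  exact (hle x.1 x.2).trans_lt hx

end RegularizedProduct

/-! ### Weak-* convergent families -/

section Exponents

variable {p s : ℝ≥0∞}

lemma conjExponent_conjExponent (hp : 1 ≤ p) : p.conjExponent.conjExponent = p :=
  have := (ENNReal.HolderConjugate.conjExponent hp).symm
  ENNReal.HolderConjugate.conjExponent_eq

lemma one_le_conjExponent (p : ℝ≥0∞) : 1 ≤ p.conjExponent := le_self_add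

lemma conjExponent_anti (h : p ≤ s) : s.conjExponent ≤ p.conjExponent := by
  unfold ENNReal.conjExponent
  gcongr

lemma conjExponent_ne_top (h : 1 < p) : p.conjExponent ≠ ⊤ :=
  ENNReal.add_ne_top.2 ⟨ENNReal.one_ne_top, ENNReal.inv_ne_top.2 (tsub_pos_of_lt h).ne'⟩

lemma inv_lt_inv_add_of_lt_sobolevConjugate (hp : p ≠ 0) (hp3 : p < 3)
    (hs : s < 3 * p / (3 - p)) : p⁻¹ < s⁻¹ + 3⁻¹ := by
  have hpt : p ≠ ⊤ := hp3.ne_top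
  calc p⁻¹ = (3 - p) / (3 * p) + 3⁻¹ := by
        have h3 : (3 : ℝ≥0∞)⁻¹ = p / (3 * p) := by
          rw [mul_comm, ENNReal.div_eq_inv_mul, ENNReal.mul_inv (.inl hp) (.inl hpt), mul_comm,
            ← mul_assoc, ENNReal.mul_inv_cancel hp hpt, one_mul]
        rw [h3, ← ENNReal.add_div, tsub_add_cancel_of_le hp3.le, ENNReal.div_eq_inv_mul,
          ENNReal.mul_inv (.inl (by simp)) (.inl (by simp)), mul_right_comm,
          ENNReal.inv_mul_cancel (by simp) (by simp), one_mul]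
    _ < s⁻¹ + 3⁻¹ := by
        refine ENNReal.add_lt_add_right (by simp) ?_
        rw [← ENNReal.inv_div (.inl ?_) (.inl ?_)]
        · exact ENNReal.inv_lt_inv.2 hs
        · exact ENNReal.sub_ne_top (by simp)
        · exact (tsub_pos_of_lt hp3).ne'

lemma exists_subcritical_exponent_ge (hp : 1 ≤ p) (hpt : p < ⊤) (hst : s < ⊤)
    (hps : p⁻¹ < s⁻¹ + 3⁻¹) :
    ∃ s', s ≤ s' ∧ p ≤ s' ∧ 1 < s' ∧ s' ≠ ⊤ ∧ p⁻¹ < s'⁻¹ + 3⁻¹ := by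
  have h43 : (4 / 3 : ℝ≥0∞) < ⊤ := ENNReal.div_lt_top (by simp) (by simp)
  refine ⟨max (max s p) (4 / 3), (le_max_left _ _).trans (le_max_left _ _),
    (le_max_right _ _).trans (le_max_left _ _), lt_max_of_lt_right ?_,
    (max_lt (max_lt hst hpt) h43).ne, ?_⟩
  · rw [ENNReal.lt_div_iff_mul_lt (by simp) (by simp)]
    norm_num
  · rcases max_choice (max s p) (4 / 3) with h | h <;> rw [h]
    · rcases max_choice s p with h | h <;> rw [h]
      · exact hps
      · exact ENNReal.lt_add_right (ENNReal.inv_ne_top.2 (one_pos.trans_le hp).ne') (by simp)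
    · refine (ENNReal.inv_le_one.2 hp).trans_lt ?_
      rw [ENNReal.inv_div (by simp) (by simp)]
      refine (ENNReal.toReal_lt_toReal (by simp) (by finiteness)).1 ?_
      rw [ENNReal.toReal_add (by finiteness) (by finiteness)]
      norm_num

end Exponents

section WeakStar

variable {T : ℝ} {q p s : ℝ≥0∞} {u : ℝ → ℝ × T3 → ℝ} {u₀ : ℝ × T3 → ℝ} {e : ℕ → ℝ}

lemma TendstoWeakStarMixed.mono_exponent (hp : 1 ≤ p) (hps : p ≤ s)
    (h : TendstoWeakStarMixed T q p.conjExponent u u₀) :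
    TendstoWeakStarMixed T q s.conjExponent u u₀ := by
  refine ⟨fun ε hε => MemIter.mono_exponent (conjExponent_anti hps) (h.1 ε hε),
    MemIter.mono_exponent (conjExponent_anti hps) h.2.1, fun ψ hψ => h.2.2 ψ ?_⟩
  rw [conjExponent_conjExponent (hp.trans hps)] at hψ
  rw [conjExponent_conjExponent hp]
  exact MemIter.mono_exponent hps hψ

lemma TendstoWeakStarMixed.boundedMixed (hq : 1 ≤ q) (hp : 1 ≤ p) (hpt : p ≠ ⊤)
    (h : TendstoWeakStarMixed T q p u u₀) (he : Tendsto e atTop (𝓝[>] 0)) (hpos : ∀ n, 0 < e n) :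
    BoundedMixed T q p fun n => u (e n) := by
  refine ⟨fun n => (h.1 _ (hpos n)).1,
    exists_iterNorm_bound hq hp hpt (fun n => h.1 _ (hpos n)) fun ψ hψ => ?_⟩
  obtain ⟨C, hC⟩ := ((h.2.2 ψ hψ).comp he).norm.bddAbove_range
  exact ⟨C, fun n => hC ⟨n, rfl⟩⟩

lemma TendstoWeakStarMixed.isWeaklyNull_sub (hq : 1 ≤ q) (hp : 1 ≤ p)
    (h : TendstoWeakStarMixed T q p u u₀) (he : Tendsto e atTop (𝓝[>] 0)) (hpos : ∀ n, 0 < e n) :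
    IsWeaklyNull (stMeasure T) fun n z => u (e n) z - u₀ z := by
  have := ENNReal.HolderConjugate.conjExponent hq
  have := ENNReal.HolderConjugate.conjExponent hp
  intro ψ hψ M hM
  have hψm : MemMixed T q.conjExponent p.conjExponent ψ := MemIter.of_bound hψ M (ae_of_all _ hM)
  have hlim := ((h.2.2 ψ hψm).comp he).sub_const (∫ z, u₀ z * ψ z ∂stMeasure T)
  rw [sub_self] at hlim
  refine hlim.congr fun n => ?_
  simp only [Function.comp_apply, sub_mul]
  exact (integral_sub (MemIter.integrable_mul (h.1 _ (hpos n)) hψm)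
    (MemIter.integrable_mul h.2.1 hψm)).symm

lemma TimeDerivBounded.hasBoundedModeDerivs {m : ℤ} {b : ℝ → ℝ × T3 → ℝ}
    (h : TimeDerivBounded T m b) (hpos : ∀ n, 0 < e n)
    (hb : ∀ n, Integrable (b (e n)) (stMeasure T)) : HasBoundedModeDerivs T fun n => b (e n) := by
  obtain ⟨C, hC⟩ := h
  intro k
  refine ⟨((sobolevWeight (-m) (-k))⁻¹ * C).toReal, fun n => ?_⟩
  obtain ⟨w, hwm, hwC, hw⟩ := hC _ (hpos n)
  have hfin l : (sobolevWeight (-m) l)⁻¹ * C ≠ ⊤ :=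
    ENNReal.mul_ne_top (ENNReal.inv_ne_top.2 (sobolevWeight_ne_zero _ l)) ENNReal.coe_ne_top
  have hwi l : Integrable (fun t => w t l) (timeMeasure T) :=
    ⟨hwm l, (lintegral_mode_le hwC l).trans_lt (hfin l).lt_top⟩
  refine ⟨fun t => w t (-k), hwi _, ?_, hw.isScalarWeakDeriv_timeMode (hb n) hwi k⟩
  rw [integral_norm_eq_lintegral_enorm (hwm _)]
  exact ENNReal.toReal_mono (hfin _) (lintegral_mode_le hwC _)

lemma MemMixed.mul_bounded {f θ : ℝ × T3 → ℝ} (hf : MemMixed T q p f)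
    (hθ : AEStronglyMeasurable θ (stMeasure T)) {M : ℝ} (hM : ∀ z, ‖θ z‖ ≤ M) :
    MemMixed T q p fun z => f z * θ z := by
  refine ⟨hf.1.mul hθ, ?_⟩
  calc mixedNorm T q p (fun z => f z * θ z)
      ≤ eLpNorm (fun t => eLpNorm (fun x => f (t, x)) p torusMeasure * ‖M‖ₑ) q (timeMeasure T) := by
        refine eLpNorm_mono_enorm_ae (ae_of_all _ fun t => ?_)
        rw [enorm_eq_self, enorm_eq_self, mul_comm, ← eLpNorm_const_smul]
        refine eLpNorm_mono_enorm fun x => ?_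
        rw [Pi.smul_apply, smul_eq_mul, enorm_mul, enorm_mul, mul_comm]
        gcongr
        exact enorm_le_iff_norm_le.2 ((hM _).trans (le_abs_self M))
    _ = mixedNorm T q p f * ‖M‖ₑ := eLpNorm_mul_const (aemeasurable_eLpNorm_section p hf.1) _
    _ < ⊤ := ENNReal.mul_lt_top hf.2 enorm_lt_top

lemma exists_continuous_extension (hT : 0 ≤ T) {θ : ℝ × T3 → ℝ}
    (hθ : ContinuousOn θ (Icc 0 T ×ˢ univ)) :
    ∃ θ' : C(Icc 0 T × T3, ℝ), θ =ᵐ[stMeasure T] timeExtend hT θ' := by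
  refine ⟨⟨fun z => θ (z.1, z.2), hθ.comp_continuous (by fun_prop) fun z => ⟨z.1.2, mem_univ _⟩⟩,
    ?_⟩
  filter_upwards [(Measure.quasiMeasurePreserving_fst (μ := timeMeasure T)
    (ν := torusMeasure)).ae (ae_mem_Icc T)] with z hz
  simp only [timeExtend, ContinuousMap.coe_mk, projIcc_of_mem hT hz]

end WeakStar

section Product

variable {T : ℝ} {q p s r : ℝ≥0∞} {m : ℤ} {a b : ℝ → ℝ × T3 → ℝ} {a₀ b₀ : ℝ × T3 → ℝ} {e : ℕ → ℝ}

lemma TendstoWeakStarSobolev.memMixed (hq : 1 ≤ q) (hp : 1 ≤ p) (hps : p ≤ s) (hs : s ≠ ⊤)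
    (hcrit : p⁻¹ < s⁻¹ + 3⁻¹) (ha : TendstoWeakStarSobolev T q p a a₀) :
    (∀ ε, 0 < ε → MemMixed T q s (a ε)) ∧ MemMixed T q s a₀ := by
  obtain ⟨ha, G, g, hG, hg, hGg⟩ := ha
  exact ⟨fun ε hε => memMixed_of_isWeakGrad hq hp hps hs hcrit (ha.1 ε hε)
      (fun i => (hGg i).1 ε hε) (hG ε hε),
    memMixed_of_isWeakGrad hq hp hps hs hcrit ha.2.1 (fun i => (hGg i).2.1) hg⟩

lemma tendsto_integral_sub_mul (hT : 0 < T) (hq : 1 ≤ q) (hp : 1 ≤ p) (hps : p ≤ s) (hs1 : 1 < s)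
    (hs : s ≠ ⊤) (hcrit : p⁻¹ < s⁻¹ + 3⁻¹) (hr : 1 < r) (ha : TendstoWeakStarSobolev T q p a a₀)
    (har : TendstoWeakStarMixed T r p a a₀)
    (hb : TendstoWeakStarMixed T q.conjExponent s.conjExponent b b₀)
    (hbt : TimeDerivBounded T m b) (he : Tendsto e atTop (𝓝[>] 0)) (hpos : ∀ n, 0 < e n)
    (θ : C(Icc 0 T × T3, ℝ)) :
    Tendsto (fun n => ∫ z, (a (e n) z - a₀ z) * b (e n) z * timeExtend hT.le θ z ∂stMeasure T)
      atTop (𝓝 0) := by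
  have := ENNReal.HolderConjugate.conjExponent hq
  have := ENNReal.HolderConjugate.conjExponent hs1.le
  have hpt : p ≠ ⊤ := ne_top_of_le_ne_top hs hps
  have hq' := one_le_conjExponent q
  have hs' := one_le_conjExponent s
  obtain ⟨ha, G, g, hG, hg, hGg⟩ := ha
  refine tendsto_integral_mul_of_isWeaklyNull (q' := q.conjExponent) (s' := s.conjExponent)
    (g := fun n i z => G (e n) i z - g i z) hT hr hp hps hs hcrit
    ((ha.boundedMixed hq hp hpt he hpos).sub_const hq hp ha.2.1)
    ((har.boundedMixed hr.le hp hpt he hpos).sub_const hr.le hp har.2.1)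
    (ha.isWeaklyNull_sub hq hp he hpos)
    (fun i => ((hGg i).boundedMixed hq hp hpt he hpos).sub_const hq hp (hGg i).2.1)
    (fun n => (hG _ (hpos n)).sub hq hp (ha.1 _ (hpos n)) ha.2.1 (fun i => (hGg i).1 _ (hpos n))
      (fun i => (hGg i).2.1) hg)
    (hb.boundedMixed hq' hs' (conjExponent_ne_top hs1) he hpos)
    (hbt.hasBoundedModeDerivs hpos fun n => (hb.1 _ (hpos n)).integrable hq' hs') θ

theorem tendsto_integral_product (hT : 0 < T) (hq : 1 ≤ q) (hp : 1 ≤ p) (hps : p ≤ s)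
    (hs1 : 1 < s) (hs : s ≠ ⊤) (hcrit : p⁻¹ < s⁻¹ + 3⁻¹) (hr : 1 < r)
    (ha : TendstoWeakStarSobolev T q p a a₀) (har : TendstoWeakStarMixed T r p a a₀)
    (hb : TendstoWeakStarMixed T q.conjExponent s.conjExponent b b₀)
    (hbt : TimeDerivBounded T m b) (θ : C(Icc 0 T × T3, ℝ)) :
    Tendsto (fun ε => ∫ z, a ε z * b ε z * timeExtend hT.le θ z ∂stMeasure T) (𝓝[>] 0)
      (𝓝 (∫ z, a₀ z * b₀ z * timeExtend hT.le θ z ∂stMeasure T)) := by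
  have := ENNReal.HolderConjugate.conjExponent hq
  have := ENNReal.HolderConjugate.conjExponent hs1.le
  obtain ⟨has, ha₀s⟩ := ha.memMixed hq hp hps hs hcrit
  have hfixed : Tendsto (fun ε => ∫ z, a₀ z * b ε z * timeExtend hT.le θ z ∂stMeasure T) (𝓝[>] 0)
      (𝓝 (∫ z, a₀ z * b₀ z * timeExtend hT.le θ z ∂stMeasure T)) := by
    have hlim := hb.2.2 (fun z => a₀ z * timeExtend hT.le θ z) (by
      rw [conjExponent_conjExponent hq, conjExponent_conjExponent hs1.le]
      exact ha₀s.mul_bounded (continuous_timeExtend hT.le θ.continuous).aestronglyMeasurable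
        (norm_timeExtend_le hT.le θ))
    simpa only [mul_comm, mul_left_comm, mul_assoc] using hlim
  have hdiff : Tendsto (fun ε => ∫ z, (a ε z - a₀ z) * b ε z * timeExtend hT.le θ z ∂stMeasure T)
      (𝓝[>] 0) (𝓝 0) := by
    refine tendsto_of_seq_tendsto fun e he => ?_
    obtain ⟨N, hN⟩ := eventually_atTop.1 (he.eventually self_mem_nhdsWithin)
    rw [← tendsto_add_atTop_iff_nat N]
    exact tendsto_integral_sub_mul hT hq hp hps hs1 hs hcrit hr ha har hb hbt
      (he.comp (tendsto_add_atTop_nat N)) (fun n => hN _ (Nat.le_add_left N n)) θ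
  rw [← zero_add (∫ z, a₀ z * b₀ z * timeExtend hT.le θ z ∂stMeasure T)]
  refine (hdiff.add hfixed).congr' ?_
  filter_upwards [self_mem_nhdsWithin] with ε hε
  have hdiffMem : MemMixed T q s fun z => a ε z - a₀ z :=
    MemIter.sub hq (hp.trans hps) (has ε hε) ha₀s
  rw [← integral_add (integrable_mul_mul_timeExtend hT.le hdiffMem (hb.1 ε hε) θ)
    (integrable_mul_mul_timeExtend hT.le ha₀s (hb.1 ε hε) θ)]
  congr 1 with z
  ring

end Product

end WeakProduct
end

open WeakProduct in
theorem proposition4p2_general (T : ℝ) (hT : 0 < T) (q p s r : ℝ≥0∞) (hq : 1 ≤ q) (hp : 1 ≤ p)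
    (hpt : p < ⊤) (hs : 1 ≤ s) (hst : s < ⊤) (hps : p⁻¹ < s⁻¹ + 3⁻¹) (hr : 1 < r) (m : ℤ)
    (a b : ℝ → ℝ × T3 → ℝ) (a₀ b₀ : ℝ × T3 → ℝ) (ha : TendstoWeakStarSobolev T q p a a₀)
    (hb : TendstoWeakStarMixed T q.conjExponent s.conjExponent b b₀)
    (har : TendstoWeakStarMixed T r p a a₀) (hbt : TimeDerivBounded T m b) :
    (∀ ε : ℝ, 0 < ε → Integrable (fun z => a ε z * b ε z) (stMeasure T)) ∧
    Integrable (fun z => a₀ z * b₀ z) (stMeasure T) ∧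
    ∀ θ : ℝ × T3 → ℝ, ContinuousOn θ (Icc 0 T ×ˢ univ) →
      Tendsto (fun ε => ∫ z, a ε z * b ε z * θ z ∂stMeasure T) (𝓝[>] 0)
        (𝓝 (∫ z, a₀ z * b₀ z * θ z ∂stMeasure T)) := by
  obtain ⟨s', hss', hps', hs'1, hs't, hcrit⟩ := exists_subcritical_exponent_ge hp hpt hst hps
  replace hb := hb.mono_exponent hs hss'
  have := ENNReal.HolderConjugate.conjExponent hq
  have := ENNReal.HolderConjugate.conjExponent hs'1.le
  obtain ⟨has, ha₀s⟩ := ha.memMixed hq hp hps' hs't hcrit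
  refine ⟨fun ε hε => MemIter.integrable_mul (has ε hε) (hb.1 ε hε),
    MemIter.integrable_mul ha₀s hb.2.1, fun θ hθ => ?_⟩
  obtain ⟨θ', hθ'⟩ := exists_continuous_extension hT.le hθ
  have hcongr (f : ℝ × T3 → ℝ) :
      ∫ z, f z * θ z ∂stMeasure T = ∫ z, f z * timeExtend hT.le θ' z ∂stMeasure T :=
    integral_congr_ae (hθ'.mono fun z hz => congrArg (f z * ·) hz)
  simp only [hcongr]
  exact tendsto_integral_product hT hq hp hps' hs'1 hs't hcrit hr ha har hb hbt θ'

theorem proposition4p2 (T : ℝ) (hT : 0 < T) (q p s r : ℝ≥0∞)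
    (hq1 : 1 ≤ q) (hq : q < ⊤) (hp1 : 1 ≤ p) (hp : p < 3)
    (hs1 : 1 ≤ s) (hs : s < 3 * p / (3 - p)) (hr : q < r) (m : ℤ)
    (a b : ℝ → ℝ × WeakProduct.T3 → ℝ) (a₀ b₀ : ℝ × WeakProduct.T3 → ℝ)
    (ha : WeakProduct.TendstoWeakStarSobolev T q p a a₀)
    (hb : WeakProduct.TendstoWeakStarMixed T q.conjExponent s.conjExponent b b₀)
    (har : WeakProduct.TendstoWeakStarMixed T r p a a₀)
    (hbt : WeakProduct.TimeDerivBounded T m b) :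
    (∀ ε : ℝ, 0 < ε → Integrable (fun z => a ε z * b ε z) (WeakProduct.stMeasure T)) ∧
    Integrable (fun z => a₀ z * b₀ z) (WeakProduct.stMeasure T) ∧
    ∀ e : ℕ → ℝ, Tendsto e atTop (𝓝[>] 0) →
      ∃ φ : ℕ → ℕ, StrictMono φ ∧
        ∀ θ : ℝ × WeakProduct.T3 → ℝ, ContinuousOn θ (Icc 0 T ×ˢ univ) →
          Tendsto (fun n => ∫ z, a (e (φ n)) z * b (e (φ n)) z * θ z ∂(WeakProduct.stMeasure T))
            atTop (𝓝 (∫ z, a₀ z * b₀ z * θ z ∂(WeakProduct.stMeasure T))) := by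
  obtain ⟨hab, ha₀b₀, hlim⟩ := proposition4p2_general T hT q p s r hq1 hp1 hp.lt_top hs1 hs.lt_top
    (WeakProduct.inv_lt_inv_add_of_lt_sobolevConjugate (one_pos.trans_le hp1).ne' hp hs)
    (hq1.trans_lt hr) m a b a₀ b₀ ha hb har hbt
  exact ⟨hab, ha₀b₀, fun e he => ⟨id, strictMono_id, fun θ hθ => (hlim θ hθ).comp he⟩⟩
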